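/- **Setting.** Let $(V,Q)$ be a quadratic space over $\mathbb{Q}$ of signature $(p,2)$, with bilinear form $(x,y)=Q(x+y)-Q(x)-Q(y)$. Let $L\subset V$ be an even lattice (that is, $Q(L)\subset\mathbb{Z}$), $L'$ its dual lattice, and $S(L)=\mathbb{C}[L'/L]$, with basis the characteristic functions $\varphi_\mu$ of the cosets $\mu+L$, $\mu\in L'/L$. Write $e(x)=e^{2\pi i x}$ and $\tau=u+iv\in\mathbb{H}$. Let $\mathbb{D}^o(V)$ be the space of oriented negative definite planes $z\subset V(\mathbb{R})$, with its usual topology. For $x\in V$ put $R^o(x,z)=-2Q(\mathrm{proj}_z x)\ge 0$. **Special cycles.** Let $Z(x)=\{z : z\perp x\}$ if $Q(x)>0$, and $Z(x)=\emptyset$ otherwise. Let $Z(m,\mu)=\bigcup_{x\in\mu+L,\,Q(x)=m}Z(x)$ and $Z(m)=\bigcup_\mu Z(m,\mu)$. **Kudla's Green function.** For $m\in\mathbb{Q}$, $w>0$ and $\varphi\in S(L)$ put $$\mathrm{Gr}^K_o(m,w,\varphi)(z)=\sum_{x\in L',\ x\ne0,\ Q(x)=m}\varphi(x)\,\beta\bigl(2\pi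 w R^o(x,z)\bigr),\qquad \beta(r)=\int_r^\infty e^{-t}\,\frac{dt}{t}\quad(r>0),$$ and $\mathrm{Gr}^K_o(m,w,\mu)=\mathrm{Gr}^K_o(m,w,\varphi_\mu)$. **Siegel theta function.** For $\varphi\in S(L)$ put $$\Theta_L(\tau,z)(\varphi)=v\sum_{\lambda\in L'}\varphi(\lambda)\,e\bigl(Q(\mathrm{proj}_{z^\perp}\lambda)\,\tau+Q(\mathrm{proj}_z\lambda)\,\bar\tau\bigr).$$ **Truncated Poincaré series.** Let $\widetilde\Gamma=\mathrm{Mp}_2(\mathbb{Z})$ be the group of pairs $\tilde\gamma=(\gamma,\phi)$ with $\gamma=\left(\begin{smallmatrix}a&b\\c&d\end{smallmatrix}\right)\in\mathrm{SL}_2(\mathbb{Z})$, $\phi$ holomorphic on $\mathbb{H}$ and $\phi(\tau)^2=c\tau+d$. Let $\rho_L$ be the Weil representation of $\widetilde\Gamma$ on $S(L)$, determined by $$\rho_L(\mathbf T)\varphi_\mu=e(-Q(\mu))\varphi_\mu,\qquad \rho_L(\mathbf S)\varphi_\mu=\frac{e((p-2)/8)}{\sqrt{|L'/L|}}\sum_{\nu\in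 L'/L}e((\mu,\nu))\varphi_\nu,$$ where $\mathbf T=\left(\left(\begin{smallmatrix}1&1\\0&1\end{smallmatrix}\right),1\right)$ and $\mathbf S=\left(\left(\begin{smallmatrix}0&-1\\1&0\end{smallmatrix}\right),\sqrt\tau\right)$. Let $k=1-p/2$, let $(f|_k[\tilde\gamma])(\tau)=\phi(\tau)^{-2k}\rho_L(\tilde\gamma)^{-1}f(\gamma\tau)$, and let $\sigma_w(\tau)=1$ if $v\ge w$ and $\sigma_w(\tau)=0$ otherwise. For $m\in Q(\mu)+\mathbb{Z}$ put $$P_{m,w,\mu}(\tau)=\frac14\sum_{\tilde\gamma\in\langle\mathbf T\rangle\backslash\widetilde\Gamma}\bigl(\sigma_w(\tau)\,e^{-2\pi i m\tau}\varphi_\mu\bigr)\big|_k[\tilde\gamma],$$ and put $P_{m,w,\mu}=0$ if $m\notin Q(\mu)+\mathbb{Z}$. For $\varphi=\sum_\mu a_\mu\varphi_\mu$ put $P_{m,w}(\varphi)=\sum_\mu a_\mu P_{m,w,\mu}$. **Regularized pairing.** For $f:\mathbb{H}\to S(L)$ and $g:\mathbb{H}\to S(L)^\vee$ put $$\langle f,g\rangle^{\mathrm{reg}}=\mathrm{CT}_{s=0}\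 \lim_{T\to\infty}\int_{\mathcal F_T}g(\tau)(f(\tau))\,v^{-s}\,\frac{du\,dv}{v^2},\qquad \mathcal F_T=\{\tau\in\mathbb{H} : |\tau|\ge1,\ |u|\le\tfrac12,\ v\le T\}.$$ It is said to exist if, for $\mathrm{Re}(s)$ large, the limit exists, is holomorphic in $s$, and continues meromorphically to $\mathrm{Re}(s)>-\varepsilon$ for some $\varepsilon>0$. Here $\mathrm{CT}_{s=0}$ is the constant term of the Laurent expansion at $s=0$. **Theorem.** Let $w>0$. 1. For all $m\in\mathbb{Q}$, $\mu\in L'/L$ and $z\in\mathbb{D}^o(V)$, the pairing $\langle P_{m,w,\mu},\Theta_L(\cdot,z)\rangle^{\mathrm{reg}}$ exists. 2. If $m\ne0$ and $z\notin Z(m,\mu)$, then the series $\mathrm{Gr}^K_o(m,w,\mu)(z)$ converges absolutely and $$\mathrm{Gr}^K_o(m,w,\mu)(z)=\langle P_{m,w,\mu},\Theta_L(\cdot,z)\rangle^{\mathrm{reg}}.$$ 3. For $m=0$ and all $z\in\mathbb{D}^o(V)$, the series converges absolutely and $$\mathrm{Gr}^K_o(0,w,\mu)(z)=\langle P_{0,w,\mu},\Theta_L(\cdot,z)\rangle^{\mathrm{reg}}+\delta_{\mu,0}\log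 w.$$ 4. By 1 and 2, for $m\neq 0$ the function $z\mapsto\langle P_{m,w,\mu},\Theta_L(\cdot,z)\rangle^{\mathrm{reg}}$ extends $\mathrm{Gr}^K_o(m,w,\mu)$ to all of $\mathbb{D}^o(V)$. This extension is discontinuous at every point of $Z(m,\mu)$. 5. The same holds with values in $S(L)^\vee$. For all $\varphi\in S(L)$, $m\in\mathbb{Q}$ and $z\in\mathbb{D}^o(V)$, the pairing $\langle P_{m,w}(\varphi),\Theta_L(\cdot,z)\rangle^{\mathrm{reg}}$ exists. It equals $\mathrm{Gr}^K_o(m,w,\varphi)(z)$, the series converging absolutely, if $m\neq0$ and $z\notin Z(m)$. For $m=0$ and all $z$, the series converges absolutely and $\mathrm{Gr}^K_o(0,w,\varphi)(z)=\langle P_{0,w}(\varphi),\Theta_L(\cdot,z)\rangle^{\mathrm{reg}}+\log(w)\,\varphi(0)$. -/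

import Mathlib

open scoped TensorProduct MatrixGroups Manifold Topology
open UpperHalfPlane MeasureTheory Filter

noncomputable section

namespace KudlaGreen

/-! ### The metaplectic group `Mp₂(ℤ)` -/

/-- Elements of `Mp₂(ℤ)`: pairs `(γ, φ)` with `γ ∈ SL₂(ℤ)` and `φ` a holomorphic function on the
upper half-plane such that `φ(τ)² = cτ + d`. -/
@[ext]
structure Mp2Z where
  mat : SL(2, ℤ)
  root : ℍ → ℂ
  root_holo : MDifferentiable 𝓘(ℂ) 𝓘(ℂ) root
  root_sq : ∀ τ : ℍ, root τ ^ 2 = ((mat 1 0 : ℤ) : ℂ) * (τ : ℂ) + ((mat 1 1 : ℤ) : ℂ)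

namespace Mp2Z

lemma root_sq' (g : Mp2Z) (τ : ℍ) : g.root τ ^ 2 = denom (g.mat : GL (Fin 2) ℝ) τ := by
  rw [g.root_sq, ModularGroup.denom_apply]

lemma root_ne_zero (g : Mp2Z) (τ : ℍ) : g.root τ ≠ 0 := by
  intro h
  have h1 := g.root_sq' τ
  rw [h] at h1
  exact denom_ne_zero _ τ (by rw [← h1]; norm_num)

lemma mdiff_smul (γ : SL(2, ℤ)) : MDifferentiable 𝓘(ℂ) 𝓘(ℂ) (fun τ : ℍ => γ • τ) := by
  have := UpperHalfPlane.mdifferentiable_smul (g := (γ : GL (Fin 2) ℝ)) (by simp)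
  exact this

lemma denom_mul_coe (γ δ : SL(2, ℤ)) (τ : ℍ) :
    denom ((γ * δ : SL(2, ℤ)) : GL (Fin 2) ℝ) τ
      = denom (γ : GL (Fin 2) ℝ) ((δ • τ : ℍ) : ℂ) * denom (δ : GL (Fin 2) ℝ) τ := by
  have h := denom_cocycle_σ (γ : GL (Fin 2) ℝ) (δ : GL (Fin 2) ℝ) τ
  simpa [σ] using h

/-- `(γ₁, φ₁)(γ₂, φ₂) = (γ₁γ₂, φ₁(γ₂τ)φ₂(τ))`. -/
instance : Mul Mp2Z where
  mul g h :=
    { mat := g.mat * h.mat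
      root := fun τ => g.root (h.mat • τ) * h.root τ
      root_holo := (g.root_holo.comp (mdiff_smul h.mat)).mul h.root_holo
      root_sq := fun τ => by
        rw [mul_pow, root_sq', root_sq', ← ModularGroup.denom_apply, denom_mul_coe] }

instance : One Mp2Z where
  one :=
    { mat := 1
      root := fun _ => 1
      root_holo := mdifferentiable_const
      root_sq := fun τ => by simp }

instance : Inv Mp2Z where
  inv g :=
    { mat := g.mat⁻¹
      root := fun τ => (g.root (g.mat⁻¹ • τ))⁻¹
      root_holo := by
        have h := g.root_holo.comp (mdiff_smul g.mat⁻¹)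
        intro τ
        exact MDifferentiableAt.inv (h τ) (g.root_ne_zero _)
      root_sq := fun τ => by
        rw [inv_pow, root_sq', ← ModularGroup.denom_apply]
        have h := denom_mul_coe g.mat g.mat⁻¹ τ
        rw [mul_inv_cancel] at h
        have h1 : denom ((1 : SL(2, ℤ)) : GL (Fin 2) ℝ) τ = 1 := by simp
        rw [h1] at h
        exact inv_eq_of_mul_eq_one_right h.symm }

@[simp] lemma mul_mat (g h : Mp2Z) : (g * h).mat = g.mat * h.mat := rfl
@[simp] lemma mul_root (g h : Mp2Z) (τ : ℍ) :
    (g * h).root τ = g.root (h.mat • τ) * h.root τ := rfl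
@[simp] lemma one_mat : (1 : Mp2Z).mat = 1 := rfl
@[simp] lemma one_root (τ : ℍ) : (1 : Mp2Z).root τ = 1 := rfl
@[simp] lemma inv_mat (g : Mp2Z) : (g⁻¹).mat = g.mat⁻¹ := rfl
@[simp] lemma inv_root (g : Mp2Z) (τ : ℍ) : (g⁻¹).root τ = (g.root (g.mat⁻¹ • τ))⁻¹ := rfl

instance : Group Mp2Z :=
  Group.ofLeftAxioms
    (fun a b c => by
      ext τ
      · simp [mul_assoc]
      · simp [mul_assoc, mul_smul])
    (fun a => by
      ext τ <;> simp)
    (fun a => by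
      ext τ
      · simp
      · simp [a.root_ne_zero])

/-- The element `T = ((1 1; 0 1), 1)`. -/
def T : Mp2Z where
  mat := ModularGroup.T
  root := fun _ => 1
  root_holo := mdifferentiable_const
  root_sq := fun τ => by simp [ModularGroup.T]

/-- The subgroup `Γ̃_∞` generated by `T`. -/
def GammaInf : Subgroup Mp2Z := Subgroup.zpowers T

/-- The sign `ε` with `φ = ε √(cτ + d)` (principal branch, arguments in `(-π, π]`). As `φ` and the
principal branch are continuous on `ℍ`, `ε` can be read off at `τ = i`. -/
def sign (g : Mp2Z) : ℂ :=
  g.root UpperHalfPlane.I /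
    ((((g.mat 1 0 : ℤ) : ℂ) * Complex.I + ((g.mat 1 1 : ℤ) : ℂ)) ^ (1 / 2 : ℂ))

end Mp2Z

/-! ### Lattices and the Weil representation -/

section Lattice

variable {V : Type*} [AddCommGroup V] [Module ℚ V]

/-- `Q` is nondegenerate of signature `(p, q)`. -/
def HasSignature (Q : QuadraticForm ℚ V) (p q : ℕ) : Prop :=
  Module.finrank ℚ V = p + q ∧ sigPos Q = p ∧ sigNeg Q = q

/-- A lattice is even if `Q` is integral on it. -/
def IsEven (Q : QuadraticForm ℚ V) (L : Submodule ℤ V) : Prop :=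
  ∀ x ∈ L, ∃ n : ℤ, Q x = n

variable (Q : QuadraticForm ℚ V) (L : Submodule ℤ V)

/-- The bilinear form `(x, y) = Q(x + y) - Q(x) - Q(y)`. -/
abbrev bil (x y : V) : ℚ := QuadraticMap.polarBilin Q x y

/-- The dual lattice `L'`. -/
abbrev dualLattice : Submodule ℤ V :=
  LinearMap.BilinForm.dualSubmodule (QuadraticMap.polarBilin Q) L

/-- The discriminant group `L'/L`. -/
abbrev Disc : Type _ := dualLattice Q L ⧸ L.submoduleOf (dualLattice Q L)

/-- The class in `L'/L` of an element of `L'`. -/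
abbrev toDisc (x : dualLattice Q L) : Disc Q L := Submodule.Quotient.mk x

/-- The space `S(L) ≃ ℂ[L'/L]`. An element `φ` is a function on `L'/L`, its value at `x ∈ L'` is
`φ (toDisc Q L x)`. -/
abbrev SchwartzL : Type _ := Disc Q L → ℂ

open scoped Classical in
/-- The characteristic function `φ_μ` of the coset `μ + L`. -/
def basisVec (μ : Disc Q L) : SchwartzL Q L := Pi.single μ 1

/-- `m ∈ Q(μ) + ℤ`. -/
def IsCongr (m : ℚ) (μ : Disc Q L) : Prop :=
  ∃ (x : dualLattice Q L) (n : ℤ), toDisc Q L x = μ ∧ m = Q (x : V) + n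

/-- `e(x) = exp(2πix)`. -/
def ee (x : ℚ) : ℂ := Complex.exp (2 * Real.pi * Complex.I * (x : ℂ))

/-- `√i = exp(πi/4)`. -/
def sqrtI : ℂ := Complex.exp (Real.pi * Complex.I / 4)

open scoped Classical in
/-- The matrix coefficients of the Weil representation `ρ_L` of `Mp₂(ℤ)` on `S(L)`, for a lattice
of signature `(p, q)` with `s = p - q`, in the explicit form due to Shintani:
`ρ_L(γ̃) φ_ν = ∑_μ weilCoeff γ̃ μ ν • φ_μ`.
This is the restriction to `Mp₂(ℤ)` of the Weil representation of `Mp₂(𝔸_f)` on `S(V(𝔸_f))`;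
on generators it gives, with `(·,·)` the bilinear form,
`ρ_L(T) φ_μ = e(-Q(μ)) φ_μ`, `ρ_L(S) φ_μ = √i^(p - q) |L'/L|^(-1/2) ∑_ν e((μ, ν)) φ_ν`.
None of the expressions depends on the chosen representatives of `μ, ν ∈ L'/L`, `r ∈ L/cL`. -/
def weilCoeff (s : ℤ) (g : Mp2Z) (μ ν : Disc Q L) : ℂ :=
  let a : ℤ := g.mat 0 0
  let b : ℤ := g.mat 0 1
  let c : ℤ := g.mat 1 0
  let d : ℤ := g.mat 1 1
  let x : V := (μ.out : dualLattice Q L)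
  let y : V := (ν.out : dualLattice Q L)
  g.sign ^ s *
    if c = 0 then
      sqrtI ^ (s * (1 - d.sign)) * (if μ = a • ν then ee (-((a * b : ℤ) : ℚ) * Q x) else 0)
    else
      sqrtI ^ (s * c.sign) /
          ((Real.sqrt (|(c : ℝ)| ^ Module.finrank ℚ V) * Real.sqrt (Nat.card (Disc Q L)) : ℝ) : ℂ) *
        ∑ᶠ r : L ⧸ (Ideal.span {c} • (⊤ : Submodule ℤ L)),
          ee (-((a : ℚ) * bil Q (x + (r.out : L)) (x + (r.out : L))
                - 2 * bil Q y (x + (r.out : L)) + (d : ℚ) * bil Q y y) / (2 * (c : ℚ)))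

/-- The Weil representation `ρ_L(γ̃)` as an operator on `S(L)`. -/
def weilRep (s : ℤ) (g : Mp2Z) (φ : SchwartzL Q L) : SchwartzL Q L :=
  fun μ => ∑ᶠ ν : Disc Q L, weilCoeff Q L s g μ ν * φ ν

/-- The slash operator of weight `k`, where `k2 = 2k`:
`(f ∣_k [γ̃])(τ) = φ(τ)^(-2k) ρ_L(γ̃)⁻¹ f(γτ)`, where `ρ_L(γ̃)⁻¹ = ρ_L(γ̃⁻¹)`. -/
def slash (s k2 : ℤ) (g : Mp2Z) (f : ℍ → SchwartzL Q L) : ℍ → SchwartzL Q L :=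
  fun τ => g.root τ ^ (-k2) • weilRep Q L s g⁻¹ (f (g.mat • τ))

/-! ### Truncated Poincaré series -/

/-- The cutoff function `σ_w`. -/
def cutoff (w : ℝ) (τ : ℍ) : ℂ := if w ≤ τ.im then 1 else 0

open scoped Classical in
/-- The truncated Poincaré series `P_{m,w,μ}` of weight `k`, where `k2 = 2k`. It is
`¼ ∑_{γ̃ ∈ Γ̃_∞ \ Γ̃} (σ_w(τ) e^(-2πimτ) φ_μ) ∣_k [γ̃]` if `m ∈ Q(μ) + ℤ`, and zero otherwise.
For fixed `τ` the sum is finite, and its terms depend only on the coset of `γ̃`. -/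
def truncPoincare (s k2 : ℤ) (m : ℚ) (w : ℝ) (μ : Disc Q L) : ℍ → SchwartzL Q L :=
  fun τ =>
    if IsCongr Q L m μ then
      (1 / 4 : ℂ) • ∑ᶠ c : Quotient (QuotientGroup.rightRel Mp2Z.GammaInf),
        slash Q L s k2 c.out
          (fun t => (cutoff w t * Complex.exp (-2 * Real.pi * Complex.I * (m : ℂ) * (t : ℂ))) •
            basisVec Q L μ) τ
    else 0

/-- The `S(L)^∨ ⊗ S(L)`-valued series `P_{m,w}`, as the function `φ ↦ P_{m,w}(·)(φ)`, given by
`P_{m,w}(τ)(∑ a_μ φ_μ) = ∑ a_μ P_{m,w,μ}(τ)`. -/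
def truncPoincareVec (s k2 : ℤ) (m : ℚ) (w : ℝ) (φ : SchwartzL Q L) : ℍ → SchwartzL Q L :=
  fun τ => ∑ᶠ μ : Disc Q L, φ μ • truncPoincare Q L s k2 m w μ τ

/-! ### The symmetric space -/

/-- The real space `V(ℝ)`. -/
abbrev RealSpace (V : Type*) [AddCommGroup V] [Module ℚ V] : Type _ := ℝ ⊗[ℚ] V

/-- The extension of `Q` to `V(ℝ)`. -/
abbrev realForm : QuadraticForm ℝ (RealSpace V) := Q.baseChange ℝ

/-- The image of `x ∈ V` in `V(ℝ)`. -/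
abbrev toReal (x : V) : RealSpace V := (1 : ℝ) ⊗ₜ[ℚ] x

/-- The symmetric space `𝔻ᵒ(V)` of oriented negative definite planes in `V(ℝ)`. -/
structure SymSpace where
  plane : Submodule ℝ (RealSpace V)
  finrank_plane : Module.finrank ℝ plane = 2
  neg_def : ∀ x ∈ plane, x ≠ 0 → realForm Q x < 0
  orient : Orientation ℝ plane (Fin 2)

/-- Ordered bases of negative definite planes. -/
def NegFrame : Type _ :=
  {e : Fin 2 → RealSpace V // LinearIndependent ℝ e ∧
    ∀ x ∈ Submodule.span ℝ (Set.range e), x ≠ 0 → realForm Q x < 0}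

variable {Q} in
/-- The oriented plane spanned by an ordered basis. -/
def NegFrame.toSymSpace (e : NegFrame Q) : SymSpace Q where
  plane := Submodule.span ℝ (Set.range e.1)
  finrank_plane := by
    rw [finrank_span_eq_card e.2.1]; simp
  neg_def := e.2.2
  orient := (Module.Basis.span e.2.1).orientation

/-- The topology on ordered bases, as a subspace of `V(ℝ)²`, where the finite dimensional real
vector space `V(ℝ)` carries its canonical topology. -/
instance : TopologicalSpace (NegFrame Q) :=
  letI : TopologicalSpace (RealSpace V) := moduleTopology ℝ (RealSpace V)
  instTopologicalSpaceSubtype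

/-- The topology of `𝔻ᵒ(V)`: the quotient topology of the space of ordered bases. -/
instance : TopologicalSpace (SymSpace Q) :=
  TopologicalSpace.coinduced NegFrame.toSymSpace inferInstance

variable {Q} [FiniteDimensional ℚ V]

lemma SymSpace.isCompl (z : SymSpace Q) :
    IsCompl z.plane
      (LinearMap.BilinForm.orthogonal (QuadraticMap.polarBilin (realForm Q)) z.plane) := by
  refine LinearMap.BilinForm.isCompl_orthogonal_of_restrict_nondegenerate ?_ ?_
  · intro x y h
    rwa [QuadraticMap.polarBilin_apply_apply, QuadraticMap.polar_comm] at h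
  · have key : ∀ x : z.plane,
        (LinearMap.BilinForm.restrict (QuadraticMap.polarBilin (realForm Q)) z.plane) x x = 0 →
          x = 0 := by
      intro x hx
      by_contra hne
      have h1 := z.neg_def x x.2 (fun h => hne (Subtype.ext h))
      have h2 : QuadraticMap.polar (realForm Q) (x : RealSpace V) (x : RealSpace V) = 0 := hx
      rw [QuadraticMap.polar_self] at h2
      have h3 : (2 : ℝ) * realForm Q (x : RealSpace V) = 0 := by simpa using h2
      linarith
    exact ⟨fun x hx => key x (hx x), fun x hx => key x (hx x)⟩

/-- The orthogonal projection `proj_z` onto the plane `z`. -/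
def proj (z : SymSpace Q) (x : RealSpace V) : RealSpace V :=
  Submodule.projection z.plane _ z.isCompl x

/-- `Rᵒ(x, z) = -2 Q(proj_z(x))`. -/
def Ro (x : V) (z : SymSpace Q) : ℝ := -2 * realForm Q (proj z (toReal x))

/-- `Z(x)`: the planes orthogonal to `x` if `x` has positive norm, and `∅` otherwise. -/
def cycleOf (x : V) : Set (SymSpace Q) :=
  {z | 0 < Q x ∧ ∀ y ∈ z.plane, QuadraticMap.polarBilin (realForm Q) (toReal x) y = 0}

/-- The support of the special cycle `Z(m, μ) = ∑_{x ∈ μ + L, Q(x) = m} Z(x)`. -/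
def specialCycle (m : ℚ) (μ : Disc Q L) : Set (SymSpace Q) :=
  {z | ∃ x : dualLattice Q L, toDisc Q L x = μ ∧ Q (x : V) = m ∧ z ∈ cycleOf (x : V)}

/-- The support of the `S(L)^∨`-valued special cycle `Z(m)`. -/
def specialCycleVec (m : ℚ) : Set (SymSpace Q) := ⋃ μ : Disc Q L, specialCycle L m μ

/-! ### Kudla's Green function -/

/-- `β(r) = ∫_r^∞ e^(-t) dt/t` for `r > 0`. -/
def beta (r : ℝ) : ℝ := ∫ t in Set.Ioi r, Real.exp (-t) / t

/-- The term `φ(x) β(2πw Rᵒ(x, z))` of Kudla's Green function. -/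
def greenTerm (w : ℝ) (φ : SchwartzL Q L) (z : SymSpace Q) (x : dualLattice Q L) : ℂ :=
  φ (toDisc Q L x) * (beta (2 * Real.pi * w * Ro (x : V) z) : ℂ)

/-- The index set of Kudla's Green function: the nonzero `x ∈ L'` with `Q(x) = m` (for `m ≠ 0`
all `x ∈ L'` with `Q(x) = m`). -/
def GreenIndex (Q : QuadraticForm ℚ V) (L : Submodule ℤ V) (m : ℚ) : Type _ :=
  {x : dualLattice Q L // Q (x : V) = m ∧ x ≠ 0}

/-- Kudla's Green function `Grᵒ(m, w, φ)(z)`. -/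
def kudlaGreen (m : ℚ) (w : ℝ) (φ : SchwartzL Q L) (z : SymSpace Q) : ℂ :=
  ∑' x : GreenIndex Q L m, greenTerm L w φ z x.1

/-- The series defining `Grᵒ(m, w, φ)(z)` converges absolutely. -/
def KudlaGreenConverges (m : ℚ) (w : ℝ) (φ : SchwartzL Q L) (z : SymSpace Q) : Prop :=
  Summable fun x : GreenIndex Q L m => greenTerm L w φ z x.1

/-! ### The Siegel theta function -/

/-- The Siegel theta function: the functional on `S(L)`
`Θ_L(τ, z)(φ) = v ∑_{λ ∈ L'} φ(λ) exp(2πi (Q(proj_{z^⊥} λ) τ + Q(proj_z λ) τ̄))`. -/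
def siegelTheta (τ : ℍ) (z : SymSpace Q) (φ : SchwartzL Q L) : ℂ :=
  (τ.im : ℂ) * ∑' x : dualLattice Q L, φ (toDisc Q L x) *
    Complex.exp (2 * Real.pi * Complex.I *
      ((realForm Q (toReal (x : V) - proj z (toReal (x : V))) : ℂ) * (τ : ℂ) +
        (realForm Q (proj z (toReal (x : V))) : ℂ) * (starRingEnd ℂ) (τ : ℂ)))

end Lattice

/-! ### Regularized integrals -/

/-- The truncated fundamental domain `ℱ_T`. -/
def truncFD (T : ℝ) : Set ℍ := {τ | 1 ≤ ‖(τ : ℂ)‖ ∧ |τ.re| ≤ 1 / 2 ∧ τ.im ≤ T}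

/-- `c` is the constant term of the Laurent expansion at `s = 0` of `Φ`: on a punctured
neighbourhood of `0`, `Φ(s) = ∑_{1 ≤ j ≤ N} a_j s^(-j) + h(s)`, with `h` analytic at `0`
and `h(0) = c`. -/
def HasConstantTerm (Φ : ℂ → ℂ) (c : ℂ) : Prop :=
  ∃ (N : ℕ) (a : ℕ → ℂ) (h : ℂ → ℂ), AnalyticAt ℂ h 0 ∧ h 0 = c ∧
    ∀ᶠ s in 𝓝[≠] (0 : ℂ), Φ s = ∑ j ∈ Finset.Icc 1 N, a j / s ^ j + h s

/-- The regularized integral `CT_{s=0} lim_{T → ∞} ∫_{ℱ_T} F(τ) v^(-s) dμ(τ)`, with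
`dμ = du dv / v²`, exists and equals `c`: for `Re(s)` large, the limit exists and is holomorphic
in `s`, it has a meromorphic continuation `Φ` to `Re(s) > -ε` for some `ε > 0`, and the constant
term of `Φ` at `s = 0` is `c`. (Mathlib's `volume` on `ℍ` is the hyperbolic measure.) -/
def HasRegularizedIntegral (F : ℍ → ℂ) (c : ℂ) : Prop :=
  ∃ (σ₀ ε : ℝ) (Φ : ℂ → ℂ), 0 < ε ∧ MeromorphicOn Φ {s | -ε < s.re} ∧
    DifferentiableOn ℂ Φ {s | σ₀ < s.re} ∧
    (∀ s : ℂ, σ₀ < s.re →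
      (∀ T : ℝ, IntegrableOn (fun τ : ℍ => F τ * (τ.im : ℂ) ^ (-s)) (truncFD T)) ∧
      Tendsto (fun T : ℝ => ∫ τ in truncFD T, F τ * (τ.im : ℂ) ^ (-s)) atTop (𝓝 (Φ s))) ∧
    HasConstantTerm Φ c

/-- The regularized pairing `⟨f, g⟩^reg` of `f : ℍ → S` and `g : ℍ → S^∨` exists. -/
def RegPairingExists {S : Type*} (f : ℍ → S) (g : ℍ → S → ℂ) : Prop :=
  ∃ c, HasRegularizedIntegral (fun τ => g τ (f τ)) c

open scoped Classical in
/-- The regularized pairing `⟨f, g⟩^reg` of `f : ℍ → S` and `g : ℍ → S^∨`, when it exists. -/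
def regPairing {S : Type*} (f : ℍ → S) (g : ℍ → S → ℂ) : ℂ :=
  if h : RegPairingExists f g then h.choose else 0

section ThetaLift

variable {V : Type*} [AddCommGroup V] [Module ℚ V] [FiniteDimensional ℚ V]
  {Q : QuadraticForm ℚ V} (L : Submodule ℤ V)

/-- For `V` of signature `(p, 2)`: the truncated Poincaré series `P_{m,w,μ}` of weight
`k = 1 - p/2`, i.e. `2k = 2 - p`. -/
def poincare (p : ℕ) (m : ℚ) (w : ℝ) (μ : Disc Q L) : ℍ → SchwartzL Q L :=
  truncPoincare Q L ((p : ℤ) - 2) (2 - (p : ℤ)) m w μ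

/-- For `V` of signature `(p, 2)`: the series `P_{m,w}(·)(φ)` of weight `k = 1 - p/2`. -/
def poincareVec (p : ℕ) (m : ℚ) (w : ℝ) (φ : SchwartzL Q L) : ℍ → SchwartzL Q L :=
  truncPoincareVec Q L ((p : ℤ) - 2) (2 - (p : ℤ)) m w φ

/-- The function `Θ_L(·, z)` on `ℍ`. -/
def thetaAt (z : SymSpace Q) : ℍ → SchwartzL Q L → ℂ := fun τ => siegelTheta L τ z

end ThetaLift

end KudlaGreen

end

noncomputable section

namespace KudlaGreen

/-! ### Negative definite planes, their complements and adapted real bases -/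

section Geometry

open Module

/-! The pairing is computed by unfolding. Poisson summation for the Gaussians attached to `z` shows
that the Siegel theta function transforms under `Mp2Z` dually to the Weil representation in
Shintani's form (`siegelTheta_slash`). Pairing it with one term of the Poincaré series therefore
gives the value at `γτ` of a single scalar function, the cutoff times `e(-mτ) Θ(τ, z)(φ_μ)`
(`thetaAt_poincare`). This function has period 1 and vanishes below height `w`, so the integral over
the fundamental domain becomes an integral over the strip `-1/2 < u ≤ 1/2`, `v ≥ w`. Integration in
`u` keeps exactly the `x ∈ μ + L` with `Q(x) = m`, and each of them contributes `v exp(-2πv R(x,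
z))` (`integral_thetaTwist`).

If `R(x, z) > 0`, the remaining integral of `exp(-2πvR) dv/v` over `(w, ∞)` is `β(2πwR)`, a term of
Kudla's Green function. If `R(x, z) = 0`, that is `x ⊥ z`, the integral of `dv/v` diverges and its
regularization is `-log w`. With `N` the finite number of such `x`, the pairing equals `∑ β(2πwR(x,
z)) - N log w` (`hasRegularizedIntegral_pairing`).

The factor `v^(-s)` is not invariant under `SL₂(ℤ)`, so it cannot be unfolded along with the series.
The domain is cut at a height `A`. Below `A` the integral is entire in `s` and only its value at `s
= 0` is needed, where unfolding applies. Above `A` only the trivial coset contributes, and the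
integral in `v` is explicit up to an entire function (`UnfoldingData.hasRegularizedIntegral`).

The remaining assertions are read off from this formula. A nonzero `x ⊥ z` has `Q(x) > 0`, because
`z^⊥` is positive definite. Hence `N = 0` if `m ≠ 0` and `z` is off the cycle. For `m = 0` only the
zero vector is counted, which yields the term `δ_{μ,0} log w`. At a point of the cycle the value is
still finite, whereas along a suitable path leaving the cycle (`exists_path`) one term `β(2πwR)`
tends to infinity as the path returns to that point; this is the discontinuity. -/

lemma exists_basis_of_posDef {M : Type*} [AddCommGroup M] [Module ℝ M] [FiniteDimensional ℝ M]
    (q : QuadraticForm ℝ M) (hq : ∀ x, x ≠ 0 → 0 < q x) :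
    ∃ b : Basis (Fin (finrank ℝ M)) ℝ M, ∀ x, q x = (∑ i, (b.repr x i) ^ 2) / 2 := by
  have hsep : LinearMap.SeparatingLeft (QuadraticMap.associated (R := ℝ) q) := by
    intro x hx
    by_contra hne
    have h1 := hx x
    rw [QuadraticMap.associated_eq_self_apply] at h1
    exact (hq x hne).ne' h1
  obtain ⟨w, hw, ⟨e⟩⟩ := QuadraticForm.equivalent_one_neg_one_weighted_sum_squared q hsep
  have hw1 : ∀ i, w i = 1 := by
    intro i
    rcases hw i with h | h
    · exfalso
      have h1 := hq (e.symm (Pi.single i 1)) (by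
        intro h0
        have h2 : e (e.symm (Pi.single i 1)) = 0 := by rw [h0]; exact map_zero e.toLinearEquiv
        have h3 : e (e.symm (Pi.single i (1 : ℝ))) = Pi.single i 1 :=
          e.toLinearEquiv.apply_symm_apply _
        rw [h3] at h2
        have := congrFun h2 i
        simp at this)
      rw [QuadraticMap.IsometryEquiv.map_app e.symm, QuadraticMap.weightedSumSquares_apply,
        Finset.sum_eq_single i] at h1
      · simp [h] at h1
        linarith
      · intro j _ hj; simp [Pi.single_eq_of_ne hj]
      · simp
    · exact h
  have h2 : (√2 : ℝ) ≠ 0 := by positivity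
  -- Rescaling by √2 makes `q` half the sum of squares, so that the polar form, rather than `q`, is
  -- the standard dot product.
  refine ⟨Basis.ofEquivFun (e.toLinearEquiv.trans (LinearEquiv.smulOfNeZero ℝ _ (√2 : ℝ) h2)), ?_⟩
  intro x
  have h3 := QuadraticMap.IsometryEquiv.map_app e x
  rw [← h3, QuadraticMap.weightedSumSquares_apply]
  simp only [hw1, Basis.ofEquivFun_repr_apply, LinearEquiv.trans_apply,
    LinearEquiv.smulOfNeZero_apply, Pi.smul_apply, smul_eq_mul, mul_pow]
  rw [Real.sq_sqrt (by norm_num), ← Finset.mul_sum, ← Finset.mul_sum, one_mul,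
    mul_div_cancel_left₀ _ (by norm_num)]
  exact Finset.sum_congr rfl fun i _ => (pow_two _).symm

variable {V : Type*} [AddCommGroup V] [Module ℚ V]

lemma realForm_toReal (Q : QuadraticForm ℚ V) (x : V) : realForm Q (toReal x) = (Q x : ℝ) := by
  simp [realForm, toReal, QuadraticForm.baseChange_tmul, Rat.smul_def]

lemma toReal_add (x y : V) : toReal (x + y) = toReal x + toReal y := TensorProduct.tmul_add _ _ _

lemma polar_toReal (Q : QuadraticForm ℚ V) (x y : V) :
    QuadraticMap.polar (realForm Q) (toReal x) (toReal y) = ((bil Q x y : ℚ) : ℝ) := by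
  simp only [QuadraticMap.polar, ← toReal_add, realForm_toReal, bil,
    QuadraticMap.polarBilin_apply_apply]
  push_cast; ring

variable [FiniteDimensional ℚ V]

lemma quadraticForm_sum_of_ortho {K M ι : Type*} [Field K] [CharZero K] [AddCommGroup M]
    [Module K M] [Fintype ι] [DecidableEq ι] (q : QuadraticForm K M) (v : ι → M)
    (hv : ∀ i j, i ≠ j → QuadraticMap.polar q (v i) (v j) = 0) (c : ι → K) :
    q (∑ i, c i • v i) = ∑ i, c i ^ 2 * q (v i) := by
  have h2 : q (∑ i, c i • v i)
      = (QuadraticMap.polar q (∑ i, c i • v i) (∑ i, c i • v i)) / 2 := by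
    rw [QuadraticMap.polar_self, two_smul]; ring
  rw [h2, ← QuadraticMap.polarBilin_apply_apply]
  simp only [map_sum, LinearMap.sum_apply, map_smul, LinearMap.smul_apply,
    QuadraticMap.polarBilin_apply_apply, smul_eq_mul]
  rw [Finset.sum_div]
  refine Finset.sum_congr rfl fun i _ => ?_
  rw [Finset.sum_eq_single i]
  · rw [QuadraticMap.polar_self, two_smul]; ring
  · intro j _ hj; rw [hv j i hj]; ring
  · simp

/-- Positivity at rational vectors alone would only give semidefiniteness over `ℝ`. On an orthogonal
basis of a maximal positive definite rational subspace, `Q` is a sum of squares with positive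
weights, and this persists for real coefficients. -/
lemma sigPos_le_sigPos_realForm (Q : QuadraticForm ℚ V) : sigPos Q ≤ sigPos (realForm Q) := by
  obtain ⟨U, hU, hpos⟩ := exists_finrank_eq_sigPos_and_posDef Q
  set n := finrank ℚ U
  have hsymm : LinearMap.IsSymm (QuadraticMap.polarBilin (Q.restrict U)) :=
    ⟨fun x y => QuadraticMap.polar_comm _ x y⟩
  obtain ⟨v, hv⟩ := LinearMap.BilinForm.exists_orthogonal_basis hsymm
  have hort : ∀ i j, i ≠ j → bil Q (v i : V) (v j) = 0 := fun i j hij => hv hij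
  have hp : ∀ j, 0 < realForm Q (toReal (v j : V)) := by
    intro j
    rw [realForm_toReal]
    exact_mod_cast hpos (v j) (v.ne_zero j)
  have hsum : ∀ c : Fin n → ℝ, realForm Q (∑ i, c i • toReal (v i : V))
      = ∑ i, c i ^ 2 * realForm Q (toReal (v i : V)) := by
    intro c
    refine quadraticForm_sum_of_ortho (realForm Q) _ ?_ c
    intro i j hij
    rw [polar_toReal, hort i j hij, Rat.cast_zero]
  have hzero : ∀ c : Fin n → ℝ, realForm Q (∑ i, c i • toReal (v i : V)) ≤ 0 → ∀ i, c i = 0 := by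
    intro c hc i
    rw [hsum] at hc
    have h0 := (Finset.sum_eq_zero_iff_of_nonneg
      (fun j _ => mul_nonneg (sq_nonneg (c j)) (hp j).le)).1
      (le_antisymm hc (Finset.sum_nonneg fun j _ => mul_nonneg (sq_nonneg (c j)) (hp j).le))
      i (Finset.mem_univ i)
    exact pow_eq_zero_iff two_ne_zero |>.1 ((mul_eq_zero.1 h0).resolve_right (hp i).ne')
  have hli : LinearIndependent ℝ (fun i => toReal (v i : V)) := by
    rw [Fintype.linearIndependent_iff]
    intro c hc
    exact hzero c (by rw [hc]; simp)
  have := le_sigPos_of_posDef (realForm Q)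
    (V := Submodule.span ℝ (Set.range fun i => toReal (v i : V))) (by
    rintro ⟨x, hx⟩ hne
    obtain ⟨c, rfl⟩ := (Submodule.mem_span_range_iff_exists_fun ℝ).1 hx
    rw [QuadraticMap.restrict_apply]
    by_contra hcon
    apply hne
    have := hzero c (not_lt.1 hcon)
    simp [this])
  rw [finrank_span_eq_card hli, Fintype.card_fin] at this
  omega

variable {Q : QuadraticForm ℚ V} {p : ℕ}

/-- Otherwise `z ⊕ ℝx` would be a three-dimensional subspace on which `Q ≤ 0`, leaving room for at
most `p - 1` positive directions in dimension `p + 2`. -/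
lemma pos_of_mem_orthogonal (hQ : HasSignature Q p 2) (z : SymSpace Q) {x : RealSpace V}
    (hx : x ∈ LinearMap.BilinForm.orthogonal (QuadraticMap.polarBilin (realForm Q)) z.plane)
    (hne : x ≠ 0) : 0 < realForm Q x := by
  by_contra hcon
  push Not at hcon
  have hdisj : Disjoint z.plane (Submodule.span ℝ {x}) :=
    z.isCompl.disjoint.mono_right ((Submodule.span_singleton_le_iff_mem _ _).2 hx)
  have h3 : finrank ℝ (z.plane ⊔ Submodule.span ℝ {x} : Submodule ℝ (RealSpace V)) = 3 := by
    have := Submodule.finrank_sup_add_finrank_inf_eq z.plane (Submodule.span ℝ {x})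
    rw [hdisj.eq_bot, finrank_bot, z.finrank_plane, finrank_span_singleton hne] at this
    omega
  have h4 : sigPos (realForm Q) + 3 ≤ finrank ℝ (RealSpace V) := by
    rw [← h3]
    refine QuadraticForm.sigPos_add_finrank_le_of_nonpos ?_
    intro y hy
    obtain ⟨y1, hy1, y2, hy2, rfl⟩ := Submodule.mem_sup.1 hy
    obtain ⟨c, rfl⟩ := Submodule.mem_span_singleton.1 hy2
    rw [QuadraticMap.map_add (realForm Q), QuadraticMap.map_smul (realForm Q)]
    have h5 : QuadraticMap.polar (realForm Q) y1 (c • x) = 0 := by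
      rw [QuadraticMap.polar_smul_right]
      have : QuadraticMap.polarBilin (realForm Q) y1 x = 0 := hx y1 hy1
      rw [QuadraticMap.polarBilin_apply_apply] at this
      rw [this, smul_zero]
    have h6 : realForm Q y1 ≤ 0 := by
      rcases eq_or_ne y1 0 with rfl | h
      · simp
      · exact (z.neg_def y1 hy1 h).le
    rw [h5, smul_eq_mul]
    nlinarith [mul_self_nonneg c]
  have h7 := sigPos_le_sigPos_realForm Q
  have h8 : finrank ℝ (RealSpace V) = finrank ℚ V := Module.finrank_baseChange
  rw [hQ.2.1] at h7
  rw [h8, hQ.1] at h4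
  omega

lemma proj_mem (z : SymSpace Q) (x : RealSpace V) : proj z x ∈ z.plane :=
  Submodule.projection_apply_mem _ _

lemma sub_proj_mem (z : SymSpace Q) (x : RealSpace V) :
    x - proj z x ∈
      LinearMap.BilinForm.orthogonal (QuadraticMap.polarBilin (realForm Q)) z.plane :=
  Submodule.sub_projection_mem _ _

lemma proj_eq_of_mem (z : SymSpace Q) {x y : RealSpace V} (hy : y ∈ z.plane)
    (hxy : x - y ∈
      LinearMap.BilinForm.orthogonal (QuadraticMap.polarBilin (realForm Q)) z.plane) :
    proj z x = y := by
  have h1 : proj z (y + (x - y)) = y := by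
    unfold proj
    rw [map_add, Submodule.projection_apply_of_mem_left _ hy,
      (Submodule.projection_apply_eq_zero_iff _).2 hxy, add_zero]
  rwa [add_sub_cancel] at h1

lemma realForm_eq_add_proj (z : SymSpace Q) (x : RealSpace V) :
    realForm Q x = realForm Q (x - proj z x) + realForm Q (proj z x) := by
  have h : QuadraticMap.polarBilin (realForm Q) (proj z x) (x - proj z x) = 0 :=
    sub_proj_mem z x _ (proj_mem z x)
  rw [QuadraticMap.polarBilin_apply_apply, QuadraticMap.polar_comm] at h
  have h2 := QuadraticMap.map_add (realForm Q) (x - proj z x) (proj z x)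
  rw [h, sub_add_cancel, add_zero] at h2
  exact h2

lemma exists_frame (hQ : HasSignature Q p 2) (z : SymSpace Q) :
    ∃ u : Basis (Fin p ⊕ Fin 2) ℝ (RealSpace V),
      (∀ x, realForm Q (x - proj z x) = (∑ i, (u.repr x (Sum.inl i)) ^ 2) / 2) ∧
      (∀ x, realForm Q (proj z x) = -(∑ i, (u.repr x (Sum.inr i)) ^ 2) / 2) := by
  set W := LinearMap.BilinForm.orthogonal (QuadraticMap.polarBilin (realForm Q)) z.plane
  obtain ⟨b₁, h₁⟩ := exists_basis_of_posDef ((realForm Q).restrict W) (by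
    rintro ⟨x, hx⟩ hne
    exact pos_of_mem_orthogonal hQ z hx (by simpa using hne))
  obtain ⟨b₂, h₂⟩ := exists_basis_of_posDef ((-realForm Q).restrict z.plane) (by
    rintro ⟨x, hx⟩ hne
    have := z.neg_def x hx (by simpa using hne)
    simpa [QuadraticMap.restrict_apply] using this)
  have hr2 : finrank ℝ z.plane = 2 := z.finrank_plane
  have hr1 : finrank ℝ W = p := by
    have := Submodule.finrank_add_eq_of_isCompl z.isCompl
    have h8 : finrank ℝ (RealSpace V) = finrank ℚ V := Module.finrank_baseChange
    rw [h8, hQ.1, hr2] at this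
    change 2 + finrank ℝ W = _ at this
    omega
  let u := ((b₁.reindex (finCongr hr1)).prod (b₂.reindex (finCongr hr2))).map
    (Submodule.prodEquivOfIsCompl W z.plane z.isCompl.symm)
  have hu : ∀ x, (Submodule.prodEquivOfIsCompl W z.plane z.isCompl.symm).symm x
      = (⟨x - proj z x, sub_proj_mem z x⟩, ⟨proj z x, proj_mem z x⟩) := by
    intro x
    rw [LinearEquiv.symm_apply_eq]
    simp
  refine ⟨u, fun x => ?_, fun x => ?_⟩
  · have := h₁ ⟨x - proj z x, sub_proj_mem z x⟩
    rw [QuadraticMap.restrict_apply] at this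
    rw [this]
    congr 1
    simp only [u, Basis.map_repr, LinearEquiv.trans_apply, hu, Basis.prod_repr_inl,
      Basis.repr_reindex, Finsupp.mapDomain_equiv_apply]
    exact (Equiv.sum_comp (finCongr hr1).symm
      (fun i => (b₁.repr ⟨x - proj z x, sub_proj_mem z x⟩ i) ^ 2)).symm
  · have := h₂ ⟨proj z x, proj_mem z x⟩
    rw [QuadraticMap.restrict_apply, neg_apply] at this
    rw [neg_div, eq_neg_iff_add_eq_zero, ← neg_eq_iff_add_eq_zero, this]
    congr 1
    simp only [u, Basis.map_repr, LinearEquiv.trans_apply, hu, Basis.prod_repr_inr,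
      Basis.repr_reindex, Finsupp.mapDomain_equiv_apply]
    exact (Equiv.sum_comp (finCongr hr2).symm
      (fun i => (b₂.repr ⟨proj z x, proj_mem z x⟩ i) ^ 2)).symm

end Geometry

/-! ### Poisson summation on `ℝ^ι` and its Gaussian case -/

section Poisson

open Module

variable {ι : Type*}

/-- The real vector with the given integral coordinates. -/
def intVec (n : ι → ℤ) : ι → ℝ := fun i => n i

/-- The half-open unit cube at `n`. -/
def unitCube (n : ι → ℤ) : Set (ι → ℝ) := {x | ∀ i, x i ∈ Set.Ioc (n i : ℝ) (n i + 1)}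

lemma iUnion_unitCube : ⋃ n : ι → ℤ, unitCube n = Set.univ := by
  refine Set.eq_univ_of_forall fun x => Set.mem_iUnion.2 ⟨fun i => ⌈x i⌉ - 1, fun i => ?_⟩
  constructor
  · have := Int.ceil_lt_add_one (x i); push_cast; linarith
  · have := Int.le_ceil (x i); push_cast; linarith

lemma pairwise_disjoint_unitCube : Pairwise (Function.onFun Disjoint (unitCube (ι := ι))) := by
  intro n m hnm
  rw [Function.onFun, Set.disjoint_left]
  intro x hx hy
  apply hnm
  ext i
  have h1 := hx i
  have h2 := hy i
  have h3 : (n i : ℝ) < m i + 1 := h1.1.trans_le h2.2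
  have h4 : (m i : ℝ) < n i + 1 := h2.1.trans_le h1.2
  norm_cast at h3 h4
  omega

variable [Fintype ι]

/-- The pairing `∑ nᵢ xᵢ`. -/
def intPair (n : ι → ℤ) (x : ι → ℝ) : ℝ := ∑ i, n i * x i

lemma summable_one_add_norm_rpow {r : ℝ} (hr : Fintype.card ι < r) :
    Summable fun n : ι → ℤ => (1 + ‖intVec n‖) ^ (-r) := by
  classical
  set b := Pi.basisFun ℝ ι
  set L := Submodule.span ℤ (Set.range b)
  let bZ : Basis ι ℤ L := b.restrictScalars ℤ
  have hL : finrank ℤ L = Fintype.card ι := finrank_eq_card_basis bZ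
  have h1 := ZLattice.summable_norm_rpow L (-r) (by rw [hL]; linarith)
  have h2 : Summable fun n : ι → ℤ => ‖intVec n‖ ^ (-r) := by
    refine (bZ.equivFun.symm.toEquiv.summable_iff.2 h1).congr fun n => ?_
    have : ((bZ.equivFun.symm n : L) : ι → ℝ) = intVec n := by
      rw [Basis.equivFun_symm_apply]
      ext i
      have hb : ∀ j, ((bZ j : L) : ι → ℝ) = Pi.single j 1 := fun j => by
        rw [Basis.restrictScalars_apply, Pi.basisFun_apply]
      simp [intVec, Finset.sum_apply, hb, Pi.single_apply]
    simp only [Function.comp_apply, LinearEquiv.coe_toEquiv, Submodule.coe_norm, this]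
  refine h2.of_norm_bounded_eventually ?_
  filter_upwards [(Set.finite_singleton (0 : ι → ℤ)).compl_mem_cofinite] with n hn
  have hr0 : 0 < r := lt_of_le_of_lt (Nat.cast_nonneg _) hr
  have hpos : 0 < ‖intVec n‖ := by
    rw [norm_pos_iff]
    intro h
    apply hn
    ext i
    have := congrFun h i
    simpa [intVec] using this
  rw [Real.norm_of_nonneg (by positivity)]
  exact Real.rpow_le_rpow_of_nonpos hpos (by linarith) (by linarith)

lemma measurableSet_unitCube (n : ι → ℤ) : MeasurableSet (unitCube n) :=
  MeasurableSet.univ_pi' fun _ => measurableSet_Ioc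

/-- The half-open unit cubes tile `ℝ^ι`; each piece is translated back to the cube at the origin. -/
lemma hasSum_setIntegral_unitCube {E : Type*} [NormedAddCommGroup E] [NormedSpace ℝ E]
    {f : (ι → ℝ) → E} (hf : Integrable f) :
    HasSum (fun n : ι → ℤ => ∫ x in unitCube 0, f (x + intVec n)) (∫ x, f x) := by
  have h1 := hasSum_integral_iUnion (f := f) (μ := volume) (measurableSet_unitCube (ι := ι))
    pairwise_disjoint_unitCube hf.integrableOn
  rw [iUnion_unitCube, setIntegral_univ] at h1
  convert! h1 using 2 with n
  have h2 : unitCube (0 : ι → ℤ) = (fun x => x + intVec n) ⁻¹' unitCube n := by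
    ext x
    simp only [unitCube, intVec, Set.mem_ofPred_eq, Set.mem_preimage, Pi.add_apply, Set.mem_Ioc,
      Pi.zero_apply, Int.cast_zero]
    refine forall_congr' fun i => and_congr ?_ ?_ <;> constructor <;> intro h <;> linarith
  rw [h2]
  exact (measurePreserving_add_right volume (intVec n)).setIntegral_preimage_emb
    (measurableEmbedding_addRight _) f _

lemma intPair_add_intVec (k n : ι → ℤ) (x : ι → ℝ) :
    intPair k (x + intVec n) = intPair k x + ((∑ i, k i * n i : ℤ) : ℝ) := by
  simp [intPair, intVec, mul_add, Finset.sum_add_distrib]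

lemma mFourier_coe (k : ι → ℤ) (x : ι → ℝ) :
    UnitAddTorus.mFourier k (fun i => (x i : UnitAddCircle))
      = Complex.exp (2 * Real.pi * Complex.I * (intPair k x : ℝ)) := by
  simp only [UnitAddTorus.mFourier, ContinuousMap.coe_mk, fourier_coe_apply, intPair]
  rw [← Complex.exp_sum]
  congr 1
  push_cast
  rw [Finset.mul_sum]
  refine Finset.sum_congr rfl fun i _ => ?_
  simp; ring

/-- From `1 + ‖n‖ ≤ (1 + K)(1 + ‖x + n‖)` for `‖x‖ ≤ K`. The majorant is uniform on bounded sets and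
makes the periodization of `g` continuous. -/
lemma summable_translates {g : (ι → ℝ) → ℂ} {r C : ℝ} (hr : Fintype.card ι < r) 
    (hC : ∀ x, ‖g x‖ ≤ C * (1 + ‖x‖) ^ (-r)) {K : ℝ} (hK : 0 ≤ K) :
    ∃ u : (ι → ℤ) → ℝ, Summable u ∧ ∀ n x, ‖x‖ ≤ K → ‖g (x + intVec n)‖ ≤ u n := by
  have hC0 : 0 ≤ C := by
    have := (norm_nonneg _).trans (hC 0)
    simpa using this
  have hr0 : 0 < r := lt_of_le_of_lt (Nat.cast_nonneg _) hr
  refine ⟨fun n => C * (1 + K) ^ r * (1 + ‖intVec n‖) ^ (-r),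
    (summable_one_add_norm_rpow hr).mul_left _, fun n x hx => (hC _).trans ?_⟩
  simp only
  rw [mul_assoc]
  refine mul_le_mul_of_nonneg_left ?_ hC0
  have h1 : 1 + ‖intVec n‖ ≤ (1 + K) * (1 + ‖x + intVec n‖) := by
    have : ‖intVec n‖ ≤ ‖x + intVec n‖ + ‖x‖ := by
      calc ‖intVec n‖ = ‖(x + intVec n) - x‖ := by rw [add_sub_cancel_left]
        _ ≤ _ := norm_sub_le _ _
    nlinarith [norm_nonneg (x + intVec n)]
  rw [Real.rpow_neg (by positivity), Real.rpow_neg (by positivity), ← div_eq_mul_inv,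
    ← Real.div_rpow (by positivity) (by positivity), ← Real.inv_rpow (by positivity)]
  refine Real.rpow_le_rpow (by positivity) ?_ hr0.le
  rw [inv_eq_one_div, div_le_div_iff₀ (by positivity) (by positivity)]
  linarith

lemma integrable_of_decay {g : (ι → ℝ) → ℂ} (hg : Continuous g) {r C : ℝ}
    (hr : Fintype.card ι < r) (hC : ∀ x, ‖g x‖ ≤ C * (1 + ‖x‖) ^ (-r)) : Integrable g := by
  have h1 : Integrable (fun x : ι → ℝ => C * (1 + ‖x‖) ^ (-r)) :=
    (integrable_one_add_norm (by simpa using hr)).const_mul C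
  exact h1.mono' hg.aestronglyMeasurable (Eventually.of_forall hC)

/-- Poisson summation for `ℤ^ι ⊂ ℝ^ι`. -/
theorem poisson_summation_pi {g : (ι → ℝ) → ℂ} (hg : Continuous g) {r C : ℝ}
    (hr : Fintype.card ι < r) (hC : ∀ x, ‖g x‖ ≤ C * (1 + ‖x‖) ^ (-r))
    (hsum : Summable fun k : ι → ℤ =>
      ∫ x, Complex.exp (-(2 * Real.pi * Complex.I * (intPair k x : ℝ))) * g x) (x : ι → ℝ) :
    ∑' n : ι → ℤ, g (x + intVec n) = ∑' k : ι → ℤ,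
      (∫ x, Complex.exp (-(2 * Real.pi * Complex.I * (intPair k x : ℝ))) * g x) *
        Complex.exp (2 * Real.pi * Complex.I * (intPair k x : ℝ)) := by
  classical
  set G : (ι → ℝ) → ℂ := fun x => ∑' n : ι → ℤ, g (x + intVec n) with hG
  have hGc : Continuous G := by
    rw [continuous_iff_continuousAt]
    intro x
    obtain ⟨u, hu, hb⟩ := summable_translates hr hC (K := ‖x‖ + 1) (by positivity)
    have : ContinuousOn G (Metric.ball 0 (‖x‖ + 1)) := by
      refine continuousOn_tsum (fun n => (hg.comp (continuous_id.add continuous_const)).continuousOn)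
        hu fun n y hy => hb n y ?_
      simpa using (mem_ball_zero_iff.1 hy).le
    exact this.continuousAt (Metric.isOpen_ball.mem_nhds (by simp))
  have hGper : ∀ x n, G (x + intVec n) = G x := by
    intro x n
    simp only [hG]
    rw [← (Equiv.addLeft n).tsum_eq (fun m => g (x + intVec m))]
    refine tsum_congr fun m => ?_
    congr 1
    ext i
    simp [intVec]; ring
  -- The periodization `G` descends along this quotient map to a continuous function on the torus,
  -- where Fourier inversion for summable coefficients applies.
  set π : (ι → ℝ) → UnitAddTorus ι := fun x i => (x i : UnitAddCircle) with hπ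
  have hquot : IsOpenQuotientMap π :=
    IsOpenQuotientMap.piMap fun _ => QuotientAddGroup.isOpenQuotientMap_mk
  have hlift : ∀ x y, π x = π y → G x = G y := by
    intro x y hxy
    have : ∀ i, ∃ n : ℤ, y i = x i + n := by
      intro i
      have h1 : ((x i : ℝ) : UnitAddCircle) = (y i : ℝ) := congrFun hxy i
      rw [eq_comm, ← sub_eq_zero, ← AddCircle.coe_sub, AddCircle.coe_eq_zero_iff] at h1
      obtain ⟨n, hn⟩ := h1
      exact ⟨n, by simp at hn; linarith⟩
    choose n hn using this
    have h2 : y = x + intVec n := by ext i; simp [hn, intVec]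
    rw [h2, hGper]
  obtain ⟨F, hF⟩ : ∃ F : UnitAddTorus ι → ℂ, ∀ x, F (π x) = G x :=
    ⟨fun t => G (Function.surjInv hquot.surjective t),
      fun x => hlift _ _ (Function.surjInv_eq hquot.surjective (π x))⟩
  have hFc : Continuous F := by
    rw [hquot.isQuotientMap.continuous_iff]
    exact hGc.congr fun x => (hF x).symm
  -- The character is periodic and can be moved inside the periodization; the cube integrals of all
  -- translates then add up to the integral over `ℝ^ι`.
  have hcoeff : ∀ k, UnitAddTorus.mFourierCoeff F k
      = ∫ x, Complex.exp (-(2 * Real.pi * Complex.I * (intPair k x : ℝ))) * g x := by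
    intro k
    set e : (ι → ℝ) → ℂ := fun x => Complex.exp (-(2 * Real.pi * Complex.I * (intPair k x : ℝ)))
      with he
    have hec : Continuous e := by
      simp only [he, intPair]; fun_prop
    have henorm : ∀ x, ‖e x‖ = 1 := by
      intro x
      have : -(2 * Real.pi * Complex.I * (intPair k x : ℝ))
        = ((-(2 * Real.pi * intPair k x) : ℝ) : ℂ) * Complex.I := by push_cast; ring
      rw [he]
      simp only [this]
      exact Complex.norm_exp_ofReal_mul_I _
    have heper : ∀ x n, e (x + intVec n) = e x := by
      intro x n
      simp only [he, intPair_add_intVec]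
      rw [Complex.ofReal_add, mul_add, neg_add, Complex.exp_add, Complex.ofReal_intCast,
        Complex.exp_neg (2 * Real.pi * Complex.I * ((∑ i, k i * n i : ℤ) : ℂ)),
        mul_comm (2 * (Real.pi : ℂ) * Complex.I) ((∑ i, k i * n i : ℤ) : ℂ),
        Complex.exp_int_mul_two_pi_mul_I, inv_one, mul_one]
    have hint : Integrable fun x => e x * g x :=
      integrable_of_decay (hec.mul hg) hr (fun x => by rw [norm_mul, henorm, one_mul]; exact hC x)
    rw [UnitAddTorus.mFourierCoeff_eq_integral F k (fun _ => ((0 : ℤ) : ℝ)),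
      ← (hasSum_setIntegral_unitCube hint).tsum_eq]
    change ∫ x in unitCube 0, _ = _
    have h1 : ∀ x : ι → ℝ, (UnitAddTorus.mFourier (-k) fun i => (x i : UnitAddCircle)) •
        F (fun i => (x i : UnitAddCircle))
          = ∑' n : ι → ℤ, e (x + intVec n) * g (x + intVec n) := by
      intro x
      rw [mFourier_coe, show F (fun i => (x i : UnitAddCircle)) = G x from hF x, smul_eq_mul, hG]
      simp only [heper]
      rw [tsum_mul_left]
      congr 2
      simp [intPair]
    simp only [h1]
    symm
    refine (hasSum_integral_of_summable_integral_norm (fun n => ?_) ?_).tsum_eq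
    · exact (hint.comp_add_right (intVec n)).integrableOn
    · exact (hasSum_setIntegral_unitCube hint.norm).summable
  have hmain := UnitAddTorus.hasSum_mFourier_series_apply_of_summable (f := ⟨F, hFc⟩)
    (by rw [ContinuousMap.coe_mk, funext hcoeff]; exact hsum) (π x)
  have := hmain.tsum_eq
  simp only [ContinuousMap.coe_mk, hF, hcoeff, smul_eq_mul] at this
  change G x = _
  rw [← this]
  refine tsum_congr fun k => ?_
  rw [mFourier_coe]


lemma exists_gaussian_decay (A : (ι → ℝ) ≃ₗ[ℝ] (ι → ℝ)) {β : ι → ℝ} (hβ : ∀ i, 0 < β i) (r : ℝ) :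
    ∃ C : ℝ, ∀ x, Real.exp (-∑ i, β i * (A x i) ^ 2) ≤ C * (1 + ‖x‖) ^ (-r) := by
  obtain ⟨β₀, hβ₀, hβle⟩ : ∃ β₀ > 0, ∀ i, β₀ ≤ β i := by
    rcases isEmpty_or_nonempty ι with h | h
    · exact ⟨1, one_pos, fun i => h.elim i⟩
    · obtain ⟨i, hi⟩ := Finite.exists_min β
      exact ⟨β i, hβ i, hi⟩
  obtain ⟨c, hc, hcle⟩ : ∃ c > 0, ∀ x, ‖x‖ ≤ c * ‖A x‖ := by
    let B := LinearMap.toContinuousLinearMap (A.symm : (ι → ℝ) →ₗ[ℝ] (ι → ℝ))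
    refine ⟨‖B‖ + 1, by positivity, fun x => ?_⟩
    have h1 := B.le_opNorm (A x)
    have h2 : B (A x) = x := by simp [B]
    rw [h2] at h1
    nlinarith [norm_nonneg (A x)]
  set a : ℝ := β₀ / c ^ 2 with ha
  have ha0 : 0 < a := by positivity
  have hquad : ∀ x, a * ‖x‖ ^ 2 ≤ ∑ i, β i * (A x i) ^ 2 := by
    intro x
    have h1 : ‖A x‖ ^ 2 ≤ ∑ i, (A x i) ^ 2 := by
      have h0 : ‖A x‖ ≤ √(∑ i, (A x i) ^ 2) := by
        refine (pi_norm_le_iff_of_nonneg (Real.sqrt_nonneg _)).2 fun i => ?_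
        refine Real.le_sqrt_of_sq_le ?_
        rw [Real.norm_eq_abs, sq_abs]
        exact Finset.single_le_sum (f := fun i => (A x i) ^ 2) (fun j _ => sq_nonneg _)
          (Finset.mem_univ i)
      calc ‖A x‖ ^ 2 ≤ √(∑ i, (A x i) ^ 2) ^ 2 := by gcongr
        _ = _ := Real.sq_sqrt (Finset.sum_nonneg fun _ _ => sq_nonneg _)
    have h2 : ‖x‖ ^ 2 ≤ c ^ 2 * ‖A x‖ ^ 2 := by
      rw [← mul_pow]; exact pow_le_pow_left₀ (norm_nonneg _) (hcle x) 2
    calc a * ‖x‖ ^ 2 ≤ a * (c ^ 2 * ‖A x‖ ^ 2) := by gcongr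
      _ = β₀ * ‖A x‖ ^ 2 := by rw [ha]; field_simp
      _ ≤ β₀ * ∑ i, (A x i) ^ 2 := by gcongr
      _ ≤ _ := by
        rw [Finset.mul_sum]
        exact Finset.sum_le_sum fun i _ => mul_le_mul_of_nonneg_right (hβle i) (sq_nonneg _)
  obtain ⟨m, hm⟩ := exists_nat_ge r
  -- The constant combines `(1 + t)^m ≤ m! e^(1 + t)` with `t - a t² ≤ 1/(4a)`, which follows by
  -- completing the square.
  refine ⟨m.factorial * Real.exp (1 + 1 / (4 * a)), fun x => ?_⟩
  have ht : 0 ≤ ‖x‖ := norm_nonneg x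
  set t := ‖x‖
  rw [Real.rpow_neg (by positivity), ← div_eq_mul_inv, le_div_iff₀ (by positivity)]
  have h1 : (1 + t) ^ r ≤ (1 + t) ^ m := by
    rw [← Real.rpow_natCast]
    exact Real.rpow_le_rpow_of_exponent_le (by linarith) hm
  have h2 : (1 + t) ^ m ≤ m.factorial * Real.exp (1 + t) := by
    have := Real.pow_div_factorial_le_exp (1 + t) (by linarith) m
    rwa [div_le_iff₀ (by positivity), mul_comm] at this
  have h3 : Real.exp (-∑ i, β i * (A x i) ^ 2) ≤ Real.exp (-(a * t ^ 2)) :=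
    Real.exp_le_exp.2 (neg_le_neg (hquad x))
  calc _ ≤ Real.exp (-(a * t ^ 2)) * (m.factorial * Real.exp (1 + t)) :=
        mul_le_mul h3 (h1.trans h2) (by positivity) (by positivity)
    _ = m.factorial * Real.exp (1 + t - a * t ^ 2) := by
        rw [mul_left_comm, ← Real.exp_add]; ring_nf
    _ ≤ _ := by
        gcongr
        have : 0 ≤ (2 * a * t - 1) ^ 2 / (4 * a) := by positivity
        have h4 : (2 * a * t - 1) ^ 2 / (4 * a) = a * t ^ 2 - t + 1 / (4 * a) := by
          field_simp; ring
        linarith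

lemma summable_gaussian_intVec (A : (ι → ℝ) ≃ₗ[ℝ] (ι → ℝ)) {β : ι → ℝ} (hβ : ∀ i, 0 < β i) :
    Summable fun n : ι → ℤ => Real.exp (-∑ i, β i * (A (intVec n) i) ^ 2) := by
  obtain ⟨C, hC⟩ := exists_gaussian_decay A hβ (Fintype.card ι + 1)
  exact ((summable_one_add_norm_rpow (lt_add_one _)).mul_left C).of_nonneg_of_le
    (fun _ => (Real.exp_pos _).le) fun n => hC _

lemma norm_cexp_neg_sum (b : ι → ℂ) (y : ι → ℝ) :
    ‖Complex.exp (-∑ i, b i * (y i : ℂ) ^ 2)‖ = Real.exp (-∑ i, (b i).re * (y i) ^ 2) := by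
  rw [Complex.norm_exp, Complex.neg_re, Complex.re_sum]
  congr 2
  refine Finset.sum_congr rfl fun i _ => ?_
  rw [← Complex.ofReal_pow, Complex.re_mul_ofReal]

/-- Poisson summation for a Gaussian `exp (-∑ bᵢ yᵢ²)` with complex coefficients and the lattice
`A ℤ^ι`, where `D` describes the dual lattice. -/
theorem poisson_summation_gaussian (A D : (ι → ℝ) ≃ₗ[ℝ] (ι → ℝ)) {b : ι → ℂ}
    (hb : ∀ i, 0 < (b i).re)
    (hD : ∀ (k : ι → ℤ) (x : ι → ℝ), intPair k x = ∑ j, D (intVec k) j * A x j) (x : ι → ℝ) :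
    ∑' n : ι → ℤ, Complex.exp (-∑ i, b i * (A (x + intVec n) i : ℂ) ^ 2)
      = ((|LinearMap.det (A : (ι → ℝ) →ₗ[ℝ] (ι → ℝ))|⁻¹ : ℝ) : ℂ) *
        (∏ i, (Real.pi / b i) ^ (1 / 2 : ℂ)) *
        ∑' k : ι → ℤ, Complex.exp (-∑ i, (Real.pi ^ 2 / b i) * (D (intVec k) i : ℂ) ^ 2) *
          Complex.exp (2 * Real.pi * Complex.I * (intPair k x : ℝ)) := by
  have hAc : Continuous A := LinearMap.continuous_of_finiteDimensional (A : (ι → ℝ) →ₗ[ℝ] (ι → ℝ))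
  set g : (ι → ℝ) → ℂ := fun x => Complex.exp (-∑ i, b i * (A x i : ℂ) ^ 2) with hg
  have hgc : Continuous g := by
    refine Complex.continuous_exp.comp (continuous_finsetSum _ fun i _ => ?_).neg
    exact continuous_const.mul
      ((Complex.continuous_ofReal.comp ((continuous_apply i).comp hAc)).pow 2)
  obtain ⟨C, hC⟩ := exists_gaussian_decay A hb (Fintype.card ι + 1)
  have hgC : ∀ x, ‖g x‖ ≤ C * (1 + ‖x‖) ^ (-(Fintype.card ι + 1 : ℝ)) := fun x => by
    rw [hg]; simp only; rw [norm_cexp_neg_sum]; exact hC x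
  have hbne : ∀ i, b i ≠ 0 := fun i h => by have := hb i; simp [h] at this
  have hcoeff : ∀ k : ι → ℤ,
      ∫ x, Complex.exp (-(2 * Real.pi * Complex.I * (intPair k x : ℝ))) * g x
        = ((|LinearMap.det (A : (ι → ℝ) →ₗ[ℝ] (ι → ℝ))|⁻¹ : ℝ) : ℂ) *
          (∏ i, (Real.pi / b i) ^ (1 / 2 : ℂ)) *
          Complex.exp (-∑ i, (Real.pi ^ 2 / b i) * (D (intVec k) i : ℂ) ^ 2) := by
    intro k
    set G : (ι → ℝ) → ℂ := fun y => Complex.exp (-∑ i, b i * (y i : ℂ) ^ 2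
      + ∑ i, (-(2 * Real.pi * Complex.I * (D (intVec k) i : ℝ))) * y i) with hGdef
    have h1 : ∀ x, Complex.exp (-(2 * Real.pi * Complex.I * (intPair k x : ℝ))) * g x
        = G (A x) := by
      intro x
      simp only [hg, hGdef]
      rw [← Complex.exp_add, add_comm, hD]
      congr 2
      push_cast
      rw [Finset.mul_sum, ← Finset.sum_neg_distrib]
      exact Finset.sum_congr rfl fun i _ => by ring
    simp only [h1]
    -- The substitution `y = Ax` separates the variables at the cost of the Jacobian; a product of
    -- one-dimensional Gaussian Fourier transforms remains.
    have h2 : ∫ x, G (A x) = |LinearMap.det (A : (ι → ℝ) →ₗ[ℝ] (ι → ℝ))|⁻¹ • ∫ y, G y := by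
      have h3 := Real.map_linearMap_volume_pi_eq_smul_volume_pi
        (f := (A : (ι → ℝ) →ₗ[ℝ] (ι → ℝ))) (LinearEquiv.isUnit_det' A).ne_zero
      have hemb : MeasurableEmbedding A :=
        A.toContinuousLinearEquiv.toHomeomorph.measurableEmbedding
      have h4 := hemb.integral_map (μ := volume) G
      rw [← h4]
      change ∫ y, G y ∂(Measure.map (A : (ι → ℝ) →ₗ[ℝ] (ι → ℝ)) volume) = _
      rw [h3, integral_smul_measure, ENNReal.toReal_ofReal (abs_nonneg _), abs_inv]
    rw [h2, hGdef, GaussianFourier.integral_cexp_neg_sum_mul_add hb, Finset.prod_mul_distrib,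
      ← Complex.exp_sum, Complex.real_smul, ← mul_assoc]
    congr 2
    rw [← Finset.sum_neg_distrib]
    refine Finset.sum_congr rfl fun i _ => ?_
    have := hbne i
    field_simp
    rw [Complex.I_sq]
    ring
  have hβ : ∀ i, 0 < (Real.pi ^ 2 / b i).re := fun i => by
    rw [div_eq_mul_inv, ← Complex.ofReal_pow, Complex.re_ofReal_mul, Complex.inv_re]
    have := Complex.normSq_pos.2 (hbne i)
    have := hb i
    positivity
  have hsum : Summable fun k : ι → ℤ =>
      Complex.exp (-∑ i, (Real.pi ^ 2 / b i) * (D (intVec k) i : ℂ) ^ 2) := by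
    refine Summable.of_norm ?_
    simp only [norm_cexp_neg_sum]
    exact summable_gaussian_intVec D hβ
  have := poisson_summation_pi hgc (lt_add_one _) hgC
    (by simp only [hcoeff]; exact hsum.mul_left _) x
  rw [this, ← tsum_mul_left]
  refine tsum_congr fun k => ?_
  rw [hcoeff, mul_assoc]

end Poisson

/-! ### Poisson summation for an even lattice and the Gaussian of a plane -/

section LatticeSums

open Module

variable {V : Type*} [AddCommGroup V] [Module ℚ V]
  {Q : QuadraticForm ℚ V} {p : ℕ} {L : Submodule ℤ V}

lemma le_dualLattice (hL : IsEven Q L) : L ≤ dualLattice Q L := by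
  intro x hx
  rw [LinearMap.BilinForm.mem_dualSubmodule]
  intro y hy
  obtain ⟨a, ha⟩ := hL x hx
  obtain ⟨b, hb⟩ := hL y hy
  obtain ⟨c, hc⟩ := hL (x + y) (L.add_mem hx hy)
  rw [Submodule.mem_one]
  refine ⟨c - a - b, ?_⟩
  rw [QuadraticMap.polarBilin_apply_apply, QuadraticMap.polar, ha, hb, hc]
  simp

lemma exists_int_bil (x : dualLattice Q L) (y : L) : ∃ n : ℤ, bil Q (x : V) (y : V) = n := by
  obtain ⟨n, hn⟩ := Submodule.mem_one.1 (x.2 y y.2)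
  exact ⟨n, by simpa using hn.symm⟩

lemma toReal_sum {κ : Type*} (s : Finset κ) (f : κ → V) :
    toReal (∑ i ∈ s, f i) = ∑ i ∈ s, toReal (f i) := TensorProduct.tmul_sum _ _ _

lemma toReal_zsmul (n : ℤ) (x : V) : toReal (n • x) = (n : ℝ) • toReal x := by
  rw [toReal, TensorProduct.tmul_smul]
  simp [Int.cast_smul_eq_zsmul]

lemma baseChange_equivFun_symm {κ : Type*} [Fintype κ] (v : Basis κ ℚ V) (n : κ → ℤ) :
    (v.baseChange ℝ).equivFun.symm (intVec n) = toReal (∑ i, n i • v i) := by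
  rw [Basis.equivFun_symm_apply, toReal_sum]
  refine Finset.sum_congr rfl fun i _ => ?_
  rw [toReal_zsmul, Basis.baseChange_apply]
  rfl

variable [FiniteDimensional ℚ V]

/-- The positive and negative directions already exhaust the dimension `p + 2`, so the radical is
zero. -/
lemma polarBilin_nondegenerate (hQ : HasSignature Q p 2) :
    (QuadraticMap.polarBilin Q).Nondegenerate := by
  have hrad : finrank ℚ Q.radical = 0 := by
    have := QuadraticForm.sigPos_add_sigNeg_add_radical (Q := Q)
    rw [hQ.1, hQ.2.1, hQ.2.2] at this
    omega
  have hbot : Q.radical = ⊥ := Submodule.finrank_eq_zero.1 hrad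
  have key : ∀ x, (∀ y, QuadraticMap.polar Q x y = 0) → x = 0 := by
    intro x hx
    have h1 : Q x = 0 := by
      have := hx x
      rw [QuadraticMap.polar_self, smul_eq_zero] at this
      exact this.resolve_left two_ne_zero
    have : x ∈ Q.radical := by
      rw [QuadraticMap.mem_radical_iff']
      refine ⟨h1, fun y => ?_⟩
      have := hx y
      rw [QuadraticMap.polar, h1] at this
      linarith
    rwa [hbot, Submodule.mem_bot] at this
  exact ⟨fun x hx => key x hx,
    fun x hx => key x fun y => by rw [QuadraticMap.polar_comm]; exact hx y⟩

/-- Integral coordinates for `L` and `L'` in mutually dual bases. Duality makes the pairing of `L'`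
with `V(ℝ)` the standard integral pairing needed for Poisson summation, and makes the base change
between the two bases the Gram matrix of `L`. -/
lemma exists_lattice_basis (hQ : HasSignature Q p 2) [L.IsLattice ℚ] :
    ∃ (v : Basis (Fin p ⊕ Fin 2) ℚ V) (vd : Basis (Fin p ⊕ Fin 2) ℚ V)
      (e : ((Fin p ⊕ Fin 2) → ℤ) ≃ L) (ed : ((Fin p ⊕ Fin 2) → ℤ) ≃ dualLattice Q L),
      L = Submodule.span ℤ (Set.range v) ∧ dualLattice Q L = Submodule.span ℤ (Set.range vd) ∧
      (∀ n, (e n : V) = ∑ i, n i • v i) ∧ (∀ n, (ed n : V) = ∑ i, n i • vd i) ∧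
      (∀ i j, bil Q (vd i) (v j) = if i = j then 1 else 0) ∧
      (∀ x i, vd.repr x i = bil Q x (v i)) := by
  classical
  have hB := polarBilin_nondegenerate hQ
  let b₀ := Free.chooseBasis ℤ L
  have hcard : Fintype.card (Free.ChooseBasisIndex ℤ L) = Fintype.card (Fin p ⊕ Fin 2) := by
    rw [← finrank_eq_card_basis (b₀.extendOfIsLattice ℚ), hQ.1]; simp
  let b := b₀.reindex (Fintype.equivOfCardEq hcard)
  let v := b.extendOfIsLattice ℚ
  let vd := LinearMap.BilinForm.dualBasis (QuadraticMap.polarBilin Q) hB v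
  have hvb : ∀ i, v i = b i := fun i => Basis.extendOfIsLattice_apply ℚ b i
  have hspan : L = Submodule.span ℤ (Set.range v) := by
    have h1 : Set.range v = L.subtype '' Set.range b := by
      rw [← Set.range_comp]; congr 1; ext i; exact hvb i
    rw [h1, ← Submodule.map_span, b.span_eq, Submodule.map_top, Submodule.range_subtype]
  have hdual : dualLattice Q L = Submodule.span ℤ (Set.range vd) := by
    conv_lhs => rw [hspan]
    exact LinearMap.BilinForm.dualSubmodule_span_of_basis _ hB v
  refine ⟨v, vd, b.equivFun.symm.toEquiv,
    ((vd.restrictScalars ℤ).equivFun.symm.trans (LinearEquiv.ofEq _ _ hdual.symm)).toEquiv,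
    hspan, hdual, fun n => ?_, fun n => ?_, fun i j => ?_, fun x i => ?_⟩
  · simp [Basis.equivFun_symm_apply, hvb]
  · simp only [LinearEquiv.coe_toEquiv, LinearEquiv.trans_apply, LinearEquiv.coe_ofEq_apply,
      Basis.equivFun_symm_apply, Submodule.coe_sum, Submodule.coe_smul,
      Basis.restrictScalars_apply]
  · have := LinearMap.BilinForm.apply_dualBasis_left hB v i j
    simp only [eq_comm (a := i)]
    exact this
  · exact LinearMap.BilinForm.dualBasis_repr_apply hB v x i

/-- The sign `±1` attached to a vector of a frame. -/
def frameSign : Fin p ⊕ Fin 2 → ℝ := Sum.elim (fun _ => 1) (fun _ => -1)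

lemma frameSign_mul_self (j : Fin p ⊕ Fin 2) : frameSign j * frameSign j = 1 := by
  rcases j with j | j <;> simp [frameSign]

variable (Q p) in
/-- A basis of `V(ℝ)` which diagonalizes `Q` and is adapted to the plane `z`. -/
structure IsFrame (z : SymSpace Q) (u : Basis (Fin p ⊕ Fin 2) ℝ (RealSpace V)) : Prop where
  compl : ∀ x, realForm Q (x - proj z x) = (∑ i, (u.repr x (Sum.inl i)) ^ 2) / 2
  plane : ∀ x, realForm Q (proj z x) = -(∑ i, (u.repr x (Sum.inr i)) ^ 2) / 2

lemma IsFrame.realForm_eq {z : SymSpace Q} {u : Basis (Fin p ⊕ Fin 2) ℝ (RealSpace V)}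
    (hu : IsFrame Q p z u) (x : RealSpace V) :
    realForm Q x = (∑ j, frameSign j * (u.repr x j) ^ 2) / 2 := by
  rw [realForm_eq_add_proj z x, hu.compl, hu.plane, Fintype.sum_sum_type]
  simp only [frameSign, Sum.elim_inl, Sum.elim_inr, one_mul, neg_mul, Finset.sum_neg_distrib]
  ring

lemma IsFrame.polar_eq {z : SymSpace Q} {u : Basis (Fin p ⊕ Fin 2) ℝ (RealSpace V)}
    (hu : IsFrame Q p z u) (x y : RealSpace V) :
    QuadraticMap.polar (realForm Q) x y = ∑ j, frameSign j * u.repr x j * u.repr y j := by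
  rw [QuadraticMap.polar, hu.realForm_eq, hu.realForm_eq, hu.realForm_eq, ← sub_div, ← sub_div,
    ← Finset.sum_sub_distrib, ← Finset.sum_sub_distrib, Finset.sum_div]
  refine Finset.sum_congr rfl fun j _ => ?_
  simp only [map_add, Finsupp.add_apply]
  ring

/-- The Gaussian `exp (2πi (Q(proj_{z^⊥} x) t + Q(proj_z x) t̄))`. -/
def gaussTerm (z : SymSpace Q) (t : ℂ) (x : RealSpace V) : ℂ :=
  Complex.exp (2 * Real.pi * Complex.I *
      ((realForm Q (x - proj z x) : ℂ) * t + (realForm Q (proj z x) : ℂ) * (starRingEnd ℂ) t))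

/-- The coefficients of the Gaussian in the coordinates of a frame. -/
def frameCoeff (t : ℂ) : Fin p ⊕ Fin 2 → ℂ :=
  Sum.elim (fun _ => -(Real.pi * Complex.I * t)) (fun _ => Real.pi * Complex.I * (starRingEnd ℂ) t)

lemma frameCoeff_re_pos {t : ℂ} (ht : 0 < t.im) (j : Fin p ⊕ Fin 2) : 0 < (frameCoeff t j).re := by
  rcases j with j | j <;> simp [frameCoeff] <;> positivity

lemma IsFrame.gaussTerm_eq {z : SymSpace Q} {u : Basis (Fin p ⊕ Fin 2) ℝ (RealSpace V)}
    (hu : IsFrame Q p z u) (t : ℂ) (x : RealSpace V) :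
    gaussTerm z t x = Complex.exp (-∑ j, frameCoeff t j * (u.repr x j : ℂ) ^ 2) := by
  rw [gaussTerm, hu.compl, hu.plane, Fintype.sum_sum_type]
  congr 1
  simp only [frameCoeff, Sum.elim_inl, Sum.elim_inr, ← Finset.mul_sum]
  push_cast
  ring

lemma gaussTerm_smul (z : SymSpace Q) (t : ℂ) (c : ℝ) (x : RealSpace V) :
    gaussTerm z t (c • x) = gaussTerm z (c ^ 2 * t) x := by
  have h1 : proj z (c • x) = c • proj z x := map_smul _ _ _
  rw [gaussTerm, gaussTerm, h1, ← smul_sub, QuadraticMap.map_smul (realForm Q),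
    QuadraticMap.map_smul (realForm Q)]
  congr 1
  simp only [smul_eq_mul, map_mul, map_pow, Complex.conj_ofReal]
  push_cast
  ring

/-- A real shift is fixed by conjugation, so it multiplies both components of `Q` equally and they
recombine to `Q(x)`. -/
lemma gaussTerm_add_real (z : SymSpace Q) (t : ℂ) (q : ℝ) (x : RealSpace V) :
    gaussTerm z (q + t) x = Complex.exp (2 * Real.pi * Complex.I * (q * realForm Q x : ℝ)) *
      gaussTerm z t x := by
  rw [gaussTerm, gaussTerm, ← Complex.exp_add, realForm_eq_add_proj z x]
  congr 1
  simp only [map_add, Complex.conj_ofReal]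
  push_cast
  ring

lemma gaussTerm_neg (z : SymSpace Q) (t : ℂ) (x : RealSpace V) :
    gaussTerm z t (-x) = gaussTerm z t x := by
  have := gaussTerm_smul z t (-1) x
  simpa using this

lemma exists_isFrame (hQ : HasSignature Q p 2) (z : SymSpace Q) :
    ∃ u : Basis (Fin p ⊕ Fin 2) ℝ (RealSpace V), IsFrame Q p z u := by
  obtain ⟨u, h1, h2⟩ := exists_frame hQ z
  exact ⟨u, h1, h2⟩

lemma summable_gaussTerm (hQ : HasSignature Q p 2) [L.IsLattice ℚ] (z : SymSpace Q) {t : ℂ}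
    (ht : 0 < t.im) : Summable fun x : dualLattice Q L => ‖gaussTerm z t (toReal (x : V))‖ := by
  obtain ⟨u, hu⟩ := exists_isFrame hQ z
  obtain ⟨v, vd, e, ed, -, -, -, hed, -, -⟩ := exists_lattice_basis (L := L) hQ
  rw [← ed.summable_iff]
  have h := summable_gaussian_intVec ((vd.baseChange ℝ).equivFun.symm.trans u.equivFun)
    (frameCoeff_re_pos (p := p) ht)
  refine h.congr fun n => ?_
  rw [Function.comp_apply, hu.gaussTerm_eq, norm_cexp_neg_sum, hed]
  simp only [LinearEquiv.trans_apply, baseChange_equivFun_symm, Basis.equivFun_apply]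

/-- The Gram matrix of `L` is computed twice. As the base change from the basis of `L'` to that of
`L`, its determinant has absolute value the index `[L' : L]`. In a frame adapted to `z` it is `Mᵀ
diag(±1) M`, with determinant `± det(M)²`. -/
lemma sq_abs_det_eq_card_disc (hL : IsEven Q L) {z : SymSpace Q}
    {u : Basis (Fin p ⊕ Fin 2) ℝ (RealSpace V)}
    (hu : IsFrame Q p z u) {v vd : Basis (Fin p ⊕ Fin 2) ℚ V}
    (hv : L = Submodule.span ℤ (Set.range v))
    (hvd : dualLattice Q L = Submodule.span ℤ (Set.range vd))
    (hrepr : ∀ x i, vd.repr x i = bil Q x (v i)) :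
    |LinearMap.det ((v.baseChange ℝ).equivFun.symm.trans u.equivFun :
      ((Fin p ⊕ Fin 2) → ℝ) →ₗ[ℝ] ((Fin p ⊕ Fin 2) → ℝ))| ^ 2 = Nat.card (Disc Q L) := by
  classical
  set A := (v.baseChange ℝ).equivFun.symm.trans u.equivFun
  have h1 : (Nat.card (Disc Q L) : ℚ) = |vd.det v| :=
    AddSubgroup.relIndex_eq_abs_det L.toAddSubgroup (dualLattice Q L).toAddSubgroup
      (le_dualLattice hL) v vd
      (by rw [← Submodule.span_int_eq_addSubgroupClosure, ← hv])
      (by rw [← Submodule.span_int_eq_addSubgroupClosure, ← hvd])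
  set M := LinearMap.toMatrix' (A : ((Fin p ⊕ Fin 2) → ℝ) →ₗ[ℝ] ((Fin p ⊕ Fin 2) → ℝ)) with hM
  have hMij : ∀ i j, M i j = u.repr (toReal (v j)) i := by
    intro i j
    rw [hM, LinearMap.toMatrix'_apply]
    have h2 : (A : ((Fin p ⊕ Fin 2) → ℝ) →ₗ[ℝ] ((Fin p ⊕ Fin 2) → ℝ)) (Pi.single j 1)
        = u.equivFun (toReal (v j)) := by
      have h3 := baseChange_equivFun_symm v (Pi.single j 1)
      have h4 : intVec (Pi.single j (1 : ℤ)) = Pi.single j 1 := by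
        ext k
        simp only [intVec, Pi.single_apply]
        split_ifs <;> simp
      rw [h4] at h3
      simp only [Pi.single_apply, ite_smul, one_smul, zero_smul, Finset.sum_ite_eq',
        Finset.mem_univ, if_true] at h3
      rw [LinearEquiv.coe_coe, LinearEquiv.trans_apply]
      congr 1
    convert! congrFun h2 i using 2
  have hgram : (vd.toMatrix v).map (Rat.castHom ℝ) = M.transpose * Matrix.diagonal frameSign * M := by
    ext i j
    rw [Matrix.map_apply, Basis.toMatrix_apply, hrepr, Rat.coe_castHom, ← polar_toReal, hu.polar_eq,
      Matrix.mul_apply]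
    refine Finset.sum_congr rfl fun k _ => ?_
    rw [Matrix.mul_diagonal, Matrix.transpose_apply, hMij, hMij]
    ring
  have hdet : ((vd.det v : ℚ) : ℝ) = M.det ^ 2 * ∏ j : Fin p ⊕ Fin 2, frameSign j := by
    rw [Basis.det_apply, ← Rat.coe_castHom, RingHom.map_det]
    rw [RingHom.mapMatrix_apply, hgram, Matrix.det_mul, Matrix.det_mul, Matrix.det_transpose,
      Matrix.det_diagonal]
    ring
  have h5 : (Nat.card (Disc Q L) : ℝ) = |((vd.det v : ℚ) : ℝ)| := by
    rw [← Rat.cast_abs, ← h1, Rat.cast_natCast]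
  rw [h5, hdet, abs_mul, abs_pow, Finset.abs_prod, Finset.prod_eq_one, mul_one, hM,
    LinearMap.det_toMatrix']
  intro j _
  rcases j with j | j <;> simp [frameSign]

/-- Poisson summation for the Gaussians `gaussTerm` and the lattice `L`. -/
theorem tsum_gaussTerm_add (hQ : HasSignature Q p 2) [L.IsLattice ℚ] (hL : IsEven Q L)
    (z : SymSpace Q) {t T : ℂ} (ht : 0 < t.im) (htT : t * T = -1) (X : RealSpace V) :
    ∑' l : L, gaussTerm z t (toReal (l : V) + X) =
      (((√(Nat.card (Disc Q L)))⁻¹ : ℝ) : ℂ) * ((-(Complex.I * T)) ^ (1 / 2 : ℂ)) ^ p *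
        (Complex.I * (starRingEnd ℂ) T) *
        ∑' x : dualLattice Q L, gaussTerm z T (toReal (x : V)) *
          Complex.exp (2 * Real.pi * Complex.I *
            (QuadraticMap.polar (realForm Q) (toReal (x : V)) X : ℝ)) := by
  classical
  obtain ⟨u, hu⟩ := exists_isFrame hQ z
  obtain ⟨v, vd, e, ed, hv, hvd, he, hed, hdual, hrepr⟩ := exists_lattice_basis (L := L) hQ
  set A := (v.baseChange ℝ).equivFun.symm.trans u.equivFun with hA
  -- The polar form is a dot product with signs in the frame, so dual vectors for the plain dot
  -- product are obtained by flipping the negative coordinates. The Gaussian is even in each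
  -- coordinate and does not see the flip.
  let D := ((vd.baseChange ℝ).equivFun.symm.trans u.equivFun).trans
    (LinearEquiv.piCongrRight fun j => LinearEquiv.smulOfNeZero ℝ ℝ (frameSign j)
      (left_ne_zero_of_mul_eq_one (frameSign_mul_self j)))
  have hDapp : ∀ k j, D (intVec k) j = frameSign j * u.repr (toReal (ed k : V)) j := by
    intro k j
    have h1 := baseChange_equivFun_symm vd k
    simp only [D, LinearEquiv.trans_apply, h1, hed]
    simp
  obtain ⟨x, rfl⟩ := (v.baseChange ℝ).equivFun.symm.surjective X
  have hpair : ∀ k x, QuadraticMap.polar (realForm Q) (toReal (ed k : V))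
      ((v.baseChange ℝ).equivFun.symm x) = intPair k x := by
    intro k x
    rw [← QuadraticMap.polarBilin_apply_apply, Basis.equivFun_symm_apply, map_sum, hed, toReal_sum]
    refine Finset.sum_congr rfl fun i _ => ?_
    rw [map_smul, map_sum, LinearMap.sum_apply, Finset.sum_eq_single i]
    · rw [toReal_zsmul, map_smul, LinearMap.smul_apply, QuadraticMap.polarBilin_apply_apply,
        Basis.baseChange_apply, polar_toReal, hdual]
      simp [mul_comm]
    · intro j _ hj
      rw [toReal_zsmul, map_smul, LinearMap.smul_apply, QuadraticMap.polarBilin_apply_apply,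
        Basis.baseChange_apply, polar_toReal, hdual, if_neg hj]
      simp
    · simp
  have hD : ∀ k x, intPair k x = ∑ j, D (intVec k) j * A x j := by
    intro k x
    rw [← hpair, hu.polar_eq]
    refine Finset.sum_congr rfl fun j _ => ?_
    rw [hDapp]
    simp [A]
  have hTne : T ≠ 0 := fun h => by simp [h] at htT
  have htne : t ≠ 0 := fun h => by simp [h] at htT
  have hπ : (Real.pi : ℂ) ≠ 0 := Complex.ofReal_ne_zero.2 Real.pi_ne_zero
  have hconj : (starRingEnd ℂ) t * (starRingEnd ℂ) T = -1 := by
    rw [← map_mul, htT]; simp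
  have hcT : (starRingEnd ℂ) T ≠ 0 := right_ne_zero_of_mul (a := (starRingEnd ℂ) t) (by
    rw [hconj]; norm_num)
  have hct : (starRingEnd ℂ) t ≠ 0 := left_ne_zero_of_mul (b := (starRingEnd ℂ) T) (by
    rw [hconj]; norm_num)
  have htT' : t = -1 / T := by rw [eq_div_iff hTne, htT]
  have hct' : (starRingEnd ℂ) t = -1 / (starRingEnd ℂ) T := by rw [eq_div_iff hcT, hconj]
  have hinl : (Real.pi : ℂ) / -(Real.pi * Complex.I * t) = -(Complex.I * T) := by
    rw [htT']
    field_simp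
    rw [Complex.I_sq]; ring
  have hinr : (Real.pi : ℂ) / (Real.pi * Complex.I * (starRingEnd ℂ) t)
      = Complex.I * (starRingEnd ℂ) T := by
    rw [hct']
    field_simp
    rw [Complex.I_sq]
  have main := poisson_summation_gaussian A D (frameCoeff_re_pos (p := p) ht) hD x
  have hdetA : |LinearMap.det (A : ((Fin p ⊕ Fin 2) → ℝ) →ₗ[ℝ] ((Fin p ⊕ Fin 2) → ℝ))|
      = √(Nat.card (Disc Q L)) := by
    rw [← sq_abs_det_eq_card_disc hL hu hv hvd hrepr, Real.sqrt_sq (abs_nonneg _)]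
  rw [← e.tsum_eq, ← ed.tsum_eq]
  have hl : ∀ n : (Fin p ⊕ Fin 2) → ℤ,
      gaussTerm z t (toReal (e n : V) + (v.baseChange ℝ).equivFun.symm x) =
      Complex.exp (-∑ i, frameCoeff t i * (A (x + intVec n) i : ℂ) ^ 2) := by
    intro n
    rw [hu.gaussTerm_eq, hA, LinearEquiv.trans_apply, map_add _ x, baseChange_equivFun_symm, he,
      add_comm (toReal _)]
    rfl
  have hr : ∀ k : (Fin p ⊕ Fin 2) → ℤ, gaussTerm z T (toReal (ed k : V)) =
      Complex.exp (-∑ i, (Real.pi ^ 2 / frameCoeff t i) * (D (intVec k) i : ℂ) ^ 2) := by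
    intro k
    rw [hu.gaussTerm_eq]
    congr 2
    refine Finset.sum_congr rfl fun j _ => ?_
    rw [hDapp]
    have h1 : (Real.pi : ℂ) ^ 2 / frameCoeff t j = frameCoeff T j := by
      rcases j with j | j
      · simp only [frameCoeff, Sum.elim_inl]
        rw [sq, mul_div_assoc, hinl]; ring
      · simp only [frameCoeff, Sum.elim_inr]
        rw [sq, mul_div_assoc, hinr]; ring
    have h2 : ((frameSign j : ℝ) : ℂ) ^ 2 = 1 := by
      rw [sq, ← Complex.ofReal_mul, frameSign_mul_self, Complex.ofReal_one]
    rw [h1, Complex.ofReal_mul, mul_pow, h2, one_mul]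
  simp only [hl, hr, hpair]
  rw [main, hdetA]
  congr 1
  rw [mul_assoc]
  congr 1
  rw [Fintype.prod_sum_type]
  simp only [frameCoeff, Sum.elim_inl, Sum.elim_inr, hinl, hinr, Finset.prod_const,
    Finset.card_univ, Fintype.card_fin]
  congr 1
  -- The two negative directions contribute `(i T̄)^(1/2)` twice, hence `i T̄` with no choice of
  -- branch.
  rw [← Complex.cpow_nat_mul]
  norm_num

end LatticeSums

/-! ### Branches of the square root on the metaplectic group -/

section Metaplectic

lemma cpow_half_sq (x : ℂ) : (x ^ (1 / 2 : ℂ)) ^ 2 = x := by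
  rw [one_div]
  exact Complex.cpow_nat_inv_pow x two_ne_zero

lemma cpow_half_mul {x y : ℂ} (hx : x ≠ 0) (hy : y ≠ 0)
    (h : x.arg + y.arg ∈ Set.Ioc (-Real.pi) Real.pi) :
    (x * y) ^ (1 / 2 : ℂ) = x ^ (1 / 2 : ℂ) * y ^ (1 / 2 : ℂ) := by
  rw [Complex.cpow_def_of_ne_zero (mul_ne_zero hx hy), Complex.cpow_def_of_ne_zero hx,
    Complex.cpow_def_of_ne_zero hy, (Complex.log_mul_eq_add_log_iff hx hy).2 h, add_mul,
    Complex.exp_add]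

lemma denom_int_ne_zero (γ : SL(2, ℤ)) (τ : ℍ) :
    ((γ 1 0 : ℤ) : ℂ) * (τ : ℂ) + ((γ 1 1 : ℤ) : ℂ) ≠ 0 := by
  rw [← ModularGroup.denom_apply]
  exact denom_ne_zero _ τ

lemma continuous_cpow_half_denom (γ : SL(2, ℤ)) :
    Continuous fun τ : ℍ => (((γ 1 0 : ℤ) : ℂ) * (τ : ℂ) + ((γ 1 1 : ℤ) : ℂ)) ^ (1 / 2 : ℂ) := by
  by_cases hc : γ 1 0 = 0
  · simp only [hc, Int.cast_zero, zero_mul, zero_add]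
    exact continuous_const
  · refine continuous_iff_continuousAt.2 fun τ => ContinuousAt.comp
      (g := fun x : ℂ => x ^ (1 / 2 : ℂ))
      (f := fun τ : ℍ => ((γ 1 0 : ℤ) : ℂ) * (τ : ℂ) + ((γ 1 1 : ℤ) : ℂ))
      (continuousAt_cpow_const (Or.inr ?_)) (by fun_prop)
    have : (γ 1 0 : ℝ) * τ.im ≠ 0 := mul_ne_zero (Int.cast_ne_zero.2 hc) τ.im_pos.ne'
    simpa using this

lemma mdifferentiable_cpow_half_denom (γ : SL(2, ℤ)) :
    MDifferentiable 𝓘(ℂ) 𝓘(ℂ)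
      fun τ : ℍ => (((γ 1 0 : ℤ) : ℂ) * (τ : ℂ) + ((γ 1 1 : ℤ) : ℂ)) ^ (1 / 2 : ℂ) := by
  by_cases hc : γ 1 0 = 0
  · simp only [hc, Int.cast_zero, zero_mul, zero_add]
    exact mdifferentiable_const
  · rw [UpperHalfPlane.mdifferentiable_iff]
    intro z hz
    have hz' : 0 < z.im := hz
    have h1 : DifferentiableAt ℂ
        (fun z : ℂ => (((γ 1 0 : ℤ) : ℂ) * z + ((γ 1 1 : ℤ) : ℂ)) ^ (1 / 2 : ℂ)) z := by
      refine DifferentiableAt.cpow_const (by fun_prop) (Or.inr ?_)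
      have : (γ 1 0 : ℝ) * z.im ≠ 0 := mul_ne_zero (Int.cast_ne_zero.2 hc) hz'.ne'
      simpa using this
    refine (h1.congr_of_eventuallyEq ?_).differentiableWithinAt
    filter_upwards [(isOpen_lt continuous_const Complex.continuous_im).mem_nhds hz'] with y hy
    simp [UpperHalfPlane.ofComplex_apply_of_im_pos hy]

namespace Mp2Z

lemma continuous_root (g : Mp2Z) : Continuous g.root := g.root_holo.continuous

/-- The holomorphic root is the sign times the principal root. -/
lemma root_eq_sign_mul (g : Mp2Z) (τ : ℍ) :
    g.root τ = g.sign *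
      (((g.mat 1 0 : ℤ) : ℂ) * (τ : ℂ) + ((g.mat 1 1 : ℤ) : ℂ)) ^ (1 / 2 : ℂ) := by
  set f : ℍ → ℂ :=
    fun τ => (((g.mat 1 0 : ℤ) : ℂ) * (τ : ℂ) + ((g.mat 1 1 : ℤ) : ℂ)) ^ (1 / 2 : ℂ) with hf
  have hne : ∀ τ, f τ ≠ 0 := fun τ h => by
    have := cpow_half_sq (((g.mat 1 0 : ℤ) : ℂ) * (τ : ℂ) + ((g.mat 1 1 : ℤ) : ℂ))
    rw [show (((g.mat 1 0 : ℤ) : ℂ) * (τ : ℂ) + ((g.mat 1 1 : ℤ) : ℂ)) ^ (1 / 2 : ℂ) = 0 from h]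
      at this
    exact denom_int_ne_zero g.mat τ (by rw [← this]; norm_num)
  have hsign : g.sign = g.root UpperHalfPlane.I / f UpperHalfPlane.I := rfl
  have h := isPreconnected_univ.eq_or_eq_neg_of_sq_eq (f := g.root) (g := f)
    g.continuous_root.continuousOn (continuous_cpow_half_denom g.mat).continuousOn
    (fun τ _ => by
      rw [Pi.pow_apply, Pi.pow_apply, g.root_sq, hf]
      exact (cpow_half_sq _).symm) (fun _ => hne _)
  rcases h with h | h
  · rw [hsign, h (Set.mem_univ UpperHalfPlane.I), div_self (hne _), one_mul]
    exact h (Set.mem_univ τ)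
  · have h1 : g.root UpperHalfPlane.I = -f UpperHalfPlane.I := h (Set.mem_univ _)
    rw [hsign, h1, neg_div, div_self (hne _), neg_one_mul]
    exact h (Set.mem_univ τ)

lemma sign_sq (g : Mp2Z) : g.sign ^ 2 = 1 := by
  rw [sign, div_pow, cpow_half_sq, g.root_sq]
  exact div_self (denom_int_ne_zero g.mat UpperHalfPlane.I)

lemma inv_mat_entries (g : Mp2Z) : g⁻¹.mat 0 0 = g.mat 1 1 ∧ g⁻¹.mat 0 1 = -g.mat 0 1 ∧
    g⁻¹.mat 1 0 = -g.mat 1 0 ∧ g⁻¹.mat 1 1 = g.mat 0 0 := by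
  rw [inv_mat, Matrix.SpecialLinearGroup.SL2_inv_expl]
  exact ⟨rfl, rfl, rfl, rfl⟩

/-- The slash operator combines the root of `g` with the sign of `g⁻¹`. Since `g⁻¹.root (gτ)` is the
inverse of `g.root τ`, comparing it with the principal branch eliminates the sign. The inverse stays
inside the principal root, because it cannot be pulled out when `cτ + d` is negative real. -/
lemma sign_inv_mul_root (g : Mp2Z) (τ : ℍ) : g⁻¹.sign * g.root τ =
    (((((g.mat 1 0 : ℤ) : ℂ) * (τ : ℂ) + ((g.mat 1 1 : ℤ) : ℂ))⁻¹) ^ (1 / 2 : ℂ))⁻¹ := by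
  have h1 := root_eq_sign_mul g⁻¹ (g.mat • τ)
  rw [inv_root, inv_mat, inv_smul_smul, ← inv_mat] at h1
  have h2 : ((g⁻¹.mat 1 0 : ℤ) : ℂ) * ((g.mat • τ : ℍ) : ℂ) + ((g⁻¹.mat 1 1 : ℤ) : ℂ)
      = (((g.mat 1 0 : ℤ) : ℂ) * (τ : ℂ) + ((g.mat 1 1 : ℤ) : ℂ))⁻¹ := by
    have hne := denom_int_ne_zero g.mat τ
    have h3 := denom_mul_coe g.mat⁻¹ g.mat τ
    rw [inv_mul_cancel, ModularGroup.denom_apply, ModularGroup.denom_apply,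
      ModularGroup.denom_apply] at h3
    rw [inv_mat]
    refine eq_inv_of_mul_eq_one_left ?_
    rw [← h3]
    simp
  rw [h2] at h1
  have hr := g.root_ne_zero τ
  have hs : g⁻¹.sign ≠ 0 := fun h => by have := sign_sq g⁻¹; rw [h] at this; norm_num at this
  rw [eq_comm, inv_eq_iff_eq_inv, mul_inv_rev, h1]
  field_simp

end Mp2Z

lemma sqrtI_eq : sqrtI = Complex.I ^ (1 / 2 : ℂ) := by
  rw [Complex.cpow_def_of_ne_zero Complex.I_ne_zero, Complex.log_I, sqrtI]
  congr 1; ring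

lemma sqrtI_sq : sqrtI ^ 2 = Complex.I := by rw [sqrtI_eq, cpow_half_sq]

/-- With `T = i · (-iT)` and `-iT` in the right half-plane, the arguments add up without leaving
`(-π, π]`, so the principal root is multiplicative here. -/
lemma cpow_half_of_im_pos {T : ℂ} (hT : 0 < T.im) :
    T ^ (1 / 2 : ℂ) = sqrtI * (-(Complex.I * T)) ^ (1 / 2 : ℂ) := by
  have hT0 : T ≠ 0 := fun h => by simp [h] at hT
  have harg : |(-(Complex.I * T)).arg| < Real.pi / 2 :=
    Complex.abs_arg_lt_pi_div_two_iff.2 (Or.inl (by simpa using hT))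
  rw [sqrtI_eq, ← cpow_half_mul Complex.I_ne_zero (by simp [hT0])]
  · congr 1
    rw [mul_neg, ← mul_assoc, Complex.I_mul_I]; ring
  · rw [Complex.arg_I]
    rw [abs_lt] at harg
    constructor <;> linarith [Real.pi_pos]

lemma cpow_half_neg_of_im_pos {T : ℂ} (hT : 0 < T.im) :
    (-T) ^ (1 / 2 : ℂ) = sqrtI⁻¹ * (-(Complex.I * T)) ^ (1 / 2 : ℂ) := by
  have hT0 : T ≠ 0 := fun h => by simp [h] at hT
  have harg : |(-(Complex.I * T)).arg| < Real.pi / 2 :=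
    Complex.abs_arg_lt_pi_div_two_iff.2 (Or.inl (by simpa using hT))
  have h1 : (-Complex.I) ^ (1 / 2 : ℂ) = sqrtI⁻¹ := by
    rw [Complex.cpow_def_of_ne_zero (neg_ne_zero.2 Complex.I_ne_zero), Complex.log_neg_I, sqrtI,
      ← Complex.exp_neg]
    congr 1; ring
  rw [← h1, ← cpow_half_mul (neg_ne_zero.2 Complex.I_ne_zero) (by simp [hT0])]
  · congr 1
    rw [neg_mul_neg, ← mul_assoc, Complex.I_mul_I]; ring
  · rw [Complex.arg_neg_I]
    rw [abs_lt] at harg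
    constructor <;> linarith [Real.pi_pos]

lemma cpow_half_ofReal_mul {r : ℝ} (hr : 0 < r) (x : ℂ) :
    ((r : ℂ) * x) ^ (1 / 2 : ℂ) = (√r : ℝ) * x ^ (1 / 2 : ℂ) := by
  rcases eq_or_ne x 0 with rfl | hx
  · simp
  rw [cpow_half_mul (Complex.ofReal_ne_zero.2 hr.ne') hx]
  · congr 1
    rw [Real.sqrt_eq_rpow, Complex.ofReal_cpow hr.le]
    norm_num
  · rw [Complex.arg_ofReal_of_nonneg hr.le, zero_add]
    exact Complex.arg_mem_Ioc x

end Metaplectic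

/-! ### Residues modulo `c` and the exponential sums of Shintani's formula -/

section QuotMul

variable {V : Type*} [AddCommGroup V] {L : Submodule ℤ V}

/-- The quotient `L / cL`. -/
abbrev QuotMul (L : Submodule ℤ V) (c : ℤ) : Type _ := L ⧸ (Ideal.span {c} • (⊤ : Submodule ℤ L))

lemma quotMul_eq_iff {c : ℤ} {l m : L} :
    (Submodule.Quotient.mk l : QuotMul L c) = Submodule.Quotient.mk m ↔ ∃ k : L, l = m + c • k := by
  rw [Submodule.Quotient.eq, Submodule.ideal_span_singleton_smul, Submodule.mem_smul_pointwise_iff_exists]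
  constructor
  · rintro ⟨k, -, hk⟩
    exact ⟨k, by rw [hk]; abel⟩
  · rintro ⟨k, hk⟩
    exact ⟨k, trivial, by rw [hk]; abel⟩

lemma mk_out_quotMul {c : ℤ} (r : QuotMul L c) :
    (Submodule.Quotient.mk r.out : QuotMul L c) = r := Quotient.out_eq r

/-- Periodicity modulo `cL` makes the sum independent of the representatives chosen by `out`; after
a permutation of the classes the representatives `g r.out` serve equally well. -/
lemma finsum_quotMul_out {c : ℤ} (f : L → ℂ) (hf : ∀ l k : L, f (l + c • k) = f l)
    (e : QuotMul L c ≃ QuotMul L c) (g : L → L)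
    (he : ∀ l, e (Submodule.Quotient.mk l) = Submodule.Quotient.mk (g l)) :
    ∑ᶠ r : QuotMul L c, f (g r.out) = ∑ᶠ r : QuotMul L c, f r.out := by
  rw [← finsum_comp_equiv e (f := fun r => f r.out)]
  refine finsum_congr fun r => ?_
  have h1 : (Submodule.Quotient.mk (e r).out : QuotMul L c) = Submodule.Quotient.mk (g r.out) := by
    rw [mk_out_quotMul, ← he, mk_out_quotMul]
  obtain ⟨k, hk⟩ := quotMul_eq_iff.1 h1
  rw [hk, hf]

lemma finite_quotMul [Module.Finite ℤ L] {c : ℤ} (hc : c ≠ 0) : Finite (QuotMul L c) := by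
  refine Module.finite_of_fg_torsion _ fun r => ?_
  obtain ⟨l, rfl⟩ := Submodule.Quotient.mk_surjective _ r
  refine ⟨⟨c, mem_nonZeroDivisors_of_ne_zero hc⟩, ?_⟩
  change c • (Submodule.Quotient.mk l : QuotMul L c) = 0
  rw [← Submodule.Quotient.mk_smul, ← Submodule.Quotient.mk_zero, quotMul_eq_iff]
  exact ⟨l, (zero_add _).symm⟩

end QuotMul

section GaussSums

variable {V : Type*} [AddCommGroup V] [Module ℚ V] {Q : QuadraticForm ℚ V} {L : Submodule ℤ V}

lemma ee_add (x y : ℚ) : ee (x + y) = ee x * ee y := by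
  rw [ee, ee, ee, ← Complex.exp_add]
  congr 1
  push_cast
  ring

lemma ee_int (n : ℤ) : ee n = 1 := by
  rw [ee]
  have := Complex.exp_int_mul_two_pi_mul_I n
  rw [← this]
  congr 1
  push_cast
  ring

lemma norm_ee (q : ℚ) : ‖ee q‖ = 1 := by
  have : (2 * Real.pi * Complex.I * (q : ℂ)) = ((2 * Real.pi * q : ℝ) : ℂ) * Complex.I := by
    push_cast; ring
  rw [ee, this, Complex.norm_exp_ofReal_mul_I]

lemma ee_eq_of_sub {x y : ℚ} (n : ℤ) (h : x = y + n) : ee x = ee y := by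
  rw [h, ee_add, ee_int, mul_one]

variable (Q L) in
/-- The exponential sum in Shintani's formula. -/
def gaussSum (c a d : ℤ) (x y : V) : ℂ :=
  ∑ᶠ r : QuotMul L c,
    ee (-((a : ℚ) * bil Q (x + (r.out : L)) (x + (r.out : L))
      - 2 * bil Q y (x + (r.out : L)) + (d : ℚ) * bil Q y y) / (2 * (c : ℚ)))

lemma bil_add_left (x y w : V) : bil Q (x + y) w = bil Q x w + bil Q y w :=
  QuadraticMap.polar_add_left Q x y w

lemma bil_add_right (x y w : V) : bil Q x (y + w) = bil Q x y + bil Q x w :=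
  QuadraticMap.polar_add_right Q x y w

lemma bil_smul_left (n : ℤ) (x y : V) : bil Q (n • x) y = n * bil Q x y := by
  rw [bil, map_zsmul, LinearMap.smul_apply, zsmul_eq_mul]

lemma bil_smul_right (n : ℤ) (x y : V) : bil Q x (n • y) = n * bil Q x y := by
  rw [bil, map_zsmul, zsmul_eq_mul]

lemma bil_comm (x y : V) : bil Q x y = bil Q y x := QuadraticMap.polar_comm Q x y

lemma bil_self (x : V) : bil Q x x = 2 * Q x := by
  rw [bil, QuadraticMap.polarBilin_apply_apply, QuadraticMap.polar_self, two_smul, two_mul]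

variable (Q) in
/-- The phase in Shintani's formula. -/
def gaussPhase (c a d : ℤ) (x y : V) : ℚ :=
  -((a : ℚ) * bil Q x x - 2 * bil Q y x + (d : ℚ) * bil Q y y) / (2 * (c : ℚ))

/-- The phase changes by `-a(x,k) + (y,k) - ac Q(k)`. The pairings are integral on `L' × L`, and
evenness makes `Q(k)` an integer. -/
lemma ee_gaussPhase_add_left (hL : IsEven Q L) {c : ℤ} (hc : c ≠ 0) (a d : ℤ)
    (x y : dualLattice Q L) (k : L) :
    ee (gaussPhase Q c a d (x + (c • k : L)) y) = ee (gaussPhase Q c a d x y) := by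
  obtain ⟨m, hm⟩ := exists_int_bil x k
  obtain ⟨n, hn⟩ := exists_int_bil y k
  obtain ⟨q, hq⟩ := hL k k.2
  refine ee_eq_of_sub (-(a * m) + n - a * c * q) ?_
  have hc' : (c : ℚ) ≠ 0 := Int.cast_ne_zero.2 hc
  simp only [gaussPhase, Submodule.coe_smul, bil_add_left, bil_add_right, bil_smul_left,
    bil_smul_right, bil_comm (k : V) (x : V), bil_self (k : V), hm, hn, hq]
  push_cast
  field_simp
  ring

/-- The change of phase carries the factor `ad - 1 = bc`, which cancels the denominator and leaves
the integer `-b(y,k) - ab Q(k)`. -/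
lemma ee_gaussPhase_swap (hL : IsEven Q L) {c : ℤ} (hc : c ≠ 0) {a b d : ℤ}
    (had : a * d - b * c = 1) (x y : dualLattice Q L) (k : L) :
    ee (gaussPhase Q c a d (x + k) (y + (a • k : L))) = ee (gaussPhase Q c a d x y) := by
  obtain ⟨m, hm⟩ := exists_int_bil x k
  obtain ⟨n, hn⟩ := exists_int_bil y k
  obtain ⟨q, hq⟩ := hL k k.2
  have had' : (a : ℚ) * d = 1 + b * c := by
    have : ((a * d - b * c : ℤ) : ℚ) = 1 := by rw [had]; simp
    push_cast at this; linarith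
  refine ee_eq_of_sub (-(b * n) - a * b * q) ?_
  have hc' : (c : ℚ) ≠ 0 := Int.cast_ne_zero.2 hc
  simp only [gaussPhase, Submodule.coe_smul, bil_add_left, bil_add_right, bil_smul_left,
    bil_smul_right, bil_comm (k : V) (x : V), bil_comm (k : V) (y : V), bil_self (k : V), hm, hn, hq]
  push_cast
  field_simp
  linear_combination (-2 * n - 2 * a * q : ℚ) * had'

lemma gaussSum_add_left (hL : IsEven Q L) {c : ℤ} (hc : c ≠ 0) (a d : ℤ)
    (x y : dualLattice Q L) (k : L) :
    gaussSum Q L c a d (x + (k : V)) y = gaussSum Q L c a d x y := by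
  have hx' : ∀ l : L, (x : V) + l ∈ dualLattice Q L := fun l =>
    add_mem x.2 (le_dualLattice hL l.2)
  let f : L → ℂ := fun l => ee (gaussPhase Q c a d (x + (l : V)) y)
  have hf : ∀ l m : L, f (l + c • m) = f l := by
    intro l m
    have := ee_gaussPhase_add_left hL hc a d ⟨_, hx' l⟩ y m
    simpa [f, add_assoc] using this
  have := finsum_quotMul_out f hf (Equiv.addLeft (Submodule.Quotient.mk k)) (fun l => k + l)
    (fun l => rfl)
  simpa [f, gaussSum, gaussPhase, add_assoc] using this

/-- Reciprocity: the summation may be moved from one variable to the other. -/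
lemma gaussSum_eq_swap (hL : IsEven Q L) {c : ℤ} (hc : c ≠ 0) {a b d : ℤ}
    (had : a * d - b * c = 1) (x y : dualLattice Q L) :
    gaussSum Q L c a d x y =
      ∑ᶠ r : QuotMul L c, ee (gaussPhase Q c a d x ((y : V) + (r.out : L))) := by
  have hy' : ∀ l : L, (y : V) + l ∈ dualLattice Q L := fun l =>
    add_mem y.2 (le_dualLattice hL l.2)
  let f : L → ℂ := fun l => ee (gaussPhase Q c a d x ((y : V) + l))
  have hf : ∀ l m : L, f (l + c • m) = f l := by
    intro l m
    obtain ⟨n, hn⟩ := exists_int_bil x m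
    obtain ⟨n', hn'⟩ := exists_int_bil ⟨_, hy' l⟩ m
    obtain ⟨q, hq⟩ := hL m m.2
    refine ee_eq_of_sub (n - d * n' - d * c * q) ?_
    have hc' : (c : ℚ) ≠ 0 := Int.cast_ne_zero.2 hc
    simp only [bil_add_left] at hn'
    simp only [gaussPhase, Submodule.coe_smul, Submodule.coe_add, bil_add_left, bil_add_right,
      bil_smul_left, bil_smul_right, bil_comm (m : V) _, bil_self (m : V), hn, hq]
    push_cast
    have h1 := hn'
    field_simp
    linear_combination (-2 * c * d : ℚ) * h1
  -- Since `ad ≡ 1` modulo `c`, multiplication by `-a` permutes `L/cL`, with inverse multiplication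
  -- by `-d`.
  let e : QuotMul L c ≃ QuotMul L c :=
    { toFun := fun r => (-a) • r
      invFun := fun r => (-d) • r
      left_inv := by
        intro r
        obtain ⟨l, rfl⟩ := Submodule.Quotient.mk_surjective _ r
        beta_reduce
        rw [← Submodule.Quotient.mk_smul, ← Submodule.Quotient.mk_smul, quotMul_eq_iff]
        refine ⟨b • l, ?_⟩
        rw [smul_smul, smul_smul]
        have : -d * -a = 1 + c * b := by linear_combination had
        rw [this, add_smul, one_smul]
      right_inv := by
        intro r
        obtain ⟨l, rfl⟩ := Submodule.Quotient.mk_surjective _ r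
        beta_reduce
        rw [← Submodule.Quotient.mk_smul, ← Submodule.Quotient.mk_smul, quotMul_eq_iff]
        refine ⟨b • l, ?_⟩
        rw [smul_smul, smul_smul]
        have : -a * -d = 1 + c * b := by linear_combination had
        rw [this, add_smul, one_smul] }
  have h1 := finsum_quotMul_out f hf e (fun l => (-a) • l) (fun l => rfl)
  change _ = ∑ᶠ r : QuotMul L c, f r.out
  rw [← h1]
  refine finsum_congr fun r => ?_
  -- The simultaneous shift by `(r, ar)` takes the pair `(x, y - ar)` to `(x + r, y)`.
  have h2 := ee_gaussPhase_swap hL hc had x ⟨_, hy' (-a • r.out)⟩ r.out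
  have h3 : (y : V) + ((-a • r.out : L) : V) + ((a • r.out : L) : V) = y := by
    rw [add_assoc, ← Submodule.coe_add, ← add_smul]; simp
  simp only [h3] at h2
  exact h2

end GaussSums

/-! ### The theta function under the metaplectic group -/

section ThetaTransformation

open Module

variable {V : Type*} [AddCommGroup V] [Module ℚ V] {Q : QuadraticForm ℚ V} {L : Submodule ℤ V}

lemma ee_eq_exp (q : ℚ) : ee q = Complex.exp (2 * Real.pi * Complex.I * ((q : ℝ) : ℂ)) := by
  simp [ee]

lemma toDisc_eq_iff {x y : dualLattice Q L} :
    toDisc Q L x = toDisc Q L y ↔ ∃ l : L, (x : V) = y + l := by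
  rw [toDisc, toDisc, Submodule.Quotient.eq]
  change (x : V) - y ∈ L ↔ _
  constructor
  · intro h
    exact ⟨⟨_, h⟩, by simp⟩
  · rintro ⟨l, hl⟩
    simp [hl]

lemma toDisc_out (μ : Disc Q L) : toDisc Q L (Quotient.out μ) = μ := Quotient.out_eq μ

lemma map_add_zsmul (x k : V) (n : ℤ) :
    Q (x + n • k) = Q x + n * bil Q x k + n ^ 2 * Q k := by
  have h := bil_self (Q := Q) (x + n • k)
  rw [bil_add_left, bil_add_right, bil_add_right, bil_smul_left, bil_smul_left, bil_smul_right,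
    bil_smul_right, bil_comm k x, bil_self x, bil_self k] at h
  linarith

lemma add_coe_injective (hL : IsEven Q L) (y : dualLattice Q L) :
    Function.Injective fun l : L => (⟨y + l, add_mem y.2 (le_dualLattice hL l.2)⟩ : dualLattice Q L) := by
  intro l m h
  have := congrArg Subtype.val h
  exact Subtype.ext (add_left_cancel this)

open scoped Classical in
lemma basisVec_apply (μ ν : Disc Q L) : basisVec Q L μ ν = if ν = μ then 1 else 0 := by
  rw [basisVec, Pi.single_apply]

variable (L) in
/-- Division with remainder by `c` in the lattice `L`. -/
def divModEquiv {c : ℤ} (hc : c ≠ 0) : QuotMul L c × L ≃ L :=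
  Equiv.ofBijective (fun rk => rk.1.out + c • rk.2) (by
    have : Module.IsTorsionFree ℤ V := Module.IsTorsionFree.trans_faithfulSMul ℤ ℚ V
    constructor
    · rintro ⟨r, k⟩ ⟨r', k'⟩ h
      simp only at h
      have h1 : r = r' := by
        rw [← mk_out_quotMul r, ← mk_out_quotMul r', quotMul_eq_iff]
        exact ⟨k' - k, by rw [smul_sub, ← add_sub_assoc, ← h]; abel⟩
      subst h1
      have h2 := add_left_cancel h
      rw [smul_right_injective L hc h2]
    · intro l
      obtain ⟨k, hk⟩ := quotMul_eq_iff.1 (mk_out_quotMul (Submodule.Quotient.mk l : QuotMul L c)).symm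
      exact ⟨⟨Submodule.Quotient.mk l, k⟩, hk.symm⟩)

variable [FiniteDimensional ℚ V] {p : ℕ}

/-- The cardinality of `L'/L` is the square of a nonzero determinant, so `Nat.card` is not the value
0 assigned to infinite types. -/
lemma finite_disc (hQ : HasSignature Q p 2) [L.IsLattice ℚ] (hL : IsEven Q L) (z : SymSpace Q) :
    Finite (Disc Q L) := by
  obtain ⟨u, hu⟩ := exists_isFrame hQ z
  obtain ⟨v, vd, e, ed, hv, hvd, -, -, -, hrepr⟩ := exists_lattice_basis (L := L) hQ
  have h := sq_abs_det_eq_card_disc hL hu hv hvd hrepr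
  refine Nat.finite_of_card_ne_zero fun h0 => ?_
  rw [h0, Nat.cast_zero, sq_eq_zero_iff, abs_eq_zero] at h
  exact (LinearEquiv.isUnit_det' _).ne_zero h

lemma siegelTheta_eq (τ : ℍ) (z : SymSpace Q) (φ : SchwartzL Q L) :
    siegelTheta L τ z φ = (τ.im : ℂ) *
      ∑' x : dualLattice Q L, φ (toDisc Q L x) * gaussTerm z τ (toReal (x : V)) := rfl

lemma summable_mul_gaussTerm (hQ : HasSignature Q p 2) [L.IsLattice ℚ] (hL : IsEven Q L)
    (z : SymSpace Q) {t : ℂ} (ht : 0 < t.im) (φ : SchwartzL Q L) :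
    Summable fun x : dualLattice Q L => φ (toDisc Q L x) * gaussTerm z t (toReal (x : V)) := by
  have := finite_disc hQ hL z
  have := Fintype.ofFinite (Disc Q L)
  refine Summable.of_norm_bounded ((summable_gaussTerm (L := L) hQ z ht).mul_left (∑ μ, ‖φ μ‖))
    fun x => ?_
  rw [norm_mul]
  exact mul_le_mul_of_nonneg_right
    (Finset.single_le_sum (f := fun μ => ‖φ μ‖) (fun _ _ => norm_nonneg _) (Finset.mem_univ _))
    (norm_nonneg _)

lemma siegelTheta_sum (hQ : HasSignature Q p 2) [L.IsLattice ℚ] (hL : IsEven Q L)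
    (τ : ℍ) (z : SymSpace Q) {ι : Type*} (s : Finset ι) (c : ι → ℂ) (ψ : ι → SchwartzL Q L) :
    siegelTheta L τ z (∑ i ∈ s, c i • ψ i) = ∑ i ∈ s, c i * siegelTheta L τ z (ψ i) := by
  simp only [siegelTheta_eq, Finset.sum_apply, Pi.smul_apply, smul_eq_mul, Finset.sum_mul]
  rw [Summable.tsum_finsetSum, Finset.mul_sum]
  · refine Finset.sum_congr rfl fun i _ => ?_
    simp only [mul_assoc]
    rw [tsum_mul_left]
    ring
  · intro i _
    simp only [mul_assoc]
    exact (summable_mul_gaussTerm hQ hL z τ.im_pos (ψ i)).mul_left _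

lemma summable_gaussTerm_coset (hQ : HasSignature Q p 2) [L.IsLattice ℚ] (hL : IsEven Q L)
    (z : SymSpace Q) {t : ℂ} (ht : 0 < t.im) (y : dualLattice Q L) :
    Summable fun l : L => gaussTerm z t (toReal ((y : V) + l)) := by
  have h : Summable fun x : dualLattice Q L => gaussTerm z t (toReal (x : V)) :=
    (summable_gaussTerm (L := L) hQ z ht).of_norm
  have h2 := h.comp_injective (add_coe_injective hL y)
  simp only [Function.comp_def] at h2
  exact h2

lemma siegelTheta_basisVec (hL : IsEven Q L) (τ : ℍ) (z : SymSpace Q) (y : dualLattice Q L) :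
    siegelTheta L τ z (basisVec Q L (toDisc Q L y)) =
      (τ.im : ℂ) * ∑' l : L, gaussTerm z τ (toReal ((y : V) + l)) := by
  rw [siegelTheta_eq, ← (add_coe_injective hL y).tsum_eq]
  · congr 1
    refine tsum_congr fun l => ?_
    rw [basisVec_apply, if_pos (toDisc_eq_iff.2 ⟨l, rfl⟩), one_mul]
  · intro x hx
    rw [Function.mem_support, basisVec_apply] at hx
    by_cases h : toDisc Q L x = toDisc Q L y
    · obtain ⟨l, hl⟩ := toDisc_eq_iff.1 h
      exact ⟨l, Subtype.ext hl.symm⟩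
    · simp [h] at hx

/-- The transformation of the theta series of a coset under `γ` with lower left entry `c ≠ 0`. -/
lemma tsum_gaussTerm_smul (hQ : HasSignature Q p 2) [L.IsLattice ℚ] (hL : IsEven Q L)
    (z : SymSpace Q) (γ : SL(2, ℤ)) (hc : γ 1 0 ≠ 0) (τ : ℍ) (y : dualLattice Q L) {T : ℂ}
    (hT : T = τ + (γ 1 1 : ℂ) / (γ 1 0 : ℂ)) :
    ∑' l : L, gaussTerm z ((γ • τ : ℍ) : ℂ) (toReal ((y : V) + l)) =
      (((√(Nat.card (Disc Q L)))⁻¹ : ℝ) : ℂ) * ((-(Complex.I * T)) ^ (1 / 2 : ℂ)) ^ p *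
        (Complex.I * (starRingEnd ℂ) T) *
        ∑' x : dualLattice Q L, gaussSum Q L (-γ 1 0) (γ 1 1) (γ 0 0) x y *
          gaussTerm z τ (toReal (x : V)) := by
  set a := γ 0 0 with ha
  set b := γ 0 1 with hb
  set c := γ 1 0 with hcdef
  set d := γ 1 1 with hd
  have hdet : a * d - b * c = 1 := by
    have := γ.det_coe
    rwa [Matrix.det_fin_two] at this
  have hcC : (c : ℂ) ≠ 0 := Int.cast_ne_zero.2 hc
  have hcQ : (c : ℚ) ≠ 0 := Int.cast_ne_zero.2 hc
  have hcR : (c : ℝ) ≠ 0 := Int.cast_ne_zero.2 hc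
  have hc' : -c ≠ 0 := neg_ne_zero.2 hc
  have hfin := finite_quotMul (L := L) hc'
  have hft := Fintype.ofFinite (QuotMul L (-c))
  have hden : (c : ℂ) * τ + d ≠ 0 := denom_int_ne_zero γ τ
  have hTim : 0 < T.im := by
    rw [hT]
    have : ((d : ℂ) / (c : ℂ)).im = 0 := by
      rw [← Complex.ofReal_intCast, ← Complex.ofReal_intCast, ← Complex.ofReal_div,
        Complex.ofReal_im]
    rw [Complex.add_im, this, add_zero]
    exact τ.im_pos
  have hT0 : T ≠ 0 := fun h => by simp [h] at hTim
  have hcT : (c : ℂ) * τ + d = c * T := by rw [hT]; field_simp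
  set t : ℂ := -1 / T with ht
  have htim : 0 < t.im := by
    rw [ht, Complex.div_im]
    have := Complex.normSq_pos.2 hT0
    simp only [Complex.neg_im, Complex.one_im, neg_zero, zero_mul, zero_div, Complex.neg_re,
      Complex.one_re, zero_sub]
    rw [neg_mul, one_mul, neg_div, neg_neg]
    positivity
  -- The decomposition `γτ = a/c - 1/(c²T)`: the real part `a/c` yields a phase depending only on
  -- the class modulo `c`, and `c⁻²` undoes the scaling of the sublattice `cL`.
  have hγτ : ((γ • τ : ℍ) : ℂ) = (((a : ℝ) / (c : ℝ) : ℝ) : ℂ) + t / c ^ 2 := by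
    rw [UpperHalfPlane.coe_specialLinearGroup_apply]
    simp only [algebraMap_int_eq, Int.coe_castRingHom, Complex.ofReal_intCast, Complex.ofReal_div]
    rw [← ha, ← hb, ← hcdef, ← hd, hcT, ht]
    have hdet' : (a : ℂ) * d - b * c = 1 := by exact_mod_cast hdet
    have hτ : (τ : ℂ) = T - d / c := by rw [hT]; ring
    rw [hτ]
    field_simp
    linear_combination (-1 : ℂ) * hdet'
  -- The modulus is `-c` rather than `c` because the Weil coefficient to be matched is that of
  -- `γ⁻¹`, whose lower left entry is `-c`.
  rw [← (divModEquiv L hc').tsum_eq, Summable.tsum_prod]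
  swap
  · exact (divModEquiv L hc').summable_iff.2 (summable_gaussTerm_coset hQ hL z (γ • τ).im_pos y)
  rw [tsum_fintype]
  have hterm : ∀ r : QuotMul L (-c),
      ∑' k : L, gaussTerm z ((γ • τ : ℍ) : ℂ) (toReal ((y : V) + (divModEquiv L hc' (r, k) : L))) =
      (((√(Nat.card (Disc Q L)))⁻¹ : ℝ) : ℂ) * ((-(Complex.I * T)) ^ (1 / 2 : ℂ)) ^ p *
        (Complex.I * (starRingEnd ℂ) T) *
        ∑' x : dualLattice Q L, ee (gaussPhase Q (-c) d a x ((y : V) + (r.out : L))) *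
          gaussTerm z τ (toReal (x : V)) := by
    intro r
    set Y : V := (y : V) + (r.out : L) with hY
    have hYmem : Y ∈ dualLattice Q L := add_mem y.2 (le_dualLattice hL (r.out).2)
    set X : RealSpace V := ((-c : ℤ) : ℝ)⁻¹ • toReal Y with hX
    have hcR' : ((-c : ℤ) : ℝ) ≠ 0 := Int.cast_ne_zero.2 hc'
    have h1 : ∀ k : L, gaussTerm z ((γ • τ : ℍ) : ℂ)
        (toReal ((y : V) + (divModEquiv L hc' (r, k) : L)))
        = ee ((a : ℚ) / c * Q Y) * gaussTerm z t (toReal (k : V) + X) := by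
      intro k
      have hdm : (y : V) + (divModEquiv L hc' (r, k) : L) = Y + (-c) • (k : V) := by
        simp [divModEquiv, hY, add_assoc]
      have h2 : toReal (Y + (-c) • (k : V)) = ((-c : ℤ) : ℝ) • (toReal (k : V) + X) := by
        rw [toReal_add, toReal_zsmul, hX, smul_add, smul_inv_smul₀ hcR', add_comm]
      rw [hdm, hγτ, gaussTerm_add_real, realForm_toReal, h2, gaussTerm_smul]
      congr 1
      · obtain ⟨m, hm⟩ := exists_int_bil ⟨Y, hYmem⟩ k
        obtain ⟨q, hq⟩ := hL k k.2
        have h3 : Q (Y + (-c) • (k : V)) = Q Y - c * m + c ^ 2 * q := by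
          simp only at hm
          rw [map_add_zsmul, hm, hq]
          push_cast
          ring
        rw [h3, ← ee_eq_of_sub (y := (a : ℚ) / c * Q Y) (-a * m + a * c * q)
          (x := (a : ℚ) / c * (Q Y - c * m + c ^ 2 * q)), ee_eq_exp]
        · congr 2
          push_cast
          ring
        · push_cast
          field_simp
          ring
      · congr 1
        push_cast
        field_simp
    simp only [h1]
    rw [tsum_mul_left]
    simp only [add_comm (toReal _) X] at *
    rw [show (∑' k : L, gaussTerm z t (X + toReal (k : V)))
      = ∑' k : L, gaussTerm z t (toReal (k : V) + X) from tsum_congr fun k => by rw [add_comm],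
      tsum_gaussTerm_add hQ hL z htim (by rw [ht]; field_simp) X, mul_left_comm, ← tsum_mul_left]
    congr 1
    refine tsum_congr fun x => ?_
    have h5 : gaussTerm z T (toReal (x : V)) = ee ((d : ℚ) / c * Q (x : V)) *
        gaussTerm z τ (toReal (x : V)) := by
      have : T = (((d : ℝ) / (c : ℝ) : ℝ) : ℂ) + τ := by rw [hT]; push_cast; ring
      rw [this, gaussTerm_add_real, realForm_toReal, ee_eq_exp]
      congr 3
      push_cast
      ring
    have h6 : QuadraticMap.polar (realForm Q) (toReal (x : V)) X
        = ((-(bil Q (x : V) Y / c) : ℚ) : ℝ) := by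
      rw [hX, QuadraticMap.polar_smul_right, polar_toReal, smul_eq_mul]
      push_cast
      rw [inv_neg]; ring
    rw [h5, h6, ← ee_eq_exp]
    -- Three phases come together: from the shift `a/c`, from the shift `d/c` between `T` and `τ`,
    -- and from the character in Poisson summation.
    have h7 : gaussPhase Q (-c) d a x Y
        = (a : ℚ) / c * Q Y + ((d : ℚ) / c * Q (x : V) + -(bil Q (x : V) Y / c)) := by
      rw [gaussPhase, bil_self, bil_self, bil_comm Y]
      push_cast
      field_simp
      ring
    rw [h7, ee_add, ee_add]
    ring
  simp only [hterm]
  rw [← Finset.mul_sum]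
  congr 1
  rw [← Summable.tsum_finsetSum]
  · refine tsum_congr fun x => ?_
    -- So far the residues shift `y`; Shintani's sum shifts `x`, and reciprocity exchanges the two.
    rw [← Finset.sum_mul, gaussSum_eq_swap hL hc' (b := -b) (by linarith) x y,
      finsum_eq_sum_of_fintype]
  · intro r _
    refine Summable.of_norm_bounded (summable_gaussTerm (L := L) hQ z τ.im_pos) fun x => ?_
    rw [norm_mul, norm_ee, one_mul]

end ThetaTransformation

section ThetaSlash

open Module

variable {V : Type*} [AddCommGroup V] [Module ℚ V] {Q : QuadraticForm ℚ V} {L : Submodule ℤ V}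

lemma weilCoeff_of_ne_zero (s : ℤ) (g : Mp2Z) (hc : g.mat 1 0 ≠ 0) (μ ν : Disc Q L) :
    weilCoeff Q L s g μ ν = g.sign ^ s * (sqrtI ^ (s * (g.mat 1 0).sign) /
      ((Real.sqrt (|(g.mat 1 0 : ℝ)| ^ finrank ℚ V) *
        Real.sqrt (Nat.card (Disc Q L)) : ℝ) : ℂ) *
      gaussSum Q L (g.mat 1 0) (g.mat 0 0) (g.mat 1 1)
        (μ.out : dualLattice Q L) (ν.out : dualLattice Q L)) := by
  simp only [weilCoeff, if_neg hc]
  rfl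

open scoped Classical in
lemma weilCoeff_of_eq_zero (s : ℤ) (g : Mp2Z) (hc : g.mat 1 0 = 0) (μ ν : Disc Q L) :
    weilCoeff Q L s g μ ν = g.sign ^ s * (sqrtI ^ (s * (1 - (g.mat 1 1).sign)) *
      (if μ = g.mat 0 0 • ν then
        ee (-((g.mat 0 0 * g.mat 0 1 : ℤ) : ℚ) * Q (μ.out : dualLattice Q L)) else 0)) := by
  simp only [weilCoeff, if_pos hc]

variable [FiniteDimensional ℚ V] {p : ℕ}

/-- With `W = (-iT)^(1/2)`, the positive directions give `W^p`, while the negative ones together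
with the factor `Im(γτ)` give `v/(c² W²)`. The resulting `W^(p-2)` is the automorphy factor up to a
power of `|c|` and an eighth root of unity, both supplied by the Weil coefficient. -/
lemma siegelTheta_weilCoeff_of_ne_zero (hQ : HasSignature Q p 2) [L.IsLattice ℚ] (hL : IsEven Q L)
    (z : SymSpace Q) (g : Mp2Z) (hc : g.mat 1 0 ≠ 0) (τ : ℍ) (ν : Disc Q L) :
    g.root τ ^ ((p : ℤ) - 2) *
      siegelTheta L τ z (fun μ => weilCoeff Q L ((p : ℤ) - 2) g⁻¹ μ ν) =
    siegelTheta L (g.mat • τ) z (basisVec Q L ν) := by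
  obtain ⟨i00, i01, i10, i11⟩ := Mp2Z.inv_mat_entries g
  set c := g.mat 1 0 with hcdef
  set d := g.mat 1 1 with hd
  set y : dualLattice Q L := ν.out with hy
  set T : ℂ := τ + (d : ℂ) / (c : ℂ) with hT
  have hcC : (c : ℂ) ≠ 0 := Int.cast_ne_zero.2 hc
  have hcT : (c : ℂ) * τ + d = c * T := by rw [hT]; field_simp
  have hTim : 0 < T.im := by
    have : ((d : ℂ) / (c : ℂ)).im = 0 := by
      rw [← Complex.ofReal_intCast, ← Complex.ofReal_intCast, ← Complex.ofReal_div,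
        Complex.ofReal_im]
    rw [hT, Complex.add_im, this, add_zero]
    exact τ.im_pos
  have hT0 : T ≠ 0 := fun h => by simp [h] at hTim
  have hc10 : g⁻¹.mat 1 0 ≠ 0 := by rw [i10]; exact neg_ne_zero.2 hc
  conv_rhs => rw [← toDisc_out ν, siegelTheta_basisVec hL,
    tsum_gaussTerm_smul hQ hL z g.mat hc τ _ hT]
  have hcoeff : ∀ x : dualLattice Q L,
      weilCoeff Q L ((p : ℤ) - 2) g⁻¹ (toDisc Q L x) ν * gaussTerm z τ (toReal (x : V)) =
      (g⁻¹.sign ^ ((p : ℤ) - 2) * (sqrtI ^ (((p : ℤ) - 2) * (-c).sign) /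
      ((Real.sqrt (|(c : ℝ)| ^ (p + 2)) * Real.sqrt (Nat.card (Disc Q L)) : ℝ) : ℂ))) *
      (gaussSum Q L (-c) d (g.mat 0 0) x y * gaussTerm z τ (toReal (x : V))) := by
    intro x
    rw [weilCoeff_of_ne_zero _ _ hc10, i10, i00, i11, hQ.1, Int.cast_neg, abs_neg]
    obtain ⟨l, hl⟩ := toDisc_eq_iff.1 (toDisc_out (toDisc Q L x))
    rw [hl, gaussSum_add_left hL (neg_ne_zero.2 hc)]
    ring
  rw [siegelTheta_eq]
  simp only [hcoeff]
  rw [tsum_mul_left]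
  set S := ∑' x : dualLattice Q L, gaussSum Q L (-c) d (g.mat 0 0) x y *
    gaussTerm z τ (toReal (x : V)) with hS
  set W : ℂ := (-(Complex.I * T)) ^ (1 / 2 : ℂ) with hW
  have hWsq : W ^ 2 = -(Complex.I * T) := cpow_half_sq _
  have hW0 : W ≠ 0 := fun h => by
    rw [h] at hWsq
    have : Complex.I * T = 0 := by rw [← neg_eq_zero, ← hWsq]; norm_num
    exact mul_ne_zero Complex.I_ne_zero hT0 this
  have habs : 0 < |(c : ℝ)| := abs_pos.2 (Int.cast_ne_zero.2 hc)
  have hsI : sqrtI ≠ 0 := Complex.exp_ne_zero _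
  -- The metaplectic sign and the eighth root of unity are absorbed here: for either sign of `c` the
  -- same root `√|c| · W` results. Inversion commutes with the principal root because `cτ + d` is
  -- not real.
  have hχ : g⁻¹.sign * g.root τ * sqrtI ^ (-c).sign = (√|(c : ℝ)| : ℝ) * W := by
    have harg : ((c : ℂ) * τ + d).arg ≠ Real.pi := by
      intro h
      have := (Complex.arg_eq_pi_iff.1 h).2
      rw [hcT] at this
      simp [hTim.ne', hc] at this
    rw [Mp2Z.sign_inv_mul_root, Complex.inv_cpow _ _ harg, inv_inv, hcT]
    rcases lt_or_gt_of_ne hc with h | h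
    · have h1 : (c : ℂ) * T = ((|(c : ℝ)| : ℝ) : ℂ) * (-T) := by
        rw [abs_of_neg (by exact_mod_cast h)]; push_cast; ring
      rw [h1, cpow_half_ofReal_mul habs, cpow_half_neg_of_im_pos hTim,
        Int.sign_eq_one_of_pos (by omega), hW]
      field_simp
    · have h1 : (c : ℂ) * T = ((|(c : ℝ)| : ℝ) : ℂ) * T := by
        rw [abs_of_pos (by exact_mod_cast h)]; push_cast; ring
      rw [h1, cpow_half_ofReal_mul habs, cpow_half_of_im_pos hTim,
        Int.sign_eq_neg_one_of_neg (by omega), zpow_neg_one, hW]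
      field_simp
  have him : (((g.mat • τ : ℍ).im : ℝ) : ℂ) * (Complex.I * (starRingEnd ℂ) T) * W ^ 2
      = τ.im / c ^ 2 := by
    rw [hWsq, ModularGroup.im_smul_eq_div_normSq, ModularGroup.denom_apply, ← hcdef, ← hd, hcT]
    have h1 : (starRingEnd ℂ) T * T = (Complex.normSq T : ℂ) := by
      rw [mul_comm, Complex.mul_conj]
    have h2 : (Complex.normSq T : ℂ) ≠ 0 := by
      rw [Complex.ofReal_ne_zero]; exact (Complex.normSq_pos.2 hT0).ne'
    have h3 : Complex.I * (starRingEnd ℂ) T * -(Complex.I * T) = (Complex.normSq T : ℂ) := by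
      rw [← h1]
      linear_combination (-(starRingEnd ℂ) T * T) * Complex.I_sq
    rw [mul_assoc, h3, Complex.normSq_mul]
    have h4 : Complex.normSq (c : ℂ) = (c : ℝ) ^ 2 := by
      rw [Complex.normSq_intCast, sq]
    rw [h4]
    push_cast
    field_simp
  have hroot : (√|(c : ℝ)|) ^ 2 = |(c : ℝ)| := Real.sq_sqrt habs.le
  have hsqrtpow : Real.sqrt (|(c : ℝ)| ^ (p + 2)) = (√|(c : ℝ)|) ^ (p + 2) := by
    conv_lhs => rw [← hroot, ← pow_mul, mul_comm, pow_mul]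
    exact Real.sqrt_sq (by positivity)
  have hpow : g.root τ ^ ((p : ℤ) - 2) * g⁻¹.sign ^ ((p : ℤ) - 2) *
      sqrtI ^ (((p : ℤ) - 2) * (-c).sign) = ((√|(c : ℝ)| : ℝ) * W : ℂ) ^ ((p : ℤ) - 2) := by
    rw [← hχ, mul_zpow, mul_zpow, mul_comm ((p : ℤ) - 2) (-c).sign, zpow_mul]
    ring
  rw [hsqrtpow]
  set R : ℂ := ((√|(c : ℝ)| : ℝ) : ℂ) with hR
  have hR0 : R ≠ 0 := Complex.ofReal_ne_zero.2 (Real.sqrt_pos.2 habs).ne'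
  -- The normalization `R^(p-2) / R^(p+2) = R⁻⁴` thus equals the `c⁻²` coming from the imaginary
  -- part.
  have hR4 : R ^ 4 = c ^ 2 := by
    have : (√|(c : ℝ)|) ^ 4 = (c : ℝ) ^ 2 := by
      rw [show 4 = 2 * 2 from rfl, pow_mul, hroot, sq_abs]
    rw [hR]
    exact_mod_cast congrArg (fun x : ℝ => (x : ℂ)) this
  set N : ℂ := ((√(Nat.card (Disc Q L)) : ℝ) : ℂ) with hN
  have hfin := finite_disc hQ hL z
  have hN0 : N ≠ 0 := by
    rw [hN, Complex.ofReal_ne_zero]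
    have : 0 < Nat.card (Disc Q L) := Nat.card_pos
    positivity
  push_cast
  rw [← hR, ← hN]
  calc _ = (g.root τ ^ ((p : ℤ) - 2) * g⁻¹.sign ^ ((p : ℤ) - 2) *
      sqrtI ^ (((p : ℤ) - 2) * (-c).sign)) * (τ.im : ℂ) / (R ^ (p + 2) * N) * S := by ring
    _ = W ^ p * N⁻¹ * ((τ.im : ℂ) / c ^ 2) / W ^ 2 * S := by
        rw [hpow, ← hR4, mul_zpow, zpow_sub₀ hR0, zpow_sub₀ hW0]
        simp only [zpow_natCast]
        field_simp
        ring
    _ = _ := by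
        rw [← him]
        field_simp

/-- Here `a = d = ±1` and `γτ = τ + ab`. The translation produces the phase `e(ab Q(x))`, and the
substitution `x ↦ ax`, which preserves `Q` and the Gaussian, matches the permutation of cosets. -/
lemma siegelTheta_weilCoeff_of_eq_zero (hL : IsEven Q L)
    (z : SymSpace Q) (g : Mp2Z) (hc : g.mat 1 0 = 0) (τ : ℍ) (ν : Disc Q L) :
    g.root τ ^ ((p : ℤ) - 2) *
      siegelTheta L τ z (fun μ => weilCoeff Q L ((p : ℤ) - 2) g⁻¹ μ ν) =
    siegelTheta L (g.mat • τ) z (basisVec Q L ν) := by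
  classical
  obtain ⟨i00, i01, i10, i11⟩ := Mp2Z.inv_mat_entries g
  have hc10 : g⁻¹.mat 1 0 = 0 := by rw [i10, hc, neg_zero]
  set a := g.mat 0 0 with ha
  set b := g.mat 0 1 with hb
  set d := g.mat 1 1 with hd
  have hdet : a * d = 1 := by
    have := g.mat.det_coe
    rw [Matrix.det_fin_two, hc, mul_zero, sub_zero] at this
    exact this
  have hda : d = a ∧ (a = 1 ∨ a = -1) := by
    rcases Int.mul_eq_one_iff_eq_one_or_neg_one.1 hdet with ⟨h1, h2⟩ | ⟨h1, h2⟩ <;> simp [h1, h2]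
  obtain ⟨hda, ha1⟩ := hda
  -- For `a = -1` the metaplectic part gives the inverse of `((-1)⁻¹)^(1/2) = i`, cancelling `√i² =
  -- i`.
  have hχ : g.root τ ^ ((p : ℤ) - 2) * g⁻¹.sign ^ ((p : ℤ) - 2) *
      sqrtI ^ (((p : ℤ) - 2) * (1 - a.sign)) = 1 := by
    rw [← mul_zpow, mul_comm (g.root τ), Mp2Z.sign_inv_mul_root, hc, ← hd, hda]
    rcases ha1 with h | h
    · simp [h]
    · rw [h, mul_comm ((p : ℤ) - 2), zpow_mul, ← mul_zpow]
      have h1 : (-1 : ℂ) ^ (1 / 2 : ℂ) = Complex.I := by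
        rw [Complex.cpow_def_of_ne_zero (by norm_num), Complex.log_neg_one,
          show (Real.pi * Complex.I * (1 / 2) : ℂ) = Real.pi / 2 * Complex.I by ring,
          Complex.exp_pi_div_two_mul_I]
      have h2 : sqrtI ^ (1 - (-1 : ℤ).sign) = Complex.I := by
        rw [show (1 - (-1 : ℤ).sign) = ((2 : ℕ) : ℤ) from rfl, zpow_natCast, sqrtI_sq]
      rw [h2]
      simp only [Int.cast_zero, zero_mul, zero_add, Int.cast_neg, Int.cast_one]
      rw [show (-1 : ℂ)⁻¹ = -1 by norm_num, h1, inv_mul_cancel₀ Complex.I_ne_zero, one_zpow]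
  have hQa : ∀ x : V, Q (a • x) = Q x := by
    intro x
    rcases ha1 with h | h <;> simp [h]
  have haa : a * a = 1 := by rw [← hdet, hda]
  have hγτ : ((g.mat • τ : ℍ) : ℂ) = (((a * b : ℤ) : ℝ) : ℂ) + τ := by
    rw [UpperHalfPlane.coe_specialLinearGroup_apply]
    simp only [algebraMap_int_eq, Int.coe_castRingHom, Complex.ofReal_intCast]
    rw [← ha, ← hb, hc, ← hd, hda]
    rcases ha1 with h | h <;> rw [h] <;> push_cast <;> ring
  have him : (g.mat • τ : ℍ).im = τ.im := by
    have := congrArg Complex.im hγτ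
    rw [Complex.add_im, Complex.ofReal_im, zero_add] at this
    exact this
  set y : dualLattice Q L := ν.out with hy
  have hν : toDisc Q L y = ν := toDisc_out ν
  rw [siegelTheta_eq, siegelTheta_eq, him, mul_left_comm]
  congr 1
  rw [← tsum_mul_left]
  let e : dualLattice Q L ≃ dualLattice Q L :=
    { toFun := fun x => a • x
      invFun := fun x => a • x
      left_inv := fun x => by simp [smul_smul, haa]
      right_inv := fun x => by simp [smul_smul, haa] }
  rw [← e.tsum_eq]
  refine tsum_congr fun x => ?_
  have hex : ((e x : dualLattice Q L) : V) = a • (x : V) := rfl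
  have htd : toDisc Q L (e x) = a • toDisc Q L x := rfl
  rw [weilCoeff_of_eq_zero _ _ hc10, i00, i01, i11, basisVec_apply, htd, hda]
  have h1 : (a • toDisc Q L x = a • ν) ↔ toDisc Q L x = ν := by
    constructor
    · intro h
      have := congrArg (fun t => a • t) h
      simpa [smul_smul, haa] using this
    · intro h; rw [h]
  have hg : gaussTerm z τ (toReal (e x : V)) = gaussTerm z τ (toReal (x : V)) := by
    rw [hex, toReal_zsmul]
    rcases ha1 with h | h
    · simp [h]
    · rw [h]
      simp [gaussTerm_neg]
  simp only [h1, hg]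
  split_ifs with hx
  · rw [hγτ, gaussTerm_add_real, realForm_toReal]
    -- The coefficient is evaluated at a chosen representative of the class of `ax`. Its norm
    -- differs from `Q(x)` by an integer, invisible to a phase with integral coefficient `ab`.
    obtain ⟨l, hl⟩ := toDisc_eq_iff.1 (toDisc_out (a • toDisc Q L x))
    obtain ⟨m, hm⟩ := exists_int_bil (e x) l
    obtain ⟨q, hq⟩ := hL l l.2
    have h3 : Q ((Quotient.out (a • toDisc Q L x) : dualLattice Q L) : V) = Q (x : V) + m + q := by
      have := map_add_zsmul (Q := Q) ((e x : dualLattice Q L) : V) l 1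
      rw [one_smul] at this
      have hl' : ((Quotient.out (a • toDisc Q L x) : dualLattice Q L) : V) = (e x : V) + l := hl
      rw [hl', this, hm, hq, hex, hQa]
      push_cast; ring
    have h4 : ee (-((a * -b : ℤ) : ℚ) * Q ((Quotient.out (a • toDisc Q L x) : dualLattice Q L) : V))
        = Complex.exp (2 * Real.pi * Complex.I * ((((a * b : ℤ) : ℝ) * (Q (x : V) : ℝ) : ℝ) : ℂ)) := by
      rw [h3, ee_eq_of_sub (y := ((a * b : ℤ) : ℚ) * Q (x : V)) (a * b * (m + q)), ee_eq_exp]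
      · push_cast; rfl
      · push_cast; ring
    rw [h4, one_mul]
    calc _ = (g.root τ ^ ((p : ℤ) - 2) * g⁻¹.sign ^ ((p : ℤ) - 2) *
      sqrtI ^ (((p : ℤ) - 2) * (1 - a.sign))) * (Complex.exp (2 * Real.pi * Complex.I * ((((a * b : ℤ) : ℝ) * (Q (x : V) : ℝ) : ℝ) : ℂ)) * gaussTerm z τ (toReal (x : V))) := by ring
      _ = _ := by rw [hχ, one_mul]
  · simp

/-- The transformation law of the Siegel theta function under `Mp₂(ℤ)`. -/
theorem siegelTheta_slash (hQ : HasSignature Q p 2) [L.IsLattice ℚ] (hL : IsEven Q L)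
    (z : SymSpace Q) (g : Mp2Z) (f : ℍ → SchwartzL Q L) (τ : ℍ) :
    siegelTheta L τ z (slash Q L ((p : ℤ) - 2) (2 - (p : ℤ)) g f τ) =
      siegelTheta L (g.mat • τ) z (f (g.mat • τ)) := by
  classical
  have hfin := finite_disc hQ hL z
  have := Fintype.ofFinite (Disc Q L)
  set φ := f (g.mat • τ) with hφ
  have h1 : φ = ∑ ν, φ ν • basisVec Q L ν := by
    ext μ
    simp [Finset.sum_apply, basisVec_apply]
  have h2 : slash Q L ((p : ℤ) - 2) (2 - (p : ℤ)) g f τ =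
      ∑ ν, (g.root τ ^ ((p : ℤ) - 2) * φ ν) •
        (fun μ => weilCoeff Q L ((p : ℤ) - 2) g⁻¹ μ ν) := by
    ext μ
    simp only [slash, weilRep, Pi.smul_apply, smul_eq_mul, Finset.sum_apply, ← hφ,
      finsum_eq_sum_of_fintype, neg_sub, Finset.mul_sum]
    exact Finset.sum_congr rfl fun ν _ => by ring
  rw [h2, siegelTheta_sum hQ hL]
  conv_rhs => rw [h1, siegelTheta_sum hQ hL]
  refine Finset.sum_congr rfl fun ν _ => ?_
  rw [mul_comm (_ ^ _) (φ ν), mul_assoc]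
  congr 1
  by_cases hc : g.mat 1 0 = 0
  · exact siegelTheta_weilCoeff_of_eq_zero hL z g hc τ ν
  · exact siegelTheta_weilCoeff_of_ne_zero hQ hL z g hc τ ν

end ThetaSlash

/-! ### From cosets in `Mp₂(ℤ)` to sums over `SL₂(ℤ)` -/

section CosetSums

namespace Mp2Z

/-- The two elements of `Mp₂(ℤ)` above `γ ∈ SL₂(ℤ)`. -/
def lift (γ : SL(2, ℤ)) (b : Bool) : Mp2Z where
  mat := γ
  root := fun τ => cond b 1 (-1) * ((((γ 1 0 : ℤ) : ℂ) * τ + ((γ 1 1 : ℤ) : ℂ)) ^ (1 / 2 : ℂ))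
  root_holo := mdifferentiable_const.mul (mdifferentiable_cpow_half_denom γ)
  root_sq := fun τ => by
    rw [mul_pow, cpow_half_sq]
    cases b <;> simp

lemma lift_injective : Function.Injective fun x : SL(2, ℤ) × Bool => lift x.1 x.2 := by
  rintro ⟨γ, b⟩ ⟨δ, b'⟩ h
  have h1 : γ = δ := congrArg Mp2Z.mat h
  subst h1
  have h2 : (lift γ b).root UpperHalfPlane.I = (lift γ b').root UpperHalfPlane.I :=
    congrFun (congrArg Mp2Z.root h) _
  have h3 : (lift γ true).root UpperHalfPlane.I ≠ 0 := root_ne_zero _ _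
  simp only [lift] at h2 h3
  rw [cond_true, one_mul] at h3
  have h4 := mul_right_cancel₀ h3 h2
  cases b <;> cases b' <;> simp at h4 ⊢ <;> norm_num [Complex.ext_iff] at h4

lemma lift_surjective : Function.Surjective fun x : SL(2, ℤ) × Bool => lift x.1 x.2 := by
  intro g
  rcases mul_self_eq_one_iff.1 ((pow_two _).symm.trans g.sign_sq) with h | h
  · refine ⟨(g.mat, true), ?_⟩
    ext τ
    · rfl
    · simp [lift, root_eq_sign_mul g, h]
  · refine ⟨(g.mat, false), ?_⟩
    ext τ
    · rfl
    · simp [lift, root_eq_sign_mul g, h]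

lemma T_zpow_mat (n : ℤ) : (T ^ n).mat = ModularGroup.T ^ n := by
  let f : Mp2Z →* SL(2, ℤ) := { toFun := Mp2Z.mat, map_one' := rfl, map_mul' := fun _ _ => rfl }
  exact map_zpow f T n

lemma T_zpow_injective : Function.Injective fun n : ℤ => ModularGroup.T ^ n := by
  intro n m h
  have := congrArg (fun γ : SL(2, ℤ) => γ 0 1) h
  simpa [ModularGroup.coe_T_zpow] using this

/-- Every element is uniquely `Tⁿ` times the representative of its coset; uniqueness of `n` holds
because `T` has infinite order in `SL₂(ℤ)`. A sum over cosets can thus be spread out over the whole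
group. -/
lemma zpow_mul_out_bijective : Function.Bijective
    fun x : Quotient (QuotientGroup.rightRel GammaInf) × ℤ => T ^ x.2 * x.1.out := by
  have hmk : ∀ (c : Quotient (QuotientGroup.rightRel GammaInf)) (n : ℤ),
      (Quotient.mk _ (T ^ n * c.out) : Quotient (QuotientGroup.rightRel GammaInf)) = c := by
    intro c n
    conv_rhs => rw [← Quotient.out_eq c]
    refine Quotient.sound (QuotientGroup.rightRel_apply.2 ?_)
    rw [mul_inv_rev, mul_inv_cancel_left, ← zpow_neg]
    exact Subgroup.zpow_mem_zpowers T _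
  constructor
  · rintro ⟨c, n⟩ ⟨c', n'⟩ h
    have h0 : T ^ n * c.out = T ^ n' * c'.out := h
    have h1 : c = c' := by rw [← hmk c n, h0, hmk]
    subst h1
    have h2 := congrArg Mp2Z.mat (mul_right_cancel h0)
    rw [T_zpow_mat, T_zpow_mat] at h2
    rw [T_zpow_injective h2]
  · intro g
    set c : Quotient (QuotientGroup.rightRel GammaInf) := Quotient.mk _ g with hc
    have h1 : g * c.out⁻¹ ∈ GammaInf :=
      QuotientGroup.rightRel_apply.1 (Quotient.exact (Quotient.out_eq c))
    obtain ⟨n, hn⟩ := Subgroup.mem_zpowers_iff.1 h1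
    exact ⟨(c, n), by simp [hn]⟩

end Mp2Z

lemma im_smul_eq_of_eq_zero {γ : SL(2, ℤ)} (hc : γ 1 0 = 0) (τ : ℍ) : (γ • τ).im = τ.im := by
  have hdet : γ 0 0 * γ 1 1 = 1 := by
    have := γ.det_coe
    rwa [Matrix.det_fin_two, hc, mul_zero, sub_zero] at this
  rw [ModularGroup.im_smul_eq_div_normSq, ModularGroup.denom_apply, hc]
  rcases Int.mul_eq_one_iff_eq_one_or_neg_one.1 hdet with ⟨-, h2⟩ | ⟨-, h2⟩ <;> simp [h2]

lemma im_smul_le_of_ne_zero {γ : SL(2, ℤ)} (hc : γ 1 0 ≠ 0) (τ : ℍ) : (γ • τ).im ≤ 1 / τ.im := by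
  have hτ := τ.im_pos
  have h1 : (τ.im) ^ 2 ≤ Complex.normSq (denom (γ : GL (Fin 2) ℝ) τ) := by
    rw [ModularGroup.denom_apply, Complex.normSq_apply]
    have h2 : (1 : ℝ) ≤ (γ 1 0 : ℝ) ^ 2 := by
      have h3 : (1 : ℤ) ≤ (γ 1 0) ^ 2 := by
        have := Int.one_le_abs hc
        nlinarith [sq_abs (γ 1 0)]
      exact_mod_cast h3
    simp
    nlinarith [mul_self_nonneg ((γ 1 0 : ℝ) * τ.re + γ 1 1)]
  rw [ModularGroup.im_smul_eq_div_normSq, div_le_div_iff₀ (by nlinarith) hτ]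
  nlinarith

lemma im_smul_le (γ : SL(2, ℤ)) (τ : ℍ) : (γ • τ).im ≤ max τ.im (1 / τ.im) := by
  by_cases hc : γ 1 0 = 0
  · exact (im_smul_eq_of_eq_zero hc τ).le.trans (le_max_left _ _)
  · exact (im_smul_le_of_ne_zero hc τ).trans (le_max_right _ _)

/-- On the fundamental domain `|cτ + d|² ≥ c² - |cd| + d²`, a nonzero value of a positive definite
integral form, hence at least 1. -/
lemma im_smul_le_of_mem_fd {τ : ℍ} (hτ : τ ∈ ModularGroup.fd) (γ : SL(2, ℤ)) :
    (γ • τ).im ≤ τ.im := by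
  have hdet : γ 0 0 * γ 1 1 - γ 0 1 * γ 1 0 = 1 := by
    have := γ.det_coe
    rwa [Matrix.det_fin_two] at this
  have h1 : (1 : ℤ) ≤ (γ 1 0) ^ 2 + (γ 1 1) ^ 2 - |γ 1 0 * γ 1 1| := by
    by_contra h
    have h0 : (γ 1 0) ^ 2 + (γ 1 1) ^ 2 ≤ |γ 1 0 * γ 1 1| := by omega
    rw [abs_mul] at h0
    have hc : γ 1 0 = 0 := by
      rw [← sq_abs (γ 1 0), ← sq_abs (γ 1 1)] at h0
      refine abs_eq_zero.1 ?_
      nlinarith [abs_nonneg (γ 1 0), abs_nonneg (γ 1 1), sq_nonneg (|γ 1 0| - 2 * |γ 1 1|),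
        sq_nonneg (2 * |γ 1 0| - |γ 1 1|)]
    have hd : γ 1 1 = 0 := by
      rw [hc] at h0
      simpa using h0
    rw [hc, hd] at hdet
    simp at hdet
  have h2 : (1 : ℝ) ≤ (γ 1 0 : ℝ) ^ 2 + (γ 1 1 : ℝ) ^ 2 - |(γ 1 0 : ℝ) * (γ 1 1 : ℝ)| := by
    exact_mod_cast h1
  obtain ⟨hτ1, hτ2⟩ := hτ
  have h3 : 1 ≤ Complex.normSq (denom (γ : GL (Fin 2) ℝ) τ) := by
    rw [ModularGroup.denom_apply]
    rw [Complex.normSq_apply] at hτ1 ⊢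
    simp only [Complex.add_re, Complex.mul_re, Complex.intCast_re, Complex.intCast_im, zero_mul,
      sub_zero, Complex.add_im, Complex.mul_im, add_zero, UpperHalfPlane.coe_re,
      UpperHalfPlane.coe_im] at hτ1 ⊢
    have h4 : -|(γ 1 0 : ℝ) * (γ 1 1 : ℝ)| ≤ 2 * ((γ 1 0 : ℝ) * (γ 1 1 : ℝ)) * τ.re := by
      have h5 : |2 * ((γ 1 0 : ℝ) * (γ 1 1 : ℝ)) * τ.re| ≤ |(γ 1 0 : ℝ) * (γ 1 1 : ℝ)| := by
        rw [abs_mul, abs_mul, abs_two]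
        nlinarith [abs_nonneg ((γ 1 0 : ℝ) * (γ 1 1 : ℝ))]
      exact (neg_le_neg h5).trans (neg_abs_le _)
    nlinarith [sq_nonneg (γ 1 0 : ℝ)]
  rw [ModularGroup.im_smul_eq_div_normSq]
  exact div_le_self τ.im_pos.le h3

/-- The vertical strip `-1/2 < Re τ ≤ 1/2`. -/
def strip : Set ℍ := {τ | τ.re ∈ Set.Ioc (-1 / 2 : ℝ) (1 / 2)}

lemma isCompact_rectangle {w : ℝ} (hw : 0 < w) (B : ℝ) :
    IsCompact {τ : ℍ | |τ.re| ≤ 1 / 2 ∧ w ≤ τ.im ∧ τ.im ≤ B} := by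
  rw [UpperHalfPlane.isEmbedding_coe.isCompact_iff]
  have : UpperHalfPlane.coe '' {τ : ℍ | |τ.re| ≤ 1 / 2 ∧ w ≤ τ.im ∧ τ.im ≤ B} =
      Set.Icc (-1 / 2 : ℝ) (1 / 2) ×ℂ Set.Icc w B := by
    ext x
    simp only [Set.mem_image, Complex.mem_reProdIm, Set.mem_Icc]
    constructor
    · rintro ⟨τ, ⟨h1, h2, h3⟩, rfl⟩
      have := abs_le.1 h1
      exact ⟨⟨by linarith [this.1, show (τ : ℂ).re = τ.re from rfl], this.2⟩, h2, h3⟩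
    · rintro ⟨⟨h1, h2⟩, h3, h4⟩
      refine ⟨⟨x, hw.trans_le h3⟩, ⟨abs_le.2 ⟨?_, h2⟩, h3, h4⟩, rfl⟩
      have : -1 / 2 ≤ x.re := h1
      change -(1 / 2) ≤ x.re
      linarith
  rw [this]
  exact isCompact_Icc.reProdIm isCompact_Icc

/-- All points of the orbit have height at most `max(v, 1/v)`, so those considered lie in a compact
rectangle and proper discontinuity applies. -/
lemma finite_smul_mem_rectangle {w : ℝ} (hw : 0 < w) (τ : ℍ) :
    {γ : SL(2, ℤ) | |(γ • τ).re| ≤ 1 / 2 ∧ w ≤ (γ • τ).im}.Finite := by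
  have h := ProperlyDiscontinuousSMul.finite_disjoint_inter_image (Γ := 𝒮ℒ)
    (isCompact_singleton (x := τ)) (isCompact_rectangle hw (max τ.im (1 / τ.im)))
  let f : SL(2, ℤ) → 𝒮ℒ := fun γ => ⟨(γ : GL (Fin 2) ℝ), ⟨γ, rfl⟩⟩
  have hf : Function.Injective f := by
    intro a b hab
    have h1 : (a : GL (Fin 2) ℝ) = b := congrArg Subtype.val hab
    ext i j
    have := congrArg (fun M : GL (Fin 2) ℝ => M i j) h1
    simpa using this
  refine (h.preimage hf.injOn).subset ?_
  rintro γ ⟨h1, h2⟩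
  refine ⟨γ • τ, ⟨τ, rfl, rfl⟩, h1, h2, im_smul_le γ τ⟩

variable {G : ℍ → ℂ} {w : ℝ}

lemma apply_T_zpow_smul (hT : ∀ τ, G (ModularGroup.T • τ) = G τ) (n : ℤ) (τ : ℍ) :
    G (ModularGroup.T ^ n • τ) = G τ := by
  induction n generalizing τ with
  | zero => simp
  | succ n ih => rw [zpow_add_one, mul_smul, ih, hT]
  | pred n ih =>
    rw [zpow_sub_one, mul_smul, ih]
    have := hT (ModularGroup.T⁻¹ • τ)
    rw [smul_inv_smul] at this
    exact this.symm

/-- Exactly one translate of `τ` by an integer lies in the half-open strip, so the sum has a single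
nonzero candidate. -/
lemma hasSum_strip_indicator (hT : ∀ τ, G (ModularGroup.T • τ) = G τ) (τ : ℍ) :
    HasSum (fun n : ℤ => strip.indicator G (ModularGroup.T ^ n • τ)) (G τ) := by
  obtain ⟨n, hn, huniq⟩ := existsUnique_add_zsmul_mem_Ioc one_pos τ.re (-1 / 2)
  have hmem : ∀ k : ℤ, ModularGroup.T ^ k • τ ∈ strip ↔
      τ.re + k • (1 : ℝ) ∈ Set.Ioc (-1 / 2 : ℝ) (-1 / 2 + 1) := by
    intro k
    rw [strip, Set.mem_ofPred_eq, ModularGroup.re_T_zpow_smul]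
    norm_num
  have h1 : G τ = strip.indicator G (ModularGroup.T ^ n • τ) := by
    rw [Set.indicator_of_mem ((hmem n).2 hn), apply_T_zpow_smul hT]
  rw [h1]
  refine hasSum_single n fun k hk => ?_
  refine Set.indicator_of_notMem (fun h => hk (huniq k ((hmem k).1 h))) _

lemma finite_support_strip_indicator (hw : 0 < w) (hGw : ∀ τ, τ.im < w → G τ = 0) (τ : ℍ) :
    (Function.support fun γ : SL(2, ℤ) => strip.indicator G (γ • τ)).Finite := by
  refine (finite_smul_mem_rectangle hw τ).subset fun γ hγ => ?_
  rw [Function.mem_support, Set.indicator_apply_ne_zero] at hγ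
  obtain ⟨h1, h2⟩ := hγ
  refine ⟨abs_le.2 ⟨?_, h1.2⟩, ?_⟩
  · have := h1.1
    linarith
  · by_contra h
    exact h2 (hGw _ (not_le.1 h))

/-- The sum `½ ∑_{γ ∈ SL₂(ℤ)} (1_{strip} G)(γτ)`. -/
def unfoldedSum (G : ℍ → ℂ) (τ : ℍ) : ℂ :=
  (1 / 2 : ℂ) * ∑' γ : SL(2, ℤ), strip.indicator G (γ • τ)

lemma tsum_strip_indicator_eq (hw : 0 < w) (hT : ∀ τ, G (ModularGroup.T • τ) = G τ)
    (hGw : ∀ τ, τ.im < w → G τ = 0) (τ : ℍ) :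
    HasSum (fun c : Quotient (QuotientGroup.rightRel Mp2Z.GammaInf) => G (c.out.mat • τ))
      (2 * ∑' γ : SL(2, ℤ), strip.indicator G (γ • τ)) := by
  have hfin := finite_support_strip_indicator hw hGw τ
  set F : Mp2Z → ℂ := fun g => strip.indicator G (g.mat • τ) with hF
  have hs : Summable fun γ : SL(2, ℤ) => strip.indicator G (γ • τ) :=
    summable_of_hasFiniteSupport hfin
  let e := Equiv.ofBijective _ ⟨Mp2Z.lift_injective, Mp2Z.lift_surjective⟩
  have h1 : HasSum (F ∘ e) (2 * ∑' γ : SL(2, ℤ), strip.indicator G (γ • τ)) := by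
    have h2 : Summable fun x : SL(2, ℤ) × Bool => strip.indicator G (x.1 • τ) := by
      refine summable_of_hasFiniteSupport ?_
      refine (hfin.prod (Set.finite_univ (α := Bool))).subset ?_
      rintro ⟨γ, b⟩ h
      exact ⟨h, trivial⟩
    have h3 := h2.hasSum
    rw [h2.tsum_prod] at h3
    simp only [tsum_fintype, Fintype.sum_bool] at h3
    rw [← tsum_mul_left]
    convert! h3 using 3
    rw [two_mul]
  have h2 := e.hasSum_iff.1 h1
  let e' := Equiv.ofBijective _ Mp2Z.zpow_mul_out_bijective
  have h3 := e'.hasSum_iff.2 h2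
  refine h3.prod_fiberwise fun c => ?_
  have := hasSum_strip_indicator hT (c.out.mat • τ)
  convert! this using 2 with n
  simp only [Function.comp, hF, e', Equiv.ofBijective_apply, Mp2Z.mul_mat, Mp2Z.T_zpow_mat,
    mul_smul]

lemma finite_support_coset (hw : 0 < w) (τ : ℍ) :
    {c : Quotient (QuotientGroup.rightRel Mp2Z.GammaInf) | w ≤ (c.out.mat • τ).im}.Finite := by
  have h1 := (finite_smul_mem_rectangle hw τ).prod (Set.finite_univ (α := Bool))
  let e := Equiv.ofBijective _ ⟨Mp2Z.lift_injective, Mp2Z.lift_surjective⟩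
  let e' := Equiv.ofBijective _ Mp2Z.zpow_mul_out_bijective
  refine ((h1.image e).image fun g => (e'.symm g).1).subset fun c hc => ?_
  obtain ⟨n, hn, -⟩ := existsUnique_add_zsmul_mem_Ioc one_pos (c.out.mat • τ).re (-1 / 2)
  refine ⟨e' (c, n), ⟨e.symm (e' (c, n)), ⟨?_, trivial⟩, by simp⟩, by simp⟩
  have h2 : (e.symm (e' (c, n))).1 = (e' (c, n)).mat := by
    conv_rhs => rw [← e.apply_symm_apply (e' (c, n))]
    rfl
  have h3 : (e' (c, n)).mat = ModularGroup.T ^ n * c.out.mat := by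
    simp [e', Mp2Z.T_zpow_mat]
  rw [Set.mem_ofPred_eq, h2, h3, mul_smul, ModularGroup.re_T_zpow_smul,
    ModularGroup.im_T_zpow_smul]
  have h4 := hn.1
  have h5 := hn.2
  rw [zsmul_one] at h4 h5
  exact ⟨abs_le.2 ⟨by linarith, by linarith⟩, hc⟩

lemma unfoldedSum_eq_finsum (hw : 0 < w) (hT : ∀ τ, G (ModularGroup.T • τ) = G τ)
    (hGw : ∀ τ, τ.im < w → G τ = 0) (τ : ℍ) :
    (1 / 4 : ℂ) * ∑ᶠ c : Quotient (QuotientGroup.rightRel Mp2Z.GammaInf), G (c.out.mat • τ) =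
      unfoldedSum G τ := by
  rw [← tsum_eq_finsum (L := SummationFilter.unconditional _),
    (tsum_strip_indicator_eq hw hT hGw τ).tsum_eq, unfoldedSum]
  · ring
  · refine (finite_support_coset hw τ).subset fun c hc => ?_
    by_contra h
    exact hc (hGw _ (not_le.1 h))

/-- If `c ≠ 0` then `γτ` has height at most `1/v < w` and contributes nothing. What survives is
`±Tⁿ`, and the two signs cancel the factor 1/2. -/
lemma unfoldedSum_eq_self (hw : 0 < w) (hT : ∀ τ, G (ModularGroup.T • τ) = G τ)
    (hGw : ∀ τ, τ.im < w → G τ = 0) {τ : ℍ} (hτ : 1 / τ.im < w) :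
    unfoldedSum G τ = G τ := by
  let f : ℤ × Bool → SL(2, ℤ) :=
    fun x => cond x.2 (ModularGroup.T ^ x.1) (-ModularGroup.T ^ x.1)
  have hf : Function.Injective f := by
    rintro ⟨n, b⟩ ⟨n', b'⟩ h
    have h1 := congrArg (fun γ : SL(2, ℤ) => γ 0 0) h
    have h2 := congrArg (fun γ : SL(2, ℤ) => γ 0 1) h
    clear h
    cases b <;> cases b' <;> simp [f, ModularGroup.coe_T_zpow] at h1 h2 ⊢ <;> omega
  have hd : ∀ γ ∉ Set.range f, strip.indicator G (γ • τ) = 0 := by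
    intro γ hγ
    by_contra h
    refine hγ ?_
    rw [← ne_eq, Set.indicator_apply_ne_zero] at h
    have hc : γ 1 0 = 0 := by
      by_contra hc
      exact h.2 (hGw _ ((im_smul_le_of_ne_zero hc τ).trans_lt hτ))
    have hdet := γ.det_coe
    rw [Matrix.det_fin_two, hc, mul_zero, sub_zero] at hdet
    rcases Int.eq_one_or_neg_one_of_mul_eq_one' hdet with ⟨ha, hd⟩ | ⟨ha, hd⟩
    · refine ⟨(γ 0 1, true), ?_⟩
      ext i j
      fin_cases i <;> fin_cases j <;> simp [f, ModularGroup.coe_T_zpow, ha, hc, hd]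
    · refine ⟨(-γ 0 1, false), ?_⟩
      ext i j
      fin_cases i <;> fin_cases j <;> simp [f, ModularGroup.coe_T_zpow, ha, hc, hd]
  have hfin := finite_support_strip_indicator hw hGw τ
  have h1 : Summable fun x => strip.indicator G (f x • τ) := by
    refine summable_of_hasFiniteSupport ?_
    exact hfin.preimage hf.injOn
  have h2 := hf.tsum_eq (f := fun γ => strip.indicator G (γ • τ)) fun γ hγ => by
    by_contra h
    exact hγ (hd γ h)
  have h3 := h1.tsum_prod' fun n => .of_finite
  simp only [tsum_fintype, Fintype.sum_bool, f, cond_true, cond_false,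
    ModularGroup.SL_neg_smul] at h3 h2
  rw [unfoldedSum, ← h2, h3]
  simp only [← two_mul]
  rw [tsum_mul_left, (hasSum_strip_indicator hT τ).tsum_eq]
  ring

end CosetSums

/-! ### Unfolding of integrals over the fundamental domain -/

section Unfolding

open scoped ENNReal

instance countable_SL : Countable SL(2, ℤ) :=
  Function.Injective.countable (f := fun γ : SL(2, ℤ) => fun i j => γ i j) fun a b h => by
    ext i j
    exact congrFun (congrFun h i) j

lemma measurePreserving_SL_smul (γ : SL(2, ℤ)) :
    MeasurePreserving (fun τ : ℍ => γ • τ) volume volume :=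
  measurePreserving_smul (γ : GL (Fin 2) ℝ) (volume : Measure ℍ)

lemma measurableEmbedding_SL_smul (γ : SL(2, ℤ)) :
    MeasurableEmbedding (fun τ : ℍ => γ • τ) :=
  measurableEmbedding_const_smul (γ : GL (Fin 2) ℝ)

lemma volume_eq_zero_of_coe {s : Set ℍ} {t : Set ℂ} (h : ∀ τ ∈ s, (τ : ℂ) ∈ t)
    (ht : volume t = 0) : volume s = 0 := by
  rw [UpperHalfPlane.volume_eq_lintegral]
  refine setLIntegral_measure_zero _ _ (measure_mono_null ?_ ht)
  rintro _ ⟨τ, hτ, rfl⟩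
  exact h τ hτ

lemma volume_complex_re_eq (c : ℝ) : volume {x : ℂ | x.re = c} = 0 := by
  have h : {x : ℂ | x.re = c} = Complex.measurableEquivRealProd ⁻¹' ({c} ×ˢ Set.univ) := by
    ext x
    simp
  rw [h, Complex.volume_preserving_equiv_real_prod.measure_preimage_equiv,
    Measure.volume_eq_prod, Measure.prod_prod]
  simp

lemma volume_re_eq (c : ℝ) : volume {τ : ℍ | τ.re = c} = 0 :=
  volume_eq_zero_of_coe (t := {x : ℂ | x.re = c}) (fun _ h => h) (volume_complex_re_eq c)

lemma volume_fd_diff_fdo : volume (ModularGroup.fd \ ModularGroup.fdo) = 0 := by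
  refine volume_eq_zero_of_coe (t := Metric.sphere (0 : ℂ) 1 ∪
    ({x : ℂ | x.re = 1 / 2} ∪ {x : ℂ | x.re = -(1 / 2)})) ?_ ?_
  · rintro τ ⟨⟨h1, h2⟩, h3⟩
    by_contra h
    simp only [Set.mem_union, mem_sphere_zero_iff_norm, Set.mem_ofPred_eq, not_or] at h
    obtain ⟨h4, h5, h6⟩ := h
    refine h3 ⟨lt_of_le_of_ne h1 fun h => h4 ?_, lt_of_le_of_ne h2 fun h => ?_⟩
    · rw [Complex.normSq_eq_norm_sq] at h
      exact (pow_eq_one_iff_of_nonneg (norm_nonneg _) two_ne_zero).1 h.symm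
    · rcases eq_or_eq_neg_of_abs_eq h with h | h
      · exact h5 h
      · exact h6 h
  · rw [measure_union_null_iff, measure_union_null_iff]
    exact ⟨Measure.addHaar_sphere _ _ _, volume_complex_re_eq _, volume_complex_re_eq _⟩

/-- Almost every orbit of `SL₂(ℤ)` meets the fundamental domain exactly once. -/
lemma ae_smul_mem_fd_iff : ∀ᵐ τ : ℍ, ∃ g : SL(2, ℤ), ∀ γ : SL(2, ℤ),
    γ • τ ∈ ModularGroup.fd ↔ γ = g ∨ γ = -g := by
  have h0 : ∀ᵐ τ : ℍ, ∀ γ : SL(2, ℤ), γ • τ ∉ ModularGroup.fd \ ModularGroup.fdo := by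
    rw [ae_all_iff]
    intro γ
    have h := (measurePreserving_SL_smul γ).quasiMeasurePreserving.preimage_null
      volume_fd_diff_fdo
    exact measure_eq_zero_iff_ae_notMem.1 h
  filter_upwards [h0] with τ hτ
  obtain ⟨g, hg⟩ := ModularGroup.exists_smul_mem_fd τ
  refine ⟨g, fun γ => ⟨fun h => ?_, ?_⟩⟩
  · have h1 : g • τ ∈ ModularGroup.fdo := by
      by_contra h2
      exact hτ g ⟨hg, h2⟩
    have h2 : (γ * g⁻¹) • (g • τ) ∈ ModularGroup.fd := by
      rwa [mul_smul, inv_smul_smul]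
    rcases ModularGroup.eq_one_or_neg_one_of_mem_fdo_mem_fd h1 h2 with h3 | h3
    · left
      exact mul_inv_eq_one.1 h3
    · right
      rw [mul_inv_eq_iff_eq_mul] at h3
      rw [h3, neg_one_mul]
  · rintro (rfl | rfl)
    · exact hg
    · rwa [ModularGroup.SL_neg_smul]

lemma SL_neg_ne (g : SL(2, ℤ)) : g ≠ -g := by
  intro h
  have h1 : ∀ i j, g i j = 0 := fun i j => by
    have := congrArg (fun γ : SL(2, ℤ) => γ i j) h
    simp at this
    omega
  have hdet := g.det_coe
  rw [Matrix.det_fin_two, h1 0 0, h1 0 1] at hdet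
  simp at hdet

lemma measurableSet_fd : MeasurableSet ModularGroup.fd := ModularGroup.isClosed_fd.measurableSet

lemma ae_tsum_indicator_fd {M : Type*} [AddCommMonoid M] [TopologicalSpace M] [T2Space M] :
    ∀ᵐ τ : ℍ, ∀ x : ℍ → M,
      ∑' γ : SL(2, ℤ), (ModularGroup.fd).indicator (fun _ => x τ) (γ⁻¹ • τ) = 2 • x τ := by
  classical
  filter_upwards [ae_smul_mem_fd_iff] with τ hτ x
  obtain ⟨g, hg⟩ := hτ
  have hne : g⁻¹ ≠ (-g)⁻¹ := fun h => SL_neg_ne g (inv_injective h)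
  have hmem : ∀ γ : SL(2, ℤ), γ⁻¹ • τ ∈ ModularGroup.fd ↔ γ ∈ ({g⁻¹, (-g)⁻¹} : Finset SL(2, ℤ)) := by
    intro γ
    rw [hg, Finset.mem_insert, Finset.mem_singleton, inv_eq_iff_eq_inv, inv_eq_iff_eq_inv]
  rw [tsum_eq_sum (s := {g⁻¹, (-g)⁻¹})]
  · rw [Finset.sum_pair hne, Set.indicator_of_mem, Set.indicator_of_mem, two_nsmul]
    · exact (hmem _).2 (by simp)
    · exact (hmem _).2 (by simp)
  · intro γ hγ
    exact Set.indicator_of_notMem (fun h => hγ ((hmem γ).1 h)) _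

lemma indicator_fd_smul {M : Type*} [Zero M] (f : ℍ → M) (γ : SL(2, ℤ)) (τ : ℍ) :
    (ModularGroup.fd).indicator (fun σ => f (γ • σ)) (γ⁻¹ • τ) =
      (ModularGroup.fd).indicator (fun _ => f τ) (γ⁻¹ • τ) := by
  simp only [Set.indicator, smul_inv_smul]

lemma lintegral_fd_smul (f : ℍ → ℝ≥0∞) (γ : SL(2, ℤ)) :
    ∫⁻ τ in ModularGroup.fd, f (γ • τ) =
      ∫⁻ τ, (ModularGroup.fd).indicator (fun _ => f τ) (γ⁻¹ • τ) := by
  rw [← lintegral_indicator measurableSet_fd,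
    ← (measurePreserving_SL_smul γ⁻¹).lintegral_comp_emb (measurableEmbedding_SL_smul γ⁻¹)]
  simp only [indicator_fd_smul]

/-- Invariance of the measure moves `γ` from the integrand to the domain. The images of the
fundamental domain then cover almost every point exactly twice, because `γ` and `-γ` act alike. -/
lemma tsum_lintegral_fd {f : ℍ → ℝ≥0∞} (hf : Measurable f) :
    ∑' γ : SL(2, ℤ), ∫⁻ τ in ModularGroup.fd, f (γ • τ) = 2 * ∫⁻ τ, f τ := by
  simp only [lintegral_fd_smul]
  rw [← lintegral_tsum]
  · rw [← lintegral_const_mul _ hf]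
    refine lintegral_congr_ae ?_
    filter_upwards [ae_tsum_indicator_fd (M := ℝ≥0∞)] with τ hτ
    rw [hτ f, two_nsmul, two_mul]
  · intro γ
    simp only [← indicator_fd_smul]
    exact (((hf.comp (measurePreserving_SL_smul γ).measurable).indicator
      measurableSet_fd).comp (measurePreserving_SL_smul γ⁻¹).measurable).aemeasurable

/-- The nonnegative version, applied to `‖f‖`, supplies the absolute convergence that justifies both
exchanges of sum and integral. -/
lemma integral_fd_tsum {f : ℍ → ℂ} (hfm : Measurable f) (hf : Integrable f) :
    IntegrableOn (fun τ => ∑' γ : SL(2, ℤ), f (γ • τ)) ModularGroup.fd ∧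
      ∫ τ in ModularGroup.fd, ∑' γ : SL(2, ℤ), f (γ • τ) = 2 * ∫ τ, f τ := by
  have hm : ∀ γ : SL(2, ℤ), Measurable fun τ : ℍ => f (γ • τ) := fun γ =>
    hfm.comp (measurePreserving_SL_smul γ).measurable
  have hfin : ∑' γ : SL(2, ℤ), ∫⁻ τ in ModularGroup.fd, ‖f (γ • τ)‖ₑ ≠ ∞ := by
    rw [tsum_lintegral_fd (f := fun τ => ‖f τ‖ₑ) hfm.enorm]
    exact ENNReal.mul_ne_top (by simp) hf.2.ne
  have hfin' : ∫⁻ τ in ModularGroup.fd, ∑' γ : SL(2, ℤ), ‖f (γ • τ)‖ₑ ≠ ∞ := by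
    rwa [lintegral_tsum fun γ => (hm γ).enorm.aemeasurable]
  have h1 : ∀ γ : SL(2, ℤ), ∫ τ in ModularGroup.fd, f (γ • τ) =
      ∫ τ, (ModularGroup.fd).indicator (fun _ => f τ) (γ⁻¹ • τ) := by
    intro γ
    rw [← integral_indicator measurableSet_fd,
      ← (measurePreserving_SL_smul γ⁻¹).integral_comp (measurableEmbedding_SL_smul γ⁻¹)]
    simp only [indicator_fd_smul]
  constructor
  · refine ⟨?_, ?_⟩
    · refine aestronglyMeasurable_of_tendsto_ae (u := (atTop : Filter (Finset SL(2, ℤ))))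
        (f := fun s τ => ∑ γ ∈ s, f (γ • τ))
        (fun s => (Finset.measurable_fun_sum _ fun γ _ => hm γ).aestronglyMeasurable) ?_
      have h2 := ae_lt_top (Measurable.tsum fun γ => (hm γ).enorm) hfin'
      filter_upwards [h2] with τ hτ
      have h3 : Summable fun γ : SL(2, ℤ) => f (γ • τ) :=
        .of_nnnorm (ENNReal.tsum_coe_ne_top_iff_summable.1 hτ.ne)
      exact h3.hasSum
    · exact (lintegral_mono fun τ => enorm_tsum_le_tsum_enorm).trans_lt hfin'.lt_top
  · rw [integral_tsum (fun γ => (hm γ).aestronglyMeasurable) hfin]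
    simp only [h1]
    rw [← integral_tsum]
    · rw [← integral_const_mul]
      refine integral_congr_ae ?_
      filter_upwards [ae_tsum_indicator_fd (M := ℂ)] with τ hτ
      rw [hτ f, two_nsmul, two_mul]
    · intro γ
      simp only [← indicator_fd_smul]
      exact (((hm γ).indicator
        measurableSet_fd).comp (measurePreserving_SL_smul γ⁻¹).measurable).aestronglyMeasurable
    · convert! hfin using 3 with γ
      rw [lintegral_fd_smul (fun τ => ‖f τ‖ₑ)]
      refine lintegral_congr fun τ => ?_
      simp only [Set.indicator]
      split_ifs <;> simp

lemma truncFD_eq (A : ℝ) : truncFD A = ModularGroup.fd ∩ {τ | τ.im ≤ A} := by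
  ext τ
  simp only [truncFD, ModularGroup.fd, Set.mem_inter_iff, Set.mem_ofPred_eq, and_assoc]
  rw [Complex.normSq_eq_norm_sq, one_le_sq_iff₀ (norm_nonneg _)]

variable {G : ℍ → ℂ} {w : ℝ}

lemma measurableSet_strip : MeasurableSet strip :=
  (UpperHalfPlane.continuous_re.measurable) measurableSet_Ioc

lemma measurableSet_im_le (A : ℝ) : MeasurableSet {τ : ℍ | τ.im ≤ A} :=
  UpperHalfPlane.continuous_im.measurable measurableSet_Iic

/-- Unfolding of the integral over the truncated fundamental domain. -/
lemma integral_unfoldedSum (hGw : ∀ τ, τ.im < w → G τ = 0)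
    (hGm : Measurable G) {A : ℝ} (hA : 0 < A) (hAw : 1 / A ≤ w)
    (hint : IntegrableOn G (strip ∩ {τ | τ.im ≤ A})) :
    IntegrableOn (unfoldedSum G) (truncFD A) ∧
      ∫ τ in truncFD A, unfoldedSum G τ = ∫ τ in strip ∩ {τ | τ.im ≤ A}, G τ := by
  set f : ℍ → ℂ := (strip ∩ {τ | τ.im ≤ A}).indicator G with hf
  have hms := measurableSet_strip.inter (measurableSet_im_le A)
  have hfm : Measurable f := hGm.indicator hms
  have hfi : Integrable f := (integrable_indicator_iff hms).2 hint
  -- Truncating the strip at `A` has the effect of truncating the domain. A point of height at most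
  -- `A` has its whole orbit below `A`. For a higher point, `c = 0` is excluded by the truncation
  -- and `c ≠ 0` leads below `1/A ≤ w`, where `G` vanishes.
  have hsum : ∀ τ ∈ ModularGroup.fd, ∑' γ : SL(2, ℤ), f (γ • τ) =
      {τ : ℍ | τ.im ≤ A}.indicator (fun τ => 2 * unfoldedSum G τ) τ := by
    intro τ hτ
    by_cases h : τ.im ≤ A
    · rw [Set.indicator_of_mem (by exact h), unfoldedSum, ← mul_assoc]
      norm_num
      refine tsum_congr fun γ => ?_
      rw [hf, Set.inter_comm, ← Set.indicator_indicator, Set.indicator_of_mem]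
      exact (im_smul_le_of_mem_fd hτ γ).trans h
    · rw [Set.indicator_of_notMem (by exact h)]
      convert! tsum_zero with γ
      rw [hf, Set.indicator_apply_eq_zero]
      rintro ⟨h1, h2⟩
      by_cases hc : γ 1 0 = 0
      · exact absurd ((im_smul_eq_of_eq_zero hc τ).symm.trans_le h2) h
      · refine hGw _ ((im_smul_le_of_ne_zero hc τ).trans_lt (lt_of_lt_of_le ?_ hAw))
        exact one_div_lt_one_div_of_lt hA (not_le.1 h)
  obtain ⟨h1, h2⟩ := integral_fd_tsum hfm hfi
  rw [integrableOn_congr_fun hsum measurableSet_fd] at h1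
  rw [setIntegral_congr_fun measurableSet_fd hsum] at h2
  rw [integrableOn_indicator_iff (measurableSet_im_le A)] at h1
  rw [setIntegral_indicator (measurableSet_im_le A), integral_const_mul] at h2
  rw [truncFD_eq]
  constructor
  · have := h1.const_mul (1 / 2 : ℂ)
    rw [Set.inter_comm]
    refine this.congr ?_
    filter_upwards with τ
    ring
  · rw [← integral_indicator hms]
    exact mul_left_cancel₀ two_ne_zero h2

lemma integral_comp_coe_upperHalfPlane (f : ℂ → ℂ) {R : Set ℂ} (hR : MeasurableSet R)
    (hpos : ∀ x ∈ R, 0 < x.im) :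
    ∫ τ in UpperHalfPlane.coe ⁻¹' R, f τ = ∫ x in R, f x * ((x.im : ℂ) ^ 2)⁻¹ := by
  have hd : Measurable fun τ : ℍ => (1 / NNReal.mk τ.im τ.im_pos.le : NNReal) ^ 2 := by
    refine Measurable.pow_const (Measurable.const_div ?_ _) _
    exact UpperHalfPlane.continuous_im.measurable.subtype_mk
  rw [UpperHalfPlane.volume_def, restrict_withDensity (UpperHalfPlane.measurable_coe hR),
    integral_withDensity_eq_integral_smul hd]
  have h1 : ∀ τ : ℍ, ((1 / NNReal.mk τ.im τ.im_pos.le : NNReal) ^ 2) • f τ =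
      f (τ : ℂ) * (((τ : ℂ).im : ℂ) ^ 2)⁻¹ := by
    intro τ
    rw [NNReal.smul_def, Complex.real_smul, mul_comm]
    simp
  simp only [h1]
  rw [← UpperHalfPlane.measurableEmbedding_coe.setIntegral_map
    (fun x : ℂ => f x * ((x.im : ℂ) ^ 2)⁻¹),
    UpperHalfPlane.measurableEmbedding_coe.map_comap, Measure.restrict_restrict hR,
    Set.inter_eq_left.2]
  intro x hx
  exact ⟨⟨x, hpos x hx⟩, rfl⟩

/-- Integration over a horizontal band of the vertical strip. -/
lemma integral_strip_band {f : ℂ → ℂ} (hf : Measurable f) {a B C : ℝ} (ha : 0 < a)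
    (hC : ∀ x : ℂ, |x.re| ≤ 1 / 2 → x.im ∈ Set.Icc a B → ‖f x‖ ≤ C) {J : Set ℝ}
    (hJm : MeasurableSet J) (hJ : J ⊆ Set.Icc a B) :
    IntegrableOn (fun τ : ℍ => f τ) (strip ∩ {τ | τ.im ∈ J}) ∧
    IntegrableOn (fun v : ℝ => ∫ u in Set.Ioc (-1 / 2 : ℝ) (1 / 2),
      f (u + v * Complex.I) * ((v : ℂ) ^ 2)⁻¹) J ∧
    ∫ τ in strip ∩ {τ | τ.im ∈ J}, f τ =
      ∫ v in J, ∫ u in Set.Ioc (-1 / 2 : ℝ) (1 / 2), f (u + v * Complex.I) * ((v : ℂ) ^ 2)⁻¹ := by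
  set I := Set.Ioc (-1 / 2 : ℝ) (1 / 2) with hI
  have hIabs : ∀ u ∈ I, |u| ≤ 1 / 2 := fun u hu => abs_le.2 ⟨by linarith [hu.1], hu.2⟩
  have hset : strip ∩ {τ | τ.im ∈ J} = UpperHalfPlane.coe ⁻¹' (I ×ℂ J) := rfl
  have hRm : MeasurableSet (I ×ℂ J) := 
    (Complex.measurable_re measurableSet_Ioc).inter (Complex.measurable_im hJm)
  have hprod : IntegrableOn (fun p : ℝ × ℝ => f (p.1 + p.2 * Complex.I) * ((p.2 : ℂ) ^ 2)⁻¹)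
      (I ×ˢ J) := by
    refine Measure.integrableOn_of_bounded (M := C * (a ^ 2)⁻¹) ?_ ?_ ?_
    · rw [Measure.volume_eq_prod, Measure.prod_prod]
      refine ENNReal.mul_ne_top (by simp [hI]) ?_
      exact ((measure_mono hJ).trans_lt (by simp)).ne
    · refine Measurable.aestronglyMeasurable ?_
      exact (hf.comp (by fun_prop)).mul (by fun_prop)
    · filter_upwards [ae_restrict_mem (measurableSet_Ioc.prod hJm)] with p hp
      have h2 := hJ hp.2
      have h3 := hC (p.1 + p.2 * Complex.I) (by simpa using hIabs _ hp.1) (by simpa using h2)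
      rw [norm_mul, norm_inv, norm_pow, Complex.norm_real, Real.norm_eq_abs, sq_abs]
      have h4 : a ^ 2 ≤ p.2 ^ 2 := by
        have := h2.1
        gcongr
      gcongr
      exact (norm_nonneg _).trans h3
  have hprod' : Integrable (fun p : ℝ × ℝ => f (p.1 + p.2 * Complex.I) * ((p.2 : ℂ) ^ 2)⁻¹)
      ((volume.restrict I).prod (volume.restrict J)) := by
    rwa [Measure.prod_restrict, ← Measure.volume_eq_prod]
  refine ⟨?_, hprod'.integral_prod_right, ?_⟩
  · refine Measure.integrableOn_of_bounded (M := C) ?_ ?_ ?_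
    · refine ne_of_lt (lt_of_le_of_lt (measure_mono ?_) (isCompact_rectangle ha B).measure_lt_top)
      rintro τ ⟨h1, h2⟩
      exact ⟨hIabs _ h1, hJ h2⟩
    · exact (hf.comp UpperHalfPlane.measurable_coe).aestronglyMeasurable
    · rw [hset]
      filter_upwards [ae_restrict_mem (UpperHalfPlane.measurable_coe hRm)] with τ hτ
      exact hC _ (hIabs _ hτ.1) (hJ hτ.2)
  · rw [hset, integral_comp_coe_upperHalfPlane f hRm fun x hx => ha.trans_le (hJ hx.2).1,
      ← integral_prod_symm _ hprod', Measure.prod_restrict, ← Measure.volume_eq_prod,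
      ← Complex.volume_preserving_equiv_real_prod.symm.setIntegral_preimage_emb
        Complex.measurableEquivRealProd.symm.measurableEmbedding]
    have h1 : Complex.measurableEquivRealProd.symm ⁻¹' (I ×ℂ J) = I ×ˢ J := by
      ext p
      simp [Complex.mem_reProdIm]
    rw [h1]
    refine setIntegral_congr_fun (measurableSet_Ioc.prod hJm) fun p _ => ?_
    simp [Complex.mk_eq_add_mul_I]

end Unfolding

/-! ### Uniqueness and linearity of the regularized integral -/

section ConstantTerm

/-- Induction on the order of the pole: multiplication by `s^(N+1)` and passage to the limit `s → 0`
kills the leading polar coefficient. This makes the constant term well defined although the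
definition only asserts existence of some expansion. -/
lemma HasConstantTerm.eq_zero_of_eventually {Φ : ℂ → ℂ} {c : ℂ} (h : HasConstantTerm Φ c)
    (h0 : ∀ᶠ s in 𝓝[≠] (0 : ℂ), Φ s = 0) : c = 0 := by
  obtain ⟨N, a, k, hk, rfl, hΦ⟩ := h
  have h1 : ∀ᶠ s in 𝓝[≠] (0 : ℂ), ∑ j ∈ Finset.Icc 1 N, a j / s ^ j + k s = 0 := by
    filter_upwards [h0, hΦ] with s h2 h3
    rw [← h3, h2]
  clear h0 hΦ
  have hkt : Tendsto k (𝓝[≠] 0) (𝓝 (k 0)) := hk.continuousAt.tendsto.mono_left inf_le_left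
  have hid : Tendsto (fun s : ℂ => s) (𝓝[≠] 0) (𝓝 0) := inf_le_left
  induction N with
  | zero =>
    refine tendsto_nhds_unique (hkt.congr' ?_) tendsto_const_nhds
    filter_upwards [h1] with s hs
    simpa using hs
  | succ N ih =>
    refine ih ?_
    have h2 : Tendsto (fun s : ℂ => ∑ j ∈ Finset.Icc 1 N, a j * s ^ (N + 1 - j) + a (N + 1) +
        k s * s ^ (N + 1)) (𝓝[≠] 0) (𝓝 (∑ j ∈ Finset.Icc 1 N, a j * 0 ^ (N + 1 - j) + a (N + 1) +
        k 0 * 0 ^ (N + 1))) :=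
      ((tendsto_finsetSum _ fun j _ => (hid.pow _).const_mul _).add_const _).add
        (hkt.mul (hid.pow _))
    have h3 : ∑ j ∈ Finset.Icc 1 N, a j * (0 : ℂ) ^ (N + 1 - j) = 0 := by
      refine Finset.sum_eq_zero fun j hj => ?_
      rw [zero_pow, mul_zero]
      have := (Finset.mem_Icc.1 hj).2
      omega
    rw [h3, zero_pow (Nat.succ_ne_zero N), mul_zero, add_zero, zero_add] at h2
    have h4 : a (N + 1) = 0 := by
      refine tendsto_nhds_unique (h2.congr' ?_) tendsto_const_nhds
      filter_upwards [h1, self_mem_nhdsWithin] with s hs hs0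
      have hs0' : s ≠ 0 := hs0
      rw [Finset.sum_Icc_succ_top (by omega)] at hs
      have h5 := congrArg (· * s ^ (N + 1)) hs
      simp only [zero_mul, add_mul, div_mul_cancel₀ _ (pow_ne_zero (N + 1) hs0')] at h5
      rw [← h5, Finset.sum_mul]
      congr 2
      refine Finset.sum_congr rfl fun j hj => ?_
      have hj' := (Finset.mem_Icc.1 hj).2
      rw [div_mul_eq_mul_div, eq_div_iff (pow_ne_zero _ hs0'), mul_assoc, ← pow_add,
        Nat.sub_add_cancel (by omega)]
    filter_upwards [h1] with s hs
    rwa [Finset.sum_Icc_succ_top (by omega), h4, zero_div, add_zero] at hs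

lemma HasConstantTerm.add {Φ Ψ : ℂ → ℂ} {c d : ℂ} (h : HasConstantTerm Φ c)
    (h' : HasConstantTerm Ψ d) : HasConstantTerm (fun s => Φ s + Ψ s) (c + d) := by
  obtain ⟨N, a, k, hk, rfl, hΦ⟩ := h
  obtain ⟨M, b, l, hl, rfl, hΨ⟩ := h'
  refine ⟨max N M, fun j => (if j ≤ N then a j else 0) + (if j ≤ M then b j else 0),
    fun s => k s + l s, hk.add hl, rfl, ?_⟩
  filter_upwards [hΦ, hΨ] with s h1 h2
  have key : ∀ (n : ℕ) (u : ℕ → ℂ), n ≤ max N M → ∑ j ∈ Finset.Icc 1 n, u j / s ^ j =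
      ∑ j ∈ Finset.Icc 1 (max N M), (if j ≤ n then u j else 0) / s ^ j := by
    intro n u hn
    refine Finset.sum_subset_zero_on_sdiff (Finset.Icc_subset_Icc_right hn) ?_ ?_
    · intro j hj
      simp only [Finset.mem_sdiff, Finset.mem_Icc] at hj
      rw [if_neg (by omega), zero_div]
    · intro j hj
      rw [if_pos (Finset.mem_Icc.1 hj).2]
  rw [h1, h2, key N a (le_max_left _ _), key M b (le_max_right _ _)]
  simp only [add_div, Finset.sum_add_distrib]
  ring

lemma HasConstantTerm.const_mul {Φ : ℂ → ℂ} {c : ℂ} (h : HasConstantTerm Φ c) (r : ℂ) :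
    HasConstantTerm (fun s => r * Φ s) (r * c) := by
  obtain ⟨N, a, k, hk, rfl, hΦ⟩ := h
  refine ⟨N, fun j => r * a j, fun s => r * k s, analyticAt_const.mul hk, rfl, ?_⟩
  filter_upwards [hΦ] with s h1
  rw [h1, mul_add, Finset.mul_sum]
  simp only [mul_div_assoc]

lemma hasRegularizedIntegral_zero : HasRegularizedIntegral (fun _ => 0) 0 := by
  refine ⟨0, 1, fun _ => 0, one_pos, fun s _ => MeromorphicAt.const 0 s, differentiableOn_const _,
    fun s _ => ⟨fun T => by simp, by simp⟩, 0, 0, fun _ => 0, analyticAt_const, rfl, by simp⟩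

lemma HasRegularizedIntegral.add {F F' : ℍ → ℂ} {c c' : ℂ} (h : HasRegularizedIntegral F c)
    (h' : HasRegularizedIntegral F' c') :
    HasRegularizedIntegral (fun τ => F τ + F' τ) (c + c') := by
  obtain ⟨σ, ε, Φ, hε, hm, hd, hi, hc⟩ := h
  obtain ⟨σ', ε', Φ', hε', hm', hd', hi', hc'⟩ := h'
  refine ⟨max σ σ', min ε ε', fun s => Φ s + Φ' s, lt_min hε hε', ?_, ?_, ?_, hc.add hc'⟩
  · intro s hs
    have hs' : -min ε ε' < s.re := hs
    have h1 := min_le_left ε ε'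
    have h2 := min_le_right ε ε'
    exact (hm s (show -ε < s.re by linarith)).add (hm' s (show -ε' < s.re by linarith))
  · exact (hd.mono fun s (hs : max σ σ' < s.re) => (le_max_left _ _).trans_lt hs).add
      (hd'.mono fun s (hs : max σ σ' < s.re) => (le_max_right _ _).trans_lt hs)
  · intro s hs
    obtain ⟨h1, h2⟩ := hi s (lt_of_le_of_lt (le_max_left _ _) hs)
    obtain ⟨h3, h4⟩ := hi' s (lt_of_le_of_lt (le_max_right _ _) hs)
    simp only [add_mul]
    refine ⟨fun T => (h1 T).add (h3 T), (h2.add h4).congr fun T => ?_⟩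
    rw [integral_add (h1 T) (h3 T)]

lemma HasRegularizedIntegral.const_mul {F : ℍ → ℂ} {c : ℂ} (h : HasRegularizedIntegral F c)
    (r : ℂ) : HasRegularizedIntegral (fun τ => r * F τ) (r * c) := by
  obtain ⟨σ, ε, Φ, hε, hm, hd, hi, hc⟩ := h
  refine ⟨σ, ε, fun s => r * Φ s, hε, fun s hs => (MeromorphicAt.const r s).mul (hm s hs),
    hd.const_mul r, fun s hs => ?_, hc.const_mul r⟩
  obtain ⟨h1, h2⟩ := hi s hs
  simp only [mul_assoc]
  refine ⟨fun T => (h1 T).const_mul r, (h2.const_mul r).congr fun T => ?_⟩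
  rw [integral_const_mul]

lemma hasRegularizedIntegral_sum {ι : Type*} (s : Finset ι) (F : ι → ℍ → ℂ) (c r : ι → ℂ)
    (h : ∀ i ∈ s, HasRegularizedIntegral (F i) (c i)) :
    HasRegularizedIntegral (fun τ => ∑ i ∈ s, r i * F i τ) (∑ i ∈ s, r i * c i) := by
  classical
  induction s using Finset.induction_on with
  | empty => simpa using hasRegularizedIntegral_zero
  | insert i s hi ih =>
    simp only [Finset.sum_insert hi]
    exact ((h i (Finset.mem_insert_self i s)).const_mul (r i)).add
      (ih fun j hj => h j (Finset.mem_insert_of_mem hj))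

/-- The regularized integral is unique. -/
lemma HasRegularizedIntegral.unique {F : ℍ → ℂ} {c c' : ℂ} (h : HasRegularizedIntegral F c)
    (h' : HasRegularizedIntegral F c') : c = c' := by
  have h0 := h.add (h'.const_mul (-1))
  simp only [neg_one_mul, add_neg_cancel] at h0
  obtain ⟨σ, ε, Φ, hε, hm, hd, hi, hc⟩ := h0
  have hΦ : ∀ s : ℂ, σ < s.re → Φ s = 0 := by
    intro s hs
    have := (hi s hs).2
    simp only [zero_mul, integral_zero] at this
    exact tendsto_nhds_unique this tendsto_const_nhds
  set U : Set ℂ := {s | -ε < s.re} with hU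
  have hUc : IsConnected U := by
    refine (convex_halfSpace_re_gt (-ε)).isConnected ⟨0, ?_⟩
    simpa [hU] using hε
  have h0U : (0 : ℂ) ∈ U := by simpa [hU] using hε
  -- Identity theorem: `Φ` vanishes far to the right, so it has infinite order there, and finiteness
  -- of the order at one point would propagate through the connected half-plane.
  have hord : meromorphicOrderAt Φ 0 = ⊤ := by
    by_contra hne
    have h1 := (hm.exists_meromorphicOrderAt_ne_top_iff_forall hUc).1 ⟨⟨0, h0U⟩, hne⟩
    have hx : ((max σ 0 + 1 : ℝ) : ℂ) ∈ U := by
      simp only [hU, Set.mem_ofPred_eq, Complex.ofReal_re]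
      linarith [le_max_right σ 0]
    refine h1 ⟨_, hx⟩ (meromorphicOrderAt_eq_top_iff.2 ?_)
    refine eventually_nhdsWithin_of_eventually_nhds ?_
    have h2 : IsOpen {s : ℂ | σ < s.re} := isOpen_lt continuous_const Complex.continuous_re
    refine (h2.mem_nhds ?_ : {s : ℂ | σ < s.re} ∈ _) |> fun h3 => mem_of_superset h3 hΦ
    simp only [Set.mem_ofPred_eq, Complex.ofReal_re]
    linarith [le_max_left σ 0]
  have := hc.eq_zero_of_eventually (meromorphicOrderAt_eq_top_iff.1 hord)
  linear_combination this

lemma regPairing_eq {S : Type*} {f : ℍ → S} {g : ℍ → S → ℂ} {c : ℂ}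
    (h : HasRegularizedIntegral (fun τ => g τ (f τ)) c) : regPairing f g = c := by
  have h1 : RegPairingExists f g := ⟨c, h⟩
  rw [regPairing, dif_pos h1]
  exact h1.choose_spec.unique h

end ConstantTerm

/-! ### Holomorphic dependence on `s` -/

section ParametricIntegrals

/-- Holomorphy in `s` of integrals of `g v^(-s)`. -/
lemma differentiable_integral_cpow_neg {X : Type*} [MeasurableSpace X] {μ : Measure X} {g : X → ℂ}
    {v : X → ℝ} (hg : AEStronglyMeasurable g μ) (hv : Measurable v) (hpos : ∀ᵐ x ∂μ, 0 < v x)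
    (hint : ∀ σ : ℝ, Integrable (fun x => ‖g x‖ * v x ^ σ) μ) :
    Differentiable ℂ fun s : ℂ => ∫ x, g x * (v x : ℂ) ^ (-s) ∂μ := by
  intro s
  have hmeas : ∀ s : ℂ, AEStronglyMeasurable (fun x => g x * (v x : ℂ) ^ (-s)) μ := fun s =>
    hg.mul (((Complex.measurable_ofReal.comp hv).pow_const _).aestronglyMeasurable)
  have hnorm : ∀ᵐ x ∂μ, ∀ s : ℂ, ‖(v x : ℂ) ^ (-s)‖ = v x ^ (-s.re) := by
    filter_upwards [hpos] with x hx s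
    rw [Complex.norm_cpow_eq_rpow_re_of_pos hx, Complex.neg_re]
  -- On the unit ball around `s` one has `v^(-Re t) ≤ v^a + v^b` whether `v` is small or large. With
  -- `|log v| ≤ v + v⁻¹` this gives the four terms of the dominating function.
  set a := -s.re - 1
  set b := -s.re + 1
  refine (hasDerivAt_integral_of_dominated_loc_of_deriv_le (s := Metric.ball s 1)
    (F := fun s x => g x * (v x : ℂ) ^ (-s))
    (F' := fun s x => g x * ((v x : ℂ) ^ (-s) * Complex.log (v x) * (-1)))
    (bound := fun x => ‖g x‖ * v x ^ (a + 1) + ‖g x‖ * v x ^ (a - 1) + ‖g x‖ * v x ^ (b + 1) +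
      ‖g x‖ * v x ^ (b - 1)) (Metric.ball_mem_nhds s one_pos) (.of_forall hmeas) ?_ ?_ ?_ ?_
      ?_).2.differentiableAt
  · refine (hint (-s.re)).mono (hmeas s) ?_
    filter_upwards [hpos, hnorm] with x hx hn
    rw [norm_mul, norm_mul, hn, norm_norm, Real.norm_eq_abs, abs_of_nonneg (by positivity)]
  · exact hg.mul ((((Complex.measurable_ofReal.comp hv).pow_const _).mul
      (Complex.measurable_log.comp (Complex.measurable_ofReal.comp hv))).mul_const _).aestronglyMeasurable
  · filter_upwards [hpos, hnorm] with x hx hn t ht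
    have hlog : ‖Complex.log (v x)‖ ≤ v x ^ (1 : ℝ) + v x ^ (-1 : ℝ) := by
      rw [← Complex.ofReal_log hx.le, Complex.norm_real, Real.norm_eq_abs, Real.rpow_one,
        Real.rpow_neg_one]
      have h1 := Real.log_le_sub_one_of_pos hx
      have h2 := Real.log_le_sub_one_of_pos (inv_pos.2 hx)
      rw [Real.log_inv] at h2
      have h3 := inv_pos.2 hx
      exact abs_le.2 ⟨by linarith, by linarith⟩
    have hre : |t.re - s.re| < 1 := by
      have h1 := Complex.abs_re_le_norm (t - s)
      rw [Complex.sub_re] at h1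
      exact h1.trans_lt (mem_ball_iff_norm.1 ht)
    obtain ⟨h1, h2⟩ := abs_lt.1 hre
    have hpow : v x ^ (-t.re) ≤ v x ^ a + v x ^ b := by
      rcases le_total 1 (v x) with h | h
      · exact (Real.rpow_le_rpow_of_exponent_le h (by simp only [b]; linarith)).trans
          (le_add_of_nonneg_left (Real.rpow_nonneg hx.le _))
      · exact (Real.rpow_le_rpow_of_exponent_ge hx h (by simp only [a]; linarith)).trans
          (le_add_of_nonneg_right (Real.rpow_nonneg hx.le _))
    rw [norm_mul, norm_mul, norm_mul, hn, norm_neg, norm_one, mul_one]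
    calc ‖g x‖ * (v x ^ (-t.re) * ‖Complex.log (v x)‖)
        ≤ ‖g x‖ * ((v x ^ a + v x ^ b) * (v x ^ (1 : ℝ) + v x ^ (-1 : ℝ))) := by gcongr
      _ = _ := by
        clear_value a b
        rw [sub_eq_add_neg a, sub_eq_add_neg b, Real.rpow_add hx, Real.rpow_add hx,
          Real.rpow_add hx, Real.rpow_add hx]
        ring
  · exact (((hint _).add (hint _)).add (hint _)).add (hint _)
  · filter_upwards [hpos] with x hx t _
    refine HasDerivAt.const_mul (g x) ?_
    exact (hasDerivAt_neg t).const_cpow (Or.inl (Complex.ofReal_ne_zero.2 hx.ne'))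

lemma integrableOn_exp_mul_rpow {A δ : ℝ} (hA : 0 < A) (hδ : 0 < δ) (σ : ℝ) :
    IntegrableOn (fun v : ℝ => Real.exp (-δ * v) * v ^ σ) (Set.Ioi A) := by
  refine integrable_of_isBigO_exp_neg (half_pos hδ) ?_ ?_
  · refine ContinuousOn.mul (by fun_prop) ?_
    exact continuousOn_id.rpow_const fun v hv => Or.inl (hA.trans_le hv).ne'
  · have h := (isLittleO_rpow_exp_pos_mul_atTop σ (half_pos hδ)).isBigO
    have h1 : (fun v : ℝ => Real.exp (-δ * v)) =O[atTop] fun v : ℝ => Real.exp (-δ * v) :=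
      Asymptotics.isBigO_refl _ _
    refine (h1.mul h).congr (fun v => rfl) fun v => ?_
    rw [← Real.exp_add]
    congr 1
    ring

/-- The constant term of `A^(-s) / s`. -/
lemma exists_cpow_neg_div {A : ℝ} (hA : 0 < A) : ∃ k : ℂ → ℂ, AnalyticAt ℂ k 0 ∧
    k 0 = -(Real.log A : ℂ) ∧ ∀ s ≠ 0, (A : ℂ) ^ (-s) / s = 1 / s + k s := by
  have hA0 : (A : ℂ) ≠ 0 := Complex.ofReal_ne_zero.2 hA.ne'
  have hd : ∀ s : ℂ, HasDerivAt (fun s : ℂ => (A : ℂ) ^ (-s))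
      ((A : ℂ) ^ (-s) * Complex.log A * (-1)) s := fun s =>
    (hasDerivAt_neg s).const_cpow (Or.inl hA0)
  have han : AnalyticAt ℂ (fun s : ℂ => (A : ℂ) ^ (-s)) 0 :=
    Differentiable.analyticAt (fun s => (hd s).differentiableAt) 0
  obtain ⟨p, hp⟩ := han
  refine ⟨dslope (fun s : ℂ => (A : ℂ) ^ (-s)) 0, ⟨_, hp.has_fpower_series_dslope_fslope⟩, ?_, ?_⟩
  · rw [dslope_same, (hd 0).deriv]
    simp [Complex.ofReal_log hA.le]
  · intro s hs
    rw [dslope_of_ne _ hs, slope_def_field]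
    simp only [neg_zero, Complex.cpow_zero, sub_zero]
    field_simp
    ring

end ParametricIntegrals

/-! ### The regularized integral of an unfolded sum -/

section RegularizedUnfolding

variable {f : ℂ → ℂ} {w : ℝ} {N : ℂ} {h₁ : ℝ → ℂ}

lemma cutoff_mul_eq_zero {τ : ℍ} (h : τ.im < w) : cutoff w τ * f τ = 0 := by
  rw [cutoff, if_neg (not_le.2 h), zero_mul]

/-- The hypotheses on `f` and on its constant Fourier coefficient `v (N + h₁ v)` under which the
regularized integral of `unfoldedSum` can be computed. -/
structure UnfoldingData (f : ℂ → ℂ) (w : ℝ) (N : ℂ) (h₁ : ℝ → ℂ) : Prop where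
  measurable : Measurable f
  periodic : ∀ x, f (x + 1) = f x
  pos : 0 < w
  bounded : ∀ B : ℝ, ∃ C : ℝ, ∀ x : ℂ, |x.re| ≤ 1 / 2 → x.im ∈ Set.Icc w B → ‖f x‖ ≤ C
  measurable_coeff : Measurable h₁
  integral_eq : ∀ v : ℝ, w ≤ v →
    ∫ u in Set.Ioc (-1 / 2 : ℝ) (1 / 2), f (u + v * Complex.I) = v * (N + h₁ v)
  decay : ∃ C δ : ℝ, 0 < δ ∧ ∀ v : ℝ, w ≤ v → ‖h₁ v‖ ≤ C * Real.exp (-δ * v)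

namespace UnfoldingData

/-- Integration in `u` leaves `v(N + h₁(v))`, and the hyperbolic measure divides by `v²`. -/
lemma band (D : UnfoldingData f w N h₁) (s : ℂ) {B : ℝ} {J : Set ℝ} (hJm : MeasurableSet J) (hJ : J ⊆ Set.Icc w B) :
    IntegrableOn (fun v : ℝ => (N + h₁ v) / v * (v : ℂ) ^ (-s)) J ∧
    IntegrableOn (fun τ : ℍ => f τ * (τ.im : ℂ) ^ (-s)) (strip ∩ {τ | τ.im ∈ J}) ∧
    ∫ τ in strip ∩ {τ | τ.im ∈ J}, f τ * (τ.im : ℂ) ^ (-s) =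
      ∫ v in J, (N + h₁ v) / v * (v : ℂ) ^ (-s) := by
  obtain ⟨C, hC⟩ := D.bounded B
  have hcont : ContinuousOn (fun v : ℝ => (v : ℂ) ^ (-s)) (Set.Icc w B) := by
    intro v hv
    refine ContinuousAt.continuousWithinAt ?_
    refine (Complex.continuous_ofReal.continuousAt).cpow continuousAt_const ?_
    exact Or.inl (by simpa using D.pos.trans_le hv.1)
  obtain ⟨C', hC'⟩ := isCompact_Icc.exists_bound_of_continuousOn hcont
  have hbd : ∀ x : ℂ, |x.re| ≤ 1 / 2 → x.im ∈ Set.Icc w B →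
      ‖f x * (x.im : ℂ) ^ (-s)‖ ≤ C * C' := by
    intro x h1 h2
    rw [norm_mul]
    have h3 := hC x h1 h2
    have h4 := hC' _ h2
    have h5 := (norm_nonneg _).trans h3
    gcongr
  have hm : Measurable fun x : ℂ => f x * (x.im : ℂ) ^ (-s) :=
    D.measurable.mul ((Complex.measurable_ofReal.comp Complex.measurable_im).pow_const _)
  obtain ⟨h1, h2, h3⟩ := integral_strip_band hm D.pos hbd hJm hJ
  have h4 : Set.EqOn (fun v : ℝ => ∫ u in Set.Ioc (-1 / 2 : ℝ) (1 / 2),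
      f (u + v * Complex.I) * ((u + v * Complex.I : ℂ).im : ℂ) ^ (-s) * ((v : ℂ) ^ 2)⁻¹)
      (fun v : ℝ => (N + h₁ v) / v * (v : ℂ) ^ (-s)) J := by
    intro v hv
    have hv0 : (v : ℂ) ≠ 0 := Complex.ofReal_ne_zero.2 (D.pos.trans_le (hJ hv).1).ne'
    have him : ∀ u : ℝ, (u + v * Complex.I : ℂ).im = v := fun u => by simp
    simp only [him, mul_assoc]
    rw [integral_mul_const, D.integral_eq v (hJ hv).1]
    field_simp
  rw [integrableOn_congr_fun h4 hJm] at h2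
  rw [setIntegral_congr_fun hJm h4] at h3
  exact ⟨h2, h1, h3⟩

lemma apply_T_smul (D : UnfoldingData f w N h₁) (τ : ℍ) : cutoff w (ModularGroup.T • τ) * f (ModularGroup.T • τ : ℍ) =
    cutoff w τ * f τ := by
  have h := ModularGroup.coe_T_zpow_smul_eq τ (n := 1)
  rw [zpow_one, Int.cast_one] at h
  rw [h, D.periodic, cutoff, cutoff, ModularGroup.im_T_smul]

lemma measurable_cutoff_mul (D : UnfoldingData f w N h₁) : Measurable fun τ : ℍ => cutoff w τ * f τ := by
  refine Measurable.mul ?_ (D.measurable.comp UpperHalfPlane.measurable_coe)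
  exact Measurable.ite (UpperHalfPlane.continuous_im.measurable measurableSet_Ici)
    measurable_const measurable_const

/-- This is the case `s = 0`, the only one where the weight `v^(-s)` does not obstruct unfolding. -/
lemma integral_truncFD (D : UnfoldingData f w N h₁) {A : ℝ} (hA : 0 < A) (hAw : 1 / A ≤ w) :
    IntegrableOn (unfoldedSum fun τ => cutoff w τ * f τ) (truncFD A) ∧
      ∫ τ in truncFD A, unfoldedSum (fun τ => cutoff w τ * f τ) τ =
        ∫ v in Set.Icc w A, (N + h₁ v) / v := by
  obtain ⟨-, h1, h2⟩ := D.band 0 (measurableSet_Icc (a := w) (b := A)) subset_rfl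
  simp only [neg_zero, Complex.cpow_zero, mul_one] at h1 h2
  have hms : MeasurableSet (strip ∩ {τ | τ.im ∈ Set.Icc w A}) :=
    measurableSet_strip.inter (UpperHalfPlane.continuous_im.measurable measurableSet_Icc)
  have hms' : MeasurableSet (strip ∩ {τ | τ.im ≤ A}) :=
    measurableSet_strip.inter (measurableSet_im_le A)
  have heq : Set.EqOn (fun τ : ℍ => cutoff w τ * f τ) (fun τ => f τ)
      (strip ∩ {τ | τ.im ∈ Set.Icc w A}) := by
    intro τ hτ
    simp only [cutoff, if_pos hτ.2.1, one_mul]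
  have hsub : strip ∩ {τ | τ.im ∈ Set.Icc w A} ⊆ strip ∩ {τ | τ.im ≤ A} :=
    fun τ hτ => ⟨hτ.1, hτ.2.2⟩
  have hzero : ∀ τ ∈ (strip ∩ {τ | τ.im ≤ A}) \ (strip ∩ {τ | τ.im ∈ Set.Icc w A}),
      cutoff w τ * f τ = 0 := by
    rintro τ ⟨⟨h3, h4⟩, h5⟩
    refine cutoff_mul_eq_zero (not_le.1 fun h6 => h5 ⟨h3, h6, h4⟩)
  rw [← integrableOn_congr_fun heq hms] at h1
  rw [← setIntegral_congr_fun hms heq] at h2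
  have h3 := h1.of_forall_sdiff_eq_zero hms' hzero
  obtain ⟨h4, h5⟩ := integral_unfoldedSum (fun τ hτ => cutoff_mul_eq_zero hτ)
    D.measurable_cutoff_mul hA hAw h3
  refine ⟨h4, ?_⟩
  rw [h5, ← h2]
  exact setIntegral_eq_of_subset_of_forall_sdiff_eq_zero hms' hsub hzero

lemma integrable_coeff (D : UnfoldingData f w N h₁) : IntegrableOn (fun v => h₁ v / v) (Set.Ioi w) := by
  obtain ⟨C, δ, hδ, hC⟩ := D.decay
  refine ((integrableOn_exp_mul_rpow D.pos hδ (-1)).const_mul C).mono'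
    (D.measurable_coeff.div (by fun_prop)).aestronglyMeasurable ?_
  filter_upwards [ae_restrict_mem measurableSet_Ioi] with v hv
  have hv' : w < v := hv
  have hv0 : 0 < v := D.pos.trans hv'
  rw [norm_div, Complex.norm_real, Real.norm_eq_abs, abs_of_pos hv0, Real.rpow_neg_one,
    ← mul_assoc, ← div_eq_mul_inv]
  gcongr
  exact hC v hv'.le

lemma integrable_coeff_mul (D : UnfoldingData f w N h₁) {A : ℝ} (hA : w ≤ A) (σ : ℝ) :
    IntegrableOn (fun v => ‖h₁ v / v‖ * v ^ σ) (Set.Ioi A) := by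
  obtain ⟨C, δ, hδ, hC⟩ := D.decay
  refine ((integrableOn_exp_mul_rpow (D.pos.trans_le hA) hδ (-1 + σ)).const_mul C).mono'
    ((D.measurable_coeff.div (by fun_prop)).norm.mul (by fun_prop)).aestronglyMeasurable ?_
  filter_upwards [ae_restrict_mem measurableSet_Ioi] with v hv
  have hv' : w < v := hA.trans_lt hv
  have hv0 : 0 < v := D.pos.trans hv'
  rw [norm_mul, norm_norm, norm_div, Complex.norm_real, Real.norm_eq_abs, Real.norm_eq_abs,
    abs_of_pos hv0, abs_of_pos (Real.rpow_pos_of_pos hv0 _), Real.rpow_add hv0, Real.rpow_neg_one,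
    ← mul_assoc, ← mul_assoc, ← div_eq_mul_inv]
  gcongr
  exact hC v hv'.le

lemma integrableOn_mul_cpow (D : UnfoldingData f w N h₁) (T : ℝ) (s : ℂ) :
    IntegrableOn (fun τ : ℍ => unfoldedSum (fun τ => cutoff w τ * f τ) τ * (τ.im : ℂ) ^ (-s))
      (truncFD T) := by
  set A := max T (1 / w) with hA
  have hA0 : 0 < A := lt_of_lt_of_le (one_div_pos.2 D.pos) (le_max_right _ _)
  have hAw : 1 / A ≤ w := (one_div_le hA0 D.pos).2 (le_max_right _ _)
  have h1 := (D.integral_truncFD hA0 hAw).1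
  have hcomp : IsCompact (truncFD A) := by
    rw [truncFD_eq]
    exact ModularGroup.isCompact_truncatedFundamentalDomain A
  have h2 : ContinuousOn (fun τ : ℍ => (τ.im : ℂ) ^ (-s)) (truncFD A) := by
    refine Continuous.continuousOn (continuous_iff_continuousAt.2 fun τ => ?_)
    refine ContinuousAt.cpow ?_ continuousAt_const (Or.inl (by simpa using τ.im_pos))
    exact (Complex.continuous_ofReal.comp UpperHalfPlane.continuous_im).continuousAt
  refine (h1.mul_continuousOn h2 hcomp).mono_set ?_
  rintro τ ⟨h3, h4, h5⟩
  exact ⟨h3, h4, h5.trans (le_max_left _ _)⟩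

/-- Above height `A ≥ 1` the fundamental domain is a full rectangle, and there the unfolded sum
reduces to `f`, so no unfolding is needed for general `s`. -/
lemma integral_truncFD_diff (D : UnfoldingData f w N h₁) {A T : ℝ} (hA1 : 1 ≤ A) (hwA : w ≤ A) (hAw : 1 / w ≤ A) (hT : A ≤ T)
    (s : ℂ) :
    ∫ τ in truncFD T, unfoldedSum (fun τ => cutoff w τ * f τ) τ * (τ.im : ℂ) ^ (-s) =
      (∫ τ in truncFD A, unfoldedSum (fun τ => cutoff w τ * f τ) τ * (τ.im : ℂ) ^ (-s)) +
        ∫ v in A..T, (N + h₁ v) / v * (v : ℂ) ^ (-s) := by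
  set H := unfoldedSum fun τ => cutoff w τ * f τ with hH
  set S : Set ℍ := {τ | |τ.re| ≤ 1 / 2 ∧ τ.im ∈ Set.Ioc A T} with hS
  have hunion : truncFD T = truncFD A ∪ S := by
    ext τ
    simp only [truncFD, hS, Set.mem_union, Set.mem_ofPred_eq, Set.mem_Ioc]
    constructor
    · rintro ⟨h1, h2, h3⟩
      rcases le_or_gt τ.im A with h | h
      · exact Or.inl ⟨h1, h2, h⟩
      · exact Or.inr ⟨h2, h, h3⟩
    · rintro (⟨h1, h2, h3⟩ | ⟨h1, h2, h3⟩)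
      · exact ⟨h1, h2, h3.trans hT⟩
      · refine ⟨?_, h1, h3⟩
        have h4 := (Complex.abs_im_le_norm (τ : ℂ))
        have h5 : τ.im ≤ |(τ : ℂ).im| := le_abs_self _
        linarith
  have hdisj : Disjoint (truncFD A) S := by
    rw [Set.disjoint_left]
    rintro τ ⟨-, -, h1⟩ ⟨-, h2, -⟩
    linarith
  have hSm : MeasurableSet S :=
    ((measurable_abs.comp UpperHalfPlane.continuous_re.measurable) measurableSet_Iic).inter
      (UpperHalfPlane.continuous_im.measurable measurableSet_Ioc)
  have hint := D.integrableOn_mul_cpow T s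
  rw [hunion] at hint ⊢
  rw [setIntegral_union hdisj hSm hint.left_of_union hint.right_of_union]
  congr 1
  have hae : S =ᵐ[volume] (strip ∩ {τ | τ.im ∈ Set.Ioc A T} : Set ℍ) := by
    have h1 := measure_eq_zero_iff_ae_notMem.1 (volume_re_eq (-(1 / 2)))
    filter_upwards [h1] with τ hτ
    refine propext ⟨?_, ?_⟩
    · rintro ⟨h2, h3⟩
      obtain ⟨h4, h5⟩ := abs_le.1 h2
      have h6 : -(1 / 2) < τ.re := lt_of_le_of_ne h4 fun h => hτ h.symm
      exact ⟨⟨by linarith, h5⟩, h3⟩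
    · rintro ⟨⟨h2, h3⟩, h4⟩
      exact ⟨abs_le.2 ⟨by linarith, h3⟩, h4⟩
  rw [setIntegral_congr_set hae, intervalIntegral.integral_of_le hT,
    ← (D.band s measurableSet_Ioc (J := Set.Ioc A T) (B := T)
      fun v hv => ⟨hwA.trans hv.1.le, hv.2⟩).2.2]
  refine setIntegral_congr_fun (measurableSet_strip.inter
    (UpperHalfPlane.continuous_im.measurable measurableSet_Ioc)) fun τ hτ => ?_
  have h1 : A < τ.im := hτ.2.1
  have h2 : 1 / τ.im < w := (one_div_lt τ.im_pos D.pos).2 (hAw.trans_lt h1)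
  rw [unfoldedSum_eq_self D.pos D.apply_T_smul (fun τ hτ => cutoff_mul_eq_zero hτ) h2, cutoff,
    if_pos (hwA.trans h1.le), one_mul]

lemma integrableOn_Ioi_cpow (D : UnfoldingData f w N h₁) {A : ℝ} (hwA : w ≤ A) (s : ℂ) :
    IntegrableOn (fun v : ℝ => h₁ v / v * (v : ℂ) ^ (-s)) (Set.Ioi A) := by
  have hA := D.pos.trans_le hwA
  refine (D.integrable_coeff_mul hwA (-s.re)).mono'
    ((D.measurable_coeff.div (by fun_prop)).mul (by fun_prop)).aestronglyMeasurable ?_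
  filter_upwards [ae_restrict_mem measurableSet_Ioi] with v hv
  rw [norm_mul, Complex.norm_cpow_eq_rpow_re_of_pos (hA.trans hv), Complex.neg_re]

/-- The regularized integral of the unfolded sum. -/
theorem hasRegularizedIntegral (D : UnfoldingData f w N h₁) :
    HasRegularizedIntegral (unfoldedSum fun τ => cutoff w τ * f τ)
      ((∫ v in Set.Ioi w, h₁ v / v) - N * Real.log w) := by
  set H := unfoldedSum fun τ => cutoff w τ * f τ with hH
  -- This height satisfies all three requirements: `A ≥ 1`, so the unit circle lies below; `A ≥ w`,
  -- so the cutoff equals 1 above; `1/A ≤ w`, so the cosets with `c ≠ 0` vanish above.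
  set A := max w (1 / w) with hA
  have hw := D.pos
  have hwA : w ≤ A := le_max_left _ _
  have hAw : 1 / w ≤ A := le_max_right _ _
  have hA0 : 0 < A := hw.trans_le hwA
  have hAw' : 1 / A ≤ w := (one_div_le hA0 hw).2 hAw
  have hA1 : 1 ≤ A := by
    rcases le_total 1 w with h | h
    · exact h.trans hwA
    · exact ((one_le_div hw).2 h).trans hAw
  set Φ₁ : ℂ → ℂ := fun s => ∫ τ in truncFD A, H τ * (τ.im : ℂ) ^ (-s) with hΦ₁
  set Φ₂ : ℂ → ℂ := fun s => ∫ v in Set.Ioi A, h₁ v / v * (v : ℂ) ^ (-s) with hΦ₂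
  have hcomp : IsCompact (truncFD A) := by
    rw [truncFD_eq]
    exact ModularGroup.isCompact_truncatedFundamentalDomain A
  obtain ⟨hHint, hHval⟩ := D.integral_truncFD hA0 hAw'
  have hd₁ : Differentiable ℂ Φ₁ := by
    refine differentiable_integral_cpow_neg hHint.aestronglyMeasurable
      UpperHalfPlane.continuous_im.measurable (.of_forall fun τ => τ.im_pos) fun σ => ?_
    refine IntegrableOn.mul_continuousOn hHint.norm ?_ hcomp
    exact UpperHalfPlane.continuous_im.continuousOn.rpow_const fun τ _ => Or.inl τ.im_pos.ne'
  have hd₂ : Differentiable ℂ Φ₂ := by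
    refine differentiable_integral_cpow_neg
      (D.measurable_coeff.div (by fun_prop)).aestronglyMeasurable measurable_id ?_
      (D.integrable_coeff_mul hwA)
    filter_upwards [ae_restrict_mem measurableSet_Ioi] with v hv using hA0.trans hv
  have hd₃ : Differentiable ℂ fun s : ℂ => (A : ℂ) ^ (-s) := fun s =>
    ((hasDerivAt_neg s).const_cpow
      (Or.inl (Complex.ofReal_ne_zero.2 hA0.ne'))).differentiableAt
  -- The continuation is meromorphic on all of `ℂ`: the first two terms are entire, and the last is
  -- the integral of `N v^(-s-1)` over `(A, ∞)`, with a simple pole at 0. The bound `ε = 1` is an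
  -- arbitrary choice.
  refine ⟨0, 1, fun s => Φ₁ s + Φ₂ s + N * ((A : ℂ) ^ (-s) / s), one_pos, ?_, ?_, ?_, ?_⟩
  · intro s _
    exact ((hd₁.analyticAt s).meromorphicAt.add (hd₂.analyticAt s).meromorphicAt).add
      ((MeromorphicAt.const N s).mul ((hd₃.analyticAt s).meromorphicAt.div
        (MeromorphicAt.id s)))
  · intro s hs
    have hs0 : s ≠ 0 := by
      rintro rfl
      simp at hs
    exact ((hd₁ s).add (hd₂ s)).add (((hd₃ s).div differentiableAt_id hs0).const_mul N)
      |>.differentiableWithinAt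
  · intro s hs
    refine ⟨fun T => D.integrableOn_mul_cpow T s, ?_⟩
    have hpow : ∀ v : ℝ, v ∈ Set.Ioi A → (1 / (v : ℂ)) * (v : ℂ) ^ (-s) = (v : ℂ) ^ (-s - 1) := by
      intro v hv
      have hv0 : (v : ℂ) ≠ 0 := Complex.ofReal_ne_zero.2 (hA0.trans hv).ne'
      rw [Complex.cpow_sub _ _ hv0, Complex.cpow_one]
      ring
    have hlt : (-s - 1).re < -1 := by
      simp only [Complex.sub_re, Complex.neg_re, Complex.one_re]
      linarith
    have hi1 : IntegrableOn (fun v : ℝ => N * ((1 / (v : ℂ)) * (v : ℂ) ^ (-s))) (Set.Ioi A) := by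
      refine Integrable.const_mul ?_ N
      exact (integrableOn_congr_fun hpow measurableSet_Ioi).2
        (integrableOn_Ioi_cpow_of_lt hlt hA0)
    have hi2 := D.integrableOn_Ioi_cpow hwA s
    have hsplit : ∀ v : ℝ, (N + h₁ v) / v * (v : ℂ) ^ (-s) =
        h₁ v / v * (v : ℂ) ^ (-s) + N * ((1 / (v : ℂ)) * (v : ℂ) ^ (-s)) := fun v => by ring
    have hi : IntegrableOn (fun v : ℝ => (N + h₁ v) / v * (v : ℂ) ^ (-s)) (Set.Ioi A) := by
      simp only [hsplit]
      exact hi2.add hi1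
    have hval : ∫ v in Set.Ioi A, (N + h₁ v) / v * (v : ℂ) ^ (-s) =
        Φ₂ s + N * ((A : ℂ) ^ (-s) / s) := by
      simp only [hsplit]
      rw [integral_add hi2 hi1, integral_const_mul, setIntegral_congr_fun measurableSet_Ioi hpow,
        integral_Ioi_cpow_of_lt hlt hA0]
      congr 2
      rw [sub_add_cancel, neg_div, div_neg, neg_neg]
    have hlim := (intervalIntegral_tendsto_integral_Ioi A hi tendsto_id).const_add (Φ₁ s)
    rw [hval, ← add_assoc] at hlim
    refine hlim.congr' ?_
    filter_upwards [eventually_ge_atTop A] with T hT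
    exact (D.integral_truncFD_diff hA1 hwA hAw hT s).symm
  -- The constant term `-N log A` of the pole part combines with `N(log A - log w)` from heights
  -- between `w` and `A`, so the auxiliary `A` drops out.
  · obtain ⟨k, hk, hk0, hks⟩ := exists_cpow_neg_div hA0
    refine ⟨1, fun _ => N, fun s => Φ₁ s + Φ₂ s + N * k s,
      ((hd₁.analyticAt 0).add (hd₂.analyticAt 0)).add (analyticAt_const.mul hk), ?_, ?_⟩
    · have h1 : Φ₁ 0 = ∫ v in Set.Icc w A, (N + h₁ v) / v := by
        rw [hΦ₁, ← hHval]
        simp [hH]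
      have h2 : Φ₂ 0 = ∫ v in Set.Ioi A, h₁ v / v := by
        rw [hΦ₂]
        simp
      have hI := D.integrable_coeff
      have hI1 : IntegrableOn (fun v => h₁ v / v) (Set.Ioc w A) :=
        hI.mono_set Set.Ioc_subset_Ioi_self
      have hI2 : IntervalIntegrable (fun v : ℝ => N * ((v⁻¹ : ℝ) : ℂ)) volume w A := by
        refine (ContinuousOn.intervalIntegrable ?_)
        rw [Set.uIcc_of_le hwA]
        refine continuousOn_const.mul (Complex.continuous_ofReal.comp_continuousOn ?_)
        exact continuousOn_id.inv₀ fun v hv => (hw.trans_le hv.1).ne'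
      have h3 : ∫ v in Set.Icc w A, (N + h₁ v) / v =
          N * (Real.log A - Real.log w) + ∫ v in Set.Ioc w A, h₁ v / v := by
        have h4 : ∀ v : ℝ, (N + h₁ v) / v = N * ((v⁻¹ : ℝ) : ℂ) + h₁ v / v := fun v => by
          push_cast
          ring
        simp only [h4]
        rw [integral_Icc_eq_integral_Ioc, integral_add
          ((intervalIntegrable_iff_integrableOn_Ioc_of_le hwA).1 hI2) hI1,
          ← intervalIntegral.integral_of_le hwA, intervalIntegral.integral_const_mul,
          intervalIntegral.integral_ofReal, integral_inv_of_pos hw hA0,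
          Real.log_div hA0.ne' hw.ne', Complex.ofReal_sub]
      have h5 : ∫ v in Set.Ioi w, h₁ v / v =
          (∫ v in Set.Ioc w A, h₁ v / v) + ∫ v in Set.Ioi A, h₁ v / v := by
        rw [← setIntegral_union (Set.Ioc_disjoint_Ioi le_rfl) measurableSet_Ioi hI1
          (hI.mono_set (Set.Ioi_subset_Ioi hwA)), Set.Ioc_union_Ioi_eq_Ioi hwA]
      simp only [h1, h2, h3, h5, hk0]
      ring
    · filter_upwards [self_mem_nhdsWithin] with s hs
      have hs0 : s ≠ 0 := hs
      simp only [Finset.Icc_self, Finset.sum_singleton, pow_one]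
      rw [hks s hs0]
      ring

end UnfoldingData
end RegularizedUnfolding

/-! ### The positive definite majorant and the Fourier coefficients of theta -/

section Majorant

variable {V : Type*} [AddCommGroup V] [Module ℚ V] [FiniteDimensional ℚ V]
  {Q : QuadraticForm ℚ V} {L : Submodule ℤ V} {p : ℕ}

lemma realForm_proj_nonpos (z : SymSpace Q) (x : RealSpace V) : realForm Q (proj z x) ≤ 0 := by
  by_cases h : proj z x = 0
  · rw [h, QuadraticMap.map_zero]
  · exact (z.neg_def _ (proj_mem z x) h).le

lemma Ro_nonneg (x : V) (z : SymSpace Q) : 0 ≤ Ro x z := by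
  have := realForm_proj_nonpos z (toReal x)
  rw [Ro]
  linarith

lemma Ro_eq_zero_iff (x : V) (z : SymSpace Q) : Ro x z = 0 ↔ proj z (toReal x) = 0 := by
  constructor
  · intro h
    by_contra hne
    have := z.neg_def _ (proj_mem z _) hne
    rw [Ro] at h
    linarith
  · intro h
    rw [Ro, h, QuadraticMap.map_zero, mul_zero]

/-- The positive definite majorant `Q(x) + R(x, z)` is nonnegative. -/
lemma add_Ro_nonneg (hQ : HasSignature Q p 2) (x : V) (z : SymSpace Q) :
    0 ≤ (Q x : ℝ) + Ro x z := by
  have h1 := realForm_eq_add_proj z (toReal x)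
  rw [realForm_toReal] at h1
  have h2 : 0 ≤ realForm Q (toReal x - proj z (toReal x)) := by
    by_cases h : toReal x - proj z (toReal x) = 0
    · rw [h, QuadraticMap.map_zero]
    · exact (pos_of_mem_orthogonal hQ z (sub_proj_mem z _) h).le
  have h3 := realForm_proj_nonpos z (toReal x)
  rw [Ro]
  linarith

/-- The real part of `t` meets the sum of the two components of `Q`, the imaginary part their
difference, which is `Q(x) + R(x, z)`. -/
lemma gaussTerm_eq (z : SymSpace Q) (t : ℂ) (x : V) : gaussTerm z t (toReal x) =
    Complex.exp (2 * Real.pi * Complex.I * ((Q x : ℝ) * t.re : ℝ)) *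
      (Real.exp (-2 * Real.pi * t.im * ((Q x : ℝ) + Ro x z)) : ℝ) := by
  have h1 := realForm_eq_add_proj z (toReal x)
  rw [realForm_toReal] at h1
  rw [gaussTerm, Ro, h1]
  set a := realForm Q (toReal x - proj z (toReal x))
  set b := realForm Q (proj z (toReal x))
  rw [Complex.ofReal_exp, ← Complex.exp_add]
  congr 1
  conv_lhs => rw [← Complex.re_add_im t]
  simp only [map_add, map_mul, Complex.conj_ofReal, Complex.conj_I]
  push_cast
  linear_combination (2 * Real.pi * t.im * (a - b)) * Complex.I_sq

lemma norm_gaussTerm (z : SymSpace Q) (t : ℂ) (x : V) : ‖gaussTerm z t (toReal x)‖ =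
    Real.exp (-2 * Real.pi * t.im * ((Q x : ℝ) + Ro x z)) := by
  rw [gaussTerm_eq, norm_mul, Complex.norm_real, Real.norm_eq_abs, Real.abs_exp]
  have : (2 * Real.pi * Complex.I * ((Q x : ℝ) * t.re : ℝ) : ℂ) =
      ((2 * Real.pi * ((Q x : ℝ) * t.re) : ℝ) : ℂ) * Complex.I := by
    push_cast
    ring
  rw [this, Complex.norm_exp_ofReal_mul_I, one_mul]

lemma countable_dualLattice (hQ : HasSignature Q p 2) [L.IsLattice ℚ] :
    Countable (dualLattice Q L) := by
  obtain ⟨v, vd, e, ed, -⟩ := exists_lattice_basis (L := L) hQ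
  exact ed.symm.injective.countable

lemma measurable_gaussTerm (z : SymSpace Q) (x : RealSpace V) :
    Measurable fun t : ℂ => gaussTerm z t x := by
  unfold gaussTerm
  have : Measurable fun t : ℂ => (starRingEnd ℂ) t := Complex.continuous_conj.measurable
  fun_prop

lemma summable_exp_majorant (hQ : HasSignature Q p 2) [L.IsLattice ℚ] (z : SymSpace Q) {v : ℝ}
    (hv : 0 < v) : Summable fun x : dualLattice Q L =>
      Real.exp (-2 * Real.pi * v * ((Q (x : V) : ℝ) + Ro (x : V) z)) := by
  have h := summable_gaussTerm (L := L) hQ z (t := Complex.I * v) (by simpa using hv)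
  refine h.congr fun x => ?_
  rw [norm_gaussTerm]
  simp

end Majorant

section ThetaCoefficients

variable {V : Type*} [AddCommGroup V] [Module ℚ V] [FiniteDimensional ℚ V]
  {Q : QuadraticForm ℚ V} (L : Submodule ℤ V) {p : ℕ}

/-- The vectors of norm `m` in the coset `μ`. -/
def cosetNorm (m : ℚ) (μ : Disc Q L) : Set (dualLattice Q L) :=
  {x | toDisc Q L x = μ ∧ Q (x : V) = m}

/-- The vectors of norm `m` in the coset `μ` that are orthogonal to `z`. -/
def orthNorm (m : ℚ) (μ : Disc Q L) (z : SymSpace Q) : Set (dualLattice Q L) :=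
  {x | x ∈ cosetNorm L m μ ∧ Ro (x : V) z = 0}

/-- The vectors of norm `m` in the coset `μ` that are not orthogonal to `z`. -/
def nonorthNorm (m : ℚ) (μ : Disc Q L) (z : SymSpace Q) : Set (dualLattice Q L) :=
  {x | x ∈ cosetNorm L m μ ∧ 0 < Ro (x : V) z}

/-- The decaying part of the `m`-th Fourier coefficient of the theta function. -/
def decayCoeff (m : ℚ) (μ : Disc Q L) (z : SymSpace Q) (v : ℝ) : ℂ :=
  ∑' x : nonorthNorm L m μ z, (Real.exp (-2 * Real.pi * v * Ro ((x : dualLattice Q L) : V) z) : ℂ)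

/-- The product of the theta function of the coset `μ` with `e(-m τ)`, as a function on `ℂ`. -/
def thetaTwist (m : ℚ) (μ : Disc Q L) (z : SymSpace Q) (t : ℂ) : ℂ :=
  Complex.exp (-2 * Real.pi * Complex.I * (m : ℂ) * t) *
    ((t.im : ℂ) * ∑' x : dualLattice Q L, basisVec Q L μ (toDisc Q L x) *
      gaussTerm z t (toReal (x : V)))

variable {L} {m : ℚ} {μ : Disc Q L} {z : SymSpace Q}

lemma cosetNorm_eq_union : cosetNorm L m μ = orthNorm L m μ z ∪ nonorthNorm L m μ z := by
  ext x
  constructor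
  · intro h
    rcases (Ro_nonneg (x : V) z).eq_or_lt with h1 | h1
    · exact Or.inl ⟨h, h1.symm⟩
    · exact Or.inr ⟨h, h1⟩
  · rintro (h | h) <;> exact h.1

lemma disjoint_orthNorm : Disjoint (orthNorm L m μ z) (nonorthNorm L m μ z) :=
  Set.disjoint_left.2 fun _ h1 h2 => h2.2.ne' h1.2

/-- For fixed norm `m` the majorant is `m + R`, so the series is `exp(2πvm)` times a part of the
convergent Gaussian series. -/
lemma summable_cosetNorm (hQ : HasSignature Q p 2) [L.IsLattice ℚ] (m : ℚ) (μ : Disc Q L)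
    (z : SymSpace Q) {v : ℝ} (hv : 0 < v) :
    Summable fun x : cosetNorm L m μ =>
      Real.exp (-2 * Real.pi * v * Ro ((x : dualLattice Q L) : V) z) := by
  have h := ((summable_exp_majorant (L := L) hQ z hv).comp_injective
    (Subtype.val_injective (p := fun x => x ∈ cosetNorm L m μ))).mul_left
    (Real.exp (2 * Real.pi * v * m))
  refine h.congr fun x => ?_
  have hx : Q ((x : dualLattice Q L) : V) = m := x.2.2
  simp only [Function.comp_apply]
  rw [hx, ← Real.exp_add]
  congr 1
  ring

lemma summable_nonorthNorm (hQ : HasSignature Q p 2) [L.IsLattice ℚ] (m : ℚ) (μ : Disc Q L)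
    (z : SymSpace Q) {v : ℝ} (hv : 0 < v) :
    Summable fun x : nonorthNorm L m μ z =>
      Real.exp (-2 * Real.pi * v * Ro ((x : dualLattice Q L) : V) z) := by
  have h := (summable_cosetNorm hQ m μ z hv).comp_injective
    (Set.inclusion_injective (s := nonorthNorm L m μ z) (t := cosetNorm L m μ) fun x hx => hx.1)
  exact h

/-- On these vectors every term of the previous convergent series equals 1. -/
lemma finite_orthNorm (hQ : HasSignature Q p 2) [L.IsLattice ℚ] (m : ℚ) (μ : Disc Q L)
    (z : SymSpace Q) : (orthNorm L m μ z).Finite := by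
  have h := (summable_cosetNorm hQ m μ z one_pos).comp_injective
    (Set.inclusion_injective (s := orthNorm L m μ z) (t := cosetNorm L m μ) fun x hx => hx.1)
  have h1 : Summable fun _ : orthNorm L m μ z => (1 : ℝ) := by
    refine h.congr fun x => ?_
    have hx : Ro ((x : dualLattice Q L) : V) z = 0 := x.2.2
    simp [hx]
  by_contra hinf
  have : Infinite (orthNorm L m μ z) := Set.infinite_coe_iff.2 hinf
  exact one_ne_zero (tendsto_nhds_unique tendsto_const_nhds h1.tendsto_cofinite_zero)

/-- Convergence leaves only finitely many vectors with `0 < R ≤ 1`, and among them a minimum is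
attained. The bound `r` gives the exponential decay in `v` and keeps the arguments of `β` away from
its singularity. -/
lemma exists_Ro_lower_bound (hQ : HasSignature Q p 2) [L.IsLattice ℚ] (m : ℚ) (μ : Disc Q L)
    (z : SymSpace Q) : ∃ r : ℝ, 0 < r ∧ ∀ x ∈ nonorthNorm L m μ z, r ≤ Ro (x : V) z := by
  have h := summable_nonorthNorm hQ m μ z one_pos
  have h1 : {x : nonorthNorm L m μ z | Ro ((x : dualLattice Q L) : V) z ≤ 1}.Finite := by
    have h2 := (h.tendsto_cofinite_zero.eventually_lt_const
      (Real.exp_pos (-2 * Real.pi * 1 * 1)))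
    refine (Filter.eventually_cofinite.1 h2).subset fun x hx => ?_
    have hx' : Ro ((x : dualLattice Q L) : V) z ≤ 1 := hx
    rw [Set.mem_ofPred_eq, not_lt, Real.exp_le_exp]
    have := Real.pi_pos
    nlinarith
  obtain ⟨r, hr, hr'⟩ : ∃ r : ℝ, 0 < r ∧ ∀ x ∈ {x : nonorthNorm L m μ z |
      Ro ((x : dualLattice Q L) : V) z ≤ 1}, r ≤ Ro ((x : dualLattice Q L) : V) z := by
    rcases Set.eq_empty_or_nonempty {x : nonorthNorm L m μ z |
      Ro ((x : dualLattice Q L) : V) z ≤ 1} with h0 | h0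
    · exact ⟨1, one_pos, by simp [h0]⟩
    · obtain ⟨x, hx, hx'⟩ := h1.exists_minimalFor
        (fun x : nonorthNorm L m μ z => Ro ((x : dualLattice Q L) : V) z) _ h0
      refine ⟨_, x.2.2, fun y hy => ?_⟩
      rcases le_total (Ro ((x : dualLattice Q L) : V) z) (Ro ((y : dualLattice Q L) : V) z)
        with h3 | h3
      · exact h3
      · exact hx' hy h3
  refine ⟨min r 1, lt_min hr one_pos, fun x hx => ?_⟩
  rcases le_or_gt (Ro (x : V) z) 1 with h3 | h3
  · exact (min_le_left _ _).trans (hr' ⟨x, hx⟩ h3)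
  · exact (min_le_right _ _).trans h3.le

lemma decayCoeff_bound (hQ : HasSignature Q p 2) [L.IsLattice ℚ] (m : ℚ) (μ : Disc Q L)
    (z : SymSpace Q) {w : ℝ} (hw : 0 < w) :
    ∃ C δ : ℝ, 0 < δ ∧ ∀ v : ℝ, w ≤ v → ‖decayCoeff L m μ z v‖ ≤ C * Real.exp (-δ * v) := by
  obtain ⟨r, hr, hR⟩ := exists_Ro_lower_bound hQ m μ z
  have hs := summable_nonorthNorm hQ m μ z hw
  -- Comparison with the value at `v = w`: since `(v - w)(R - r) ≥ 0`, each term is at most its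
  -- value at `w` times `exp(-2πr(v - w))`.
  refine ⟨(∑' x : nonorthNorm L m μ z,
    Real.exp (-2 * Real.pi * w * Ro ((x : dualLattice Q L) : V) z)) *
      Real.exp (2 * Real.pi * r * w), 2 * Real.pi * r, by positivity, fun v hv => ?_⟩
  rw [mul_assoc, ← Real.exp_add]
  refine tsum_of_norm_bounded (hs.hasSum.mul_right _) fun x => ?_
  rw [Complex.norm_real, Real.norm_eq_abs, Real.abs_exp, ← Real.exp_add, Real.exp_le_exp]
  have h1 := hR x.1 x.2
  have h2 : 0 ≤ (v - w) * (Ro ((x : dualLattice Q L) : V) z - r) :=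
    mul_nonneg (sub_nonneg.2 hv) (sub_nonneg.2 h1)
  nlinarith [Real.pi_pos]

end ThetaCoefficients

/-! ### The function `β` and termwise integration of theta -/

section Beta

lemma integral_exp_div_eq_beta {w b : ℝ} (hb : 0 < b) :
    ∫ v in Set.Ioi w, Real.exp (-b * v) / v = beta (b * w) := by
  have h := integral_comp_mul_left_Ioi (fun t : ℝ => Real.exp (-t) / t) w hb
  rw [beta, eq_comm, ← smul_right_inj (inv_ne_zero hb.ne'), ← h, smul_eq_mul,
    ← integral_const_mul]
  refine integral_congr_ae (.of_forall fun v => ?_)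
  simp only [neg_mul]
  rw [mul_comm b v, ← div_div, div_eq_mul_inv _ b]
  ring

lemma integrableOn_exp_div {r : ℝ} (hr : 0 < r) :
    IntegrableOn (fun t : ℝ => Real.exp (-t) / t) (Set.Ioi r) := by
  refine (integrableOn_exp_mul_rpow hr one_pos (-1)).congr (.of_forall fun _ => ?_)
  simp only [neg_one_mul, Real.rpow_neg_one, div_eq_mul_inv]

lemma beta_nonneg {r : ℝ} (hr : 0 ≤ r) : 0 ≤ beta r :=
  setIntegral_nonneg measurableSet_Ioi fun _ ht =>
    div_nonneg (Real.exp_pos _).le (hr.trans (le_of_lt ht))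

lemma beta_le {r : ℝ} (hr : 0 < r) : beta r ≤ Real.exp (-r) / r := by
  have h1 : IntegrableOn (fun t : ℝ => Real.exp (-t) / r) (Set.Ioi r) :=
    (integrableOn_exp_neg_Ioi r).div_const r
  have h2 : ∫ t in Set.Ioi r, Real.exp (-t) / r = Real.exp (-r) / r := by
    rw [integral_div, integral_exp_neg_Ioi]
  rw [← h2, beta]
  refine setIntegral_mono_on (integrableOn_exp_div hr) h1 measurableSet_Ioi fun t ht => ?_
  have ht' : r < t := ht
  gcongr

end Beta

section ThetaIntegrals

variable {V : Type*} [AddCommGroup V] [Module ℚ V] [FiniteDimensional ℚ V]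
  {Q : QuadraticForm ℚ V} {L : Submodule ℤ V} {p : ℕ}

lemma integral_exp_int (n : ℤ) : ∫ u in Set.Ioc (-1 / 2 : ℝ) (1 / 2),
    Complex.exp (2 * Real.pi * Complex.I * (n * u : ℝ)) = if n = 0 then 1 else 0 := by
  rw [← intervalIntegral.integral_of_le (by norm_num)]
  split_ifs with h
  · simp [h]
    norm_num
  · have hn : (2 * Real.pi * Complex.I * n : ℂ) ≠ 0 := by
      simp [Real.pi_ne_zero, h]
    have h1 : ∀ u : ℝ, (2 * Real.pi * Complex.I * (n * u : ℝ) : ℂ) =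
        (2 * Real.pi * Complex.I * n) * u := fun u => by push_cast; ring
    simp only [h1]
    rw [integral_exp_mul_complex hn, div_eq_zero_iff]
    left
    rw [sub_eq_zero, Complex.exp_eq_exp_iff_exists_int]
    refine ⟨n, ?_⟩
    push_cast
    ring

/-- Each term integrates to a value of `β` by rescaling. From `β(r) ≤ e^(-r)/r` and the lower bound
on `R` these values are summable, which gives both the exchange of sum and integral and the absolute
convergence of Kudla's series. -/
lemma integral_decayCoeff (hQ : HasSignature Q p 2) [L.IsLattice ℚ] (m : ℚ) (μ : Disc Q L)
    (z : SymSpace Q) {w : ℝ} (hw : 0 < w) :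
    (Summable fun x : nonorthNorm L m μ z =>
      beta (2 * Real.pi * w * Ro ((x : dualLattice Q L) : V) z)) ∧
    ∫ v in Set.Ioi w, decayCoeff L m μ z v / v =
      ∑' x : nonorthNorm L m μ z, (beta (2 * Real.pi * w * Ro ((x : dualLattice Q L) : V) z) : ℂ) := by
  have hcount := countable_dualLattice (L := L) hQ
  obtain ⟨r, hr, hR⟩ := exists_Ro_lower_bound hQ m μ z
  have hpi := Real.pi_pos
  have hs : Summable fun x : nonorthNorm L m μ z =>
      beta (2 * Real.pi * w * Ro ((x : dualLattice Q L) : V) z) := by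
    refine Summable.of_nonneg_of_le (fun x => beta_nonneg ?_) (fun x => ?_)
      ((summable_nonorthNorm hQ m μ z hw).mul_right (2 * Real.pi * w * r)⁻¹)
    · have := Ro_nonneg ((x : dualLattice Q L) : V) z
      positivity
    · have h1 := hR x.1 x.2
      have h2 := hr.trans_le h1
      refine (beta_le (by positivity)).trans ?_
      rw [div_eq_mul_inv]
      have h3 : -(2 * Real.pi * w * Ro ((x : dualLattice Q L) : V) z) =
        -2 * Real.pi * w * Ro ((x : dualLattice Q L) : V) z := by ring
      rw [h3]
      gcongr
  refine ⟨hs, ?_⟩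
  have hterm : ∀ x : nonorthNorm L m μ z, ∀ v : ℝ,
      (Real.exp (-2 * Real.pi * v * Ro ((x : dualLattice Q L) : V) z) : ℂ) / v =
      ((Real.exp (-(2 * Real.pi * Ro ((x : dualLattice Q L) : V) z) * v) / v : ℝ) : ℂ) := by
    intro x v
    have h1 : -2 * Real.pi * v * Ro ((x : dualLattice Q L) : V) z =
      -(2 * Real.pi * Ro ((x : dualLattice Q L) : V) z) * v := by ring
    rw [h1, Complex.ofReal_div]
  have hpos : ∀ x : nonorthNorm L m μ z, 0 < 2 * Real.pi * Ro ((x : dualLattice Q L) : V) z :=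
    fun x => by
      have := x.2.2
      positivity
  have hval : ∀ x : nonorthNorm L m μ z, ∫ v in Set.Ioi w,
      Real.exp (-(2 * Real.pi * Ro ((x : dualLattice Q L) : V) z) * v) / v =
      beta (2 * Real.pi * w * Ro ((x : dualLattice Q L) : V) z) := by
    intro x
    rw [integral_exp_div_eq_beta (hpos x)]
    congr 1
    ring
  have hint : ∀ x : nonorthNorm L m μ z, IntegrableOn (fun v : ℝ =>
      Real.exp (-(2 * Real.pi * Ro ((x : dualLattice Q L) : V) z) * v) / v) (Set.Ioi w) := by
    intro x
    refine (integrableOn_exp_mul_rpow hw (hpos x) (-1)).congr (.of_forall fun t => ?_)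
    simp only [Real.rpow_neg_one, div_eq_mul_inv]
  have h := hasSum_integral_of_summable_integral_norm (μ := volume.restrict (Set.Ioi w))
    (F := fun (x : nonorthNorm L m μ z) (v : ℝ) =>
      ((Real.exp (-(2 * Real.pi * Ro ((x : dualLattice Q L) : V) z) * v) / v : ℝ) : ℂ))
    (fun x => (hint x).ofReal) ?_
  · rw [← integral_congr_ae (.of_forall fun v => ?_), ← h.tsum_eq]
    · refine tsum_congr fun x => ?_
      rw [integral_complex_ofReal, hval]
    · simp only [decayCoeff, ← hterm]
      rw [tsum_div_const]
  · refine hs.congr fun x => ?_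
    rw [← hval]
    refine setIntegral_congr_fun measurableSet_Ioi fun v hv => ?_
    have hv0 : 0 < v := hw.trans hv
    rw [Complex.norm_real, Real.norm_eq_abs, abs_of_pos (by positivity)]

omit [FiniteDimensional ℚ V] in
lemma exists_int_of_isCongr (hL : IsEven Q L) {m : ℚ} {μ : Disc Q L} (h : IsCongr Q L m μ)
    {x : dualLattice Q L} (hx : toDisc Q L x = μ) : ∃ n : ℤ, Q (x : V) - m = n := by
  obtain ⟨y, n, hy, hm⟩ := h
  obtain ⟨l, hl⟩ := toDisc_eq_iff.1 (hx.trans hy.symm)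
  obtain ⟨k, hk⟩ := exists_int_bil y l
  obtain ⟨j, hj⟩ := hL l l.2
  refine ⟨k + j - n, ?_⟩
  have h2 := map_add_zsmul (Q := Q) (y : V) l 1
  rw [one_smul] at h2
  rw [hl, h2, hk, hj, hm]
  push_cast
  ring

lemma thetaTwist_term (m : ℚ) (z : SymSpace Q) (t : ℂ) (x : V) :
    Complex.exp (-2 * Real.pi * Complex.I * (m : ℂ) * t) * gaussTerm z t (toReal x) =
      Complex.exp (2 * Real.pi * Complex.I * (((Q x - m : ℚ) : ℝ) * t.re : ℝ)) *
        (Real.exp (-2 * Real.pi * t.im * ((Q x : ℝ) + Ro x z - m)) : ℝ) := by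
  rw [gaussTerm_eq, Complex.ofReal_exp, Complex.ofReal_exp, ← Complex.exp_add, ← Complex.exp_add,
    ← Complex.exp_add]
  congr 1
  conv_lhs =>
    enter [1]
    rw [← Complex.re_add_im t]
  push_cast
  linear_combination (-2 * Real.pi * m * t.im) * Complex.I_sq

lemma thetaTwist_eq (m : ℚ) (μ : Disc Q L) (z : SymSpace Q) (t : ℂ) :
    thetaTwist L m μ z t = t.im * ∑' x : dualLattice Q L, basisVec Q L μ (toDisc Q L x) *
      (Complex.exp (2 * Real.pi * Complex.I * (((Q (x : V) - m : ℚ) : ℝ) * t.re : ℝ)) *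
        (Real.exp (-2 * Real.pi * t.im * ((Q (x : V) : ℝ) + Ro (x : V) z - m)) : ℝ)) := by
  simp only [← thetaTwist_term, mul_left_comm (basisVec Q L μ _)]
  rw [tsum_mul_left, thetaTwist, mul_left_comm]

/-- Because `m ∈ Q(μ) + ℤ`, the characters in `u` have integral frequency `Q(x) - m`, and
orthogonality retains the vectors of norm `m`. Each leaves `exp(-2πvR)`, which is 1 for all `v`
exactly when `R = 0`; these vectors are counted by the constant. -/
lemma integral_thetaTwist (hQ : HasSignature Q p 2) [L.IsLattice ℚ] (hL : IsEven Q L) {m : ℚ}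
    {μ : Disc Q L} (hm : IsCongr Q L m μ) (z : SymSpace Q) {v : ℝ} (hv : 0 < v) :
    ∫ u in Set.Ioc (-1 / 2 : ℝ) (1 / 2), thetaTwist L m μ z (u + v * Complex.I) =
      v * ((orthNorm L m μ z).ncard + decayCoeff L m μ z v) := by
  classical
  have hcount := countable_dualLattice (L := L) hQ
  set I := Set.Ioc (-1 / 2 : ℝ) (1 / 2) with hI
  let E : dualLattice Q L → ℝ := fun x =>
    Real.exp (-2 * Real.pi * v * ((Q (x : V) : ℝ) + Ro (x : V) z - m))
  let F : dualLattice Q L → ℝ → ℂ := fun x u => basisVec Q L μ (toDisc Q L x) *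
    (Complex.exp (2 * Real.pi * Complex.I * (((Q (x : V) - m : ℚ) : ℝ) * u : ℝ)) * (E x : ℂ))
  have hE : Summable E := by
    refine ((summable_exp_majorant (L := L) hQ z hv).mul_left
      (Real.exp (2 * Real.pi * v * m))).congr fun x => ?_
    simp only [E]
    rw [← Real.exp_add]
    congr 1
    ring
  have hF : ∀ u : ℝ, thetaTwist L m μ z (u + v * Complex.I) = v * ∑' x, F x u := by
    intro u
    have hre : (u + v * Complex.I : ℂ).re = u := by simp
    have him : (u + v * Complex.I : ℂ).im = v := by simp
    rw [thetaTwist_eq, hre, him]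
  have hcexp : ∀ x : dualLattice Q L, Continuous (F x) := fun x => by
    simp only [F]
    fun_prop
  have hFn : ∀ x u, ‖F x u‖ ≤ E x := by
    intro x u
    have h1 : (2 * Real.pi * Complex.I * (((Q (x : V) - m : ℚ) : ℝ) * u : ℝ) : ℂ) =
        ((2 * Real.pi * (((Q (x : V) - m : ℚ) : ℝ) * u) : ℝ) : ℂ) * Complex.I := by
      push_cast
      ring
    simp only [F]
    rw [norm_mul, norm_mul, h1, Complex.norm_exp_ofReal_mul_I, one_mul, Complex.norm_real,
      Real.norm_eq_abs, Real.abs_exp, basisVec_apply]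
    split_ifs <;> simp [E, Real.exp_nonneg]
  have hint : ∀ x, IntegrableOn (F x) I := fun x =>
    ((hcexp x).integrableOn_Icc (a := -1 / 2) (b := 1 / 2)).mono_set Set.Ioc_subset_Icc_self
  have hvol : (volume.restrict I).real Set.univ = 1 := by
    simp [hI, Measure.real]
    norm_num
  have h := hasSum_integral_of_summable_integral_norm (μ := volume.restrict I) (F := F) hint ?_
  · simp only [hF]
    rw [integral_const_mul, ← h.tsum_eq]
    congr 1
    have hval : ∀ x, ∫ u in I, F x u = (cosetNorm L m μ).indicator
        (fun x => (Real.exp (-2 * Real.pi * v * Ro (x : V) z) : ℂ)) x := by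
      intro x
      simp only [F]
      rw [integral_const_mul, integral_mul_const, basisVec_apply]
      by_cases hx : toDisc Q L x = μ
      · obtain ⟨n, hn⟩ := exists_int_of_isCongr hL hm hx
        rw [if_pos hx, one_mul, hn]
        simp only [Rat.cast_intCast]
        rw [integral_exp_int]
        by_cases hx' : Q (x : V) = m
        · have hn0 : n = 0 := by
            have : (n : ℚ) = 0 := by rw [← hn, hx', sub_self]
            exact_mod_cast this
          rw [if_pos hn0, one_mul, Set.indicator_of_mem (show x ∈ cosetNorm L m μ from ⟨hx, hx'⟩)]
          simp only [E, hx']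
          congr 3
          ring
        · have hn0 : n ≠ 0 := by
            rintro rfl
            rw [Int.cast_zero, sub_eq_zero] at hn
            exact hx' hn
          rw [if_neg hn0, zero_mul, Set.indicator_of_notMem fun h => hx' h.2]
      · rw [if_neg hx, zero_mul, Set.indicator_of_notMem fun h => hx h.1]
    simp only [hval]
    rw [← tsum_subtype, cosetNorm_eq_union (z := z)]
    have hfin := finite_orthNorm hQ m μ z
    have := hfin.to_subtype
    have hs := summable_nonorthNorm hQ m μ z hv
    have hs0 : Summable fun x : orthNorm L m μ z =>
        (Real.exp (-2 * Real.pi * v * Ro ((x : dualLattice Q L) : V) z) : ℂ) := .of_finite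
    have hs1 : Summable fun x : nonorthNorm L m μ z =>
        (Real.exp (-2 * Real.pi * v * Ro ((x : dualLattice Q L) : V) z) : ℂ) :=
      Complex.summable_ofReal.2 hs
    rw [Summable.tsum_union_disjoint
      (f := fun x : dualLattice Q L => (Real.exp (-2 * Real.pi * v * Ro (x : V) z) : ℂ))
      disjoint_orthNorm hs0 hs1]
    congr 1
    have h1 : ∀ x : orthNorm L m μ z,
        (Real.exp (-2 * Real.pi * v * Ro ((x : dualLattice Q L) : V) z) : ℂ) = 1 := by
      intro x
      rw [x.2.2]
      simp
    rw [tsum_congr h1, tsum_const, Nat.card_coe_set_eq, nsmul_eq_mul, mul_one]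
  · refine Summable.of_nonneg_of_le (fun x => integral_nonneg fun u => norm_nonneg _)
      (fun x => ?_) hE
    calc ∫ u in I, ‖F x u‖ ≤ ∫ _ in I, E x := by
          refine integral_mono (hint x).norm (integrableOn_const ?_) fun u => hFn x u
          simp [hI]
      _ = E x := by rw [integral_const, hvol, one_smul]

/-- The theta function satisfies the hypotheses of the regularized unfolding. -/
lemma unfoldingData_thetaTwist (hQ : HasSignature Q p 2) [L.IsLattice ℚ] (hL : IsEven Q L) {m : ℚ}
    {μ : Disc Q L} (hm : IsCongr Q L m μ) (z : SymSpace Q) {w : ℝ} (hw : 0 < w) :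
    UnfoldingData (thetaTwist L m μ z) w (orthNorm L m μ z).ncard (decayCoeff L m μ z) where
  measurable := by
    have := countable_dualLattice (L := L) hQ
    have h1 : Measurable fun t : ℂ => ∑' x : dualLattice Q L, basisVec Q L μ (toDisc Q L x) *
      gaussTerm z t (toReal (x : V)) :=
      Measurable.tsum fun x => (measurable_gaussTerm z _).const_mul _
    unfold thetaTwist
    fun_prop
  periodic := by
    intro t
    have him : (t + 1).im = t.im := by simp
    rw [thetaTwist_eq, thetaTwist_eq, him]
    congr 1
    refine tsum_congr fun x => ?_
    rw [basisVec_apply]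
    split_ifs with hx
    · obtain ⟨n, hn⟩ := exists_int_of_isCongr hL hm hx
      rw [hn]
      congr 2
      rw [Complex.exp_eq_exp_iff_exists_int]
      refine ⟨n, ?_⟩
      simp only [Complex.add_re, Complex.one_re]
      push_cast
      ring
    · rw [zero_mul, zero_mul]
  pos := hw
  bounded := by
    intro B
    have hs := (summable_exp_majorant (L := L) hQ z hw).hasSum
    refine ⟨Real.exp (2 * Real.pi * |(m : ℝ)| * B) * (B * ∑' x : dualLattice Q L,
      Real.exp (-2 * Real.pi * w * ((Q (x : V) : ℝ) + Ro (x : V) z))), fun t _ ht => ?_⟩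
    have ht0 : 0 < t.im := hw.trans_le ht.1
    have hpi := Real.pi_pos
    rw [thetaTwist, norm_mul, norm_mul, Complex.norm_real, Real.norm_eq_abs, abs_of_pos ht0]
    refine mul_le_mul ?_ (mul_le_mul ht.2 ?_ (norm_nonneg _) (ht0.le.trans ht.2)) (by positivity)
      (Real.exp_nonneg _)
    · rw [Complex.norm_exp, Real.exp_le_exp]
      have h1 : (-2 * Real.pi * Complex.I * (m : ℂ) * t).re = 2 * Real.pi * (m : ℝ) * t.im := by
        have : (-2 * Real.pi * Complex.I * (m : ℂ) * t) =
            ((-2 * Real.pi * (m : ℝ) : ℝ) : ℂ) * (Complex.I * t) := by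
          push_cast
          ring
        rw [this, Complex.re_ofReal_mul, Complex.I_mul_re]
        ring
      rw [h1]
      have h2 := le_abs_self (m : ℝ)
      have h3 := ht.2
      have h4 : 0 ≤ |(m : ℝ)| := abs_nonneg _
      gcongr
    · refine tsum_of_norm_bounded hs fun x => ?_
      have h1 := add_Ro_nonneg hQ (x : V) z
      have h2 : ‖basisVec Q L μ (toDisc Q L x)‖ ≤ 1 := by
        rw [basisVec_apply]
        split_ifs <;> simp
      have h3 : ‖gaussTerm z t (toReal (x : V))‖ ≤
          Real.exp (-2 * Real.pi * w * ((Q (x : V) : ℝ) + Ro (x : V) z)) := by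
        rw [norm_gaussTerm, Real.exp_le_exp]
        have h4 := mul_nonneg (sub_nonneg.2 ht.1) h1
        nlinarith
      rw [norm_mul]
      calc _ ≤ 1 * _ := mul_le_mul h2 h3 (norm_nonneg _) zero_le_one
        _ = _ := one_mul _
  measurable_coeff := by
    have := countable_dualLattice (L := L) hQ
    refine Measurable.tsum fun x => ?_
    fun_prop
  integral_eq := fun v hv => integral_thetaTwist hQ hL hm z (hw.trans_le hv)
  decay := decayCoeff_bound hQ m μ z hw

end ThetaIntegrals

/-! ### The pairing of the Poincaré series with theta -/

section Pairing

variable {V : Type*} [AddCommGroup V] [Module ℚ V] [FiniteDimensional ℚ V]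
  {Q : QuadraticForm ℚ V} {L : Submodule ℤ V} {p : ℕ}

lemma siegelTheta_smul (τ : ℍ) (z : SymSpace Q) (c : ℂ) (φ : SchwartzL Q L) :
    siegelTheta L τ z (c • φ) = c * siegelTheta L τ z φ := by
  rw [siegelTheta_eq, siegelTheta_eq, mul_left_comm, ← tsum_mul_left (a := c)]
  congr 1
  refine tsum_congr fun x => ?_
  rw [Pi.smul_apply, smul_eq_mul, mul_assoc]

lemma thetaTwist_coe (m : ℚ) (μ : Disc Q L) (z : SymSpace Q) (τ : ℍ) :
    thetaTwist L m μ z τ = Complex.exp (-2 * Real.pi * Complex.I * (m : ℂ) * τ) *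
      siegelTheta L τ z (basisVec Q L μ) := rfl

/-- Pairing the Poincaré series with the theta function. -/
lemma thetaAt_poincare (hQ : HasSignature Q p 2) [L.IsLattice ℚ] (hL : IsEven Q L) {m : ℚ}
    {μ : Disc Q L} (hm : IsCongr Q L m μ) (z : SymSpace Q) {w : ℝ} (hw : 0 < w) (τ : ℍ) :
    thetaAt L z τ (poincare L p m w μ τ) =
      unfoldedSum (fun τ => cutoff w τ * thetaTwist L m μ z τ) τ := by
  have D := unfoldingData_thetaTwist hQ hL hm z hw
  rw [← unfoldedSum_eq_finsum hw D.apply_T_smul fun τ hτ => cutoff_mul_eq_zero hτ]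
  have hfin := finite_support_coset hw τ
  have h1 : (Function.support fun c : Quotient (QuotientGroup.rightRel Mp2Z.GammaInf) =>
      cutoff w (c.out.mat • τ) * thetaTwist L m μ z (c.out.mat • τ : ℍ)) ⊆ hfin.toFinset := by
    intro c hc
    rw [Set.Finite.coe_toFinset]
    by_contra h
    exact hc (cutoff_mul_eq_zero (not_le.1 h))
  rw [finsum_eq_sum_of_support_subset _ h1, thetaAt, poincare, truncPoincare, if_pos hm,
    siegelTheta_smul]
  set Fn : ℍ → SchwartzL Q L := fun t =>
    (cutoff w t * Complex.exp (-2 * Real.pi * Complex.I * (m : ℂ) * (t : ℂ))) •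
      basisVec Q L μ with hFn
  -- Only finitely many cosets reach height `w`, so the theta functional passes through a finite
  -- sum.
  have h2 : (Function.support fun c : Quotient (QuotientGroup.rightRel Mp2Z.GammaInf) =>
      slash Q L ((p : ℤ) - 2) (2 - (p : ℤ)) c.out Fn τ) ⊆ hfin.toFinset := by
    intro c hc
    rw [Set.Finite.coe_toFinset]
    by_contra h
    refine hc ?_
    have h3 : Fn (c.out.mat • τ) = 0 := by
      have h4 : ¬ w ≤ (c.out.mat • τ).im := h
      simp only [hFn, cutoff, if_neg h4, zero_mul, zero_smul]
    funext ν
    simp only [slash, weilRep, h3, Pi.smul_apply, Pi.zero_apply, mul_zero, finsum_zero, smul_zero]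
  rw [finsum_eq_sum_of_support_subset _ h2]
  have h3 := siegelTheta_sum hQ hL τ z hfin.toFinset (fun _ => 1)
    (fun c => slash Q L ((p : ℤ) - 2) (2 - (p : ℤ)) c.out Fn τ)
  simp only [one_smul, one_mul] at h3
  rw [h3]
  congr 1
  refine Finset.sum_congr rfl fun c _ => ?_
  rw [siegelTheta_slash hQ hL, hFn, siegelTheta_smul, thetaTwist_coe, mul_assoc]

omit [FiniteDimensional ℚ V] in
lemma cosetNorm_eq_empty {m : ℚ} {μ : Disc Q L} (hm : ¬ IsCongr Q L m μ) :
    cosetNorm L m μ = ∅ := by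
  refine Set.eq_empty_of_forall_notMem fun x hx => hm ⟨x, 0, hx.1, ?_⟩
  rw [hx.2, Int.cast_zero, add_zero]

/-- The value of the regularized pairing. -/
theorem hasRegularizedIntegral_pairing (hQ : HasSignature Q p 2) [L.IsLattice ℚ] (hL : IsEven Q L)
    (m : ℚ) (μ : Disc Q L) (z : SymSpace Q) {w : ℝ} (hw : 0 < w) :
    HasRegularizedIntegral (fun τ => thetaAt L z τ (poincare L p m w μ τ))
      ((∑' x : nonorthNorm L m μ z,
        (beta (2 * Real.pi * w * Ro ((x : dualLattice Q L) : V) z) : ℂ)) -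
          (orthNorm L m μ z).ncard * Real.log w) := by
  by_cases hm : IsCongr Q L m μ
  · rw [← (integral_decayCoeff hQ m μ z hw).2]
    have h := (unfoldingData_thetaTwist hQ hL hm z hw).hasRegularizedIntegral
    have h1 : (fun τ => thetaAt L z τ (poincare L p m w μ τ)) =
        unfoldedSum fun τ => cutoff w τ * thetaTwist L m μ z τ :=
      funext fun τ => thetaAt_poincare hQ hL hm z hw τ
    rw [h1]
    exact h
  -- The Poincaré series is zero by definition here, and no vector of the coset has norm `m`; both
  -- sides vanish.
  · have h0 := cosetNorm_eq_empty hm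
    have h1 : nonorthNorm L m μ z = ∅ := by simp [nonorthNorm, h0]
    have h2 : orthNorm L m μ z = ∅ := by simp [orthNorm, h0]
    have h3 : (fun τ => thetaAt L z τ (poincare L p m w μ τ)) = fun _ => 0 := by
      funext τ
      simp [thetaAt, poincare, truncPoincare, if_neg hm, siegelTheta_eq]
    rw [h3, h1, h2]
    simpa using hasRegularizedIntegral_zero

end Pairing

/-! ### Comparison with Kudla's Green function -/

section GreenFunction

variable {V : Type*} [AddCommGroup V] [Module ℚ V] [FiniteDimensional ℚ V]
  {Q : QuadraticForm ℚ V} {L : Submodule ℤ V} {p : ℕ}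

lemma toReal_eq_zero (hQ : HasSignature Q p 2) {x : V} (h : toReal x = 0) : x = 0 := by
  refine (polarBilin_nondegenerate hQ).1 x fun y => ?_
  have h1 := polar_toReal (Q := Q) x y
  rw [h, QuadraticMap.polar_zero_left] at h1
  exact_mod_cast h1.symm

/-- `R(x, z) = 0` if and only if `x` is orthogonal to `z`. -/
lemma Ro_eq_zero_iff_orthogonal (x : V) (z : SymSpace Q) :
    Ro x z = 0 ↔ ∀ y ∈ z.plane, QuadraticMap.polarBilin (realForm Q) (toReal x) y = 0 := by
  have hsymm : ∀ y, QuadraticMap.polarBilin (realForm Q) (toReal x) y =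
      QuadraticMap.polarBilin (realForm Q) y (toReal x) := fun y =>
    QuadraticMap.polar_comm (realForm Q) _ _
  rw [Ro_eq_zero_iff]
  constructor
  · intro h y hy
    have h1 := sub_proj_mem z (toReal x) y hy
    rw [h, sub_zero] at h1
    rw [hsymm]
    exact h1
  · intro h
    refine proj_eq_of_mem z (Submodule.zero_mem _) ?_
    intro y hy
    rw [sub_zero]
    exact (hsymm y).symm.trans (h y hy)

/-- `R(x, z) = 0` puts `x` into `z^⊥`, which is positive definite. For `m ≠ 0` this identifies the
vectors counted by `N` with those defining the cycle; for `m = 0` it leaves only the zero vector. -/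
lemma pos_of_Ro_eq_zero (hQ : HasSignature Q p 2) {x : V} (hx : x ≠ 0) {z : SymSpace Q}
    (h : Ro x z = 0) : 0 < Q x := by
  have h1 := sub_proj_mem z (toReal x)
  rw [(Ro_eq_zero_iff x z).1 h, sub_zero] at h1
  have h2 := pos_of_mem_orthogonal hQ z h1 fun h => hx (toReal_eq_zero hQ h)
  rw [realForm_toReal] at h2
  exact_mod_cast h2

lemma Ro_zero (z : SymSpace Q) : Ro (0 : V) z = 0 := by
  rw [Ro_eq_zero_iff_orthogonal]
  intro y _
  simp [toReal]

lemma mem_specialCycle_of_mem_orthNorm (hQ : HasSignature Q p 2) {m : ℚ} (hm : m ≠ 0)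
    {μ : Disc Q L} {z : SymSpace Q} {x : dualLattice Q L} (hx : x ∈ orthNorm L m μ z) :
    z ∈ specialCycle L m μ := by
  have hx0 : (x : V) ≠ 0 := by
    intro h
    have := hx.1.2
    rw [h, QuadraticMap.map_zero] at this
    exact hm this.symm
  exact ⟨x, hx.1.1, hx.1.2, pos_of_Ro_eq_zero hQ hx0 hx.2,
    (Ro_eq_zero_iff_orthogonal _ _).1 hx.2⟩

lemma eq_zero_of_mem_orthNorm_zero (hQ : HasSignature Q p 2) {μ : Disc Q L} {z : SymSpace Q}
    {x : dualLattice Q L} (hx : x ∈ orthNorm L 0 μ z) : x = 0 := by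
  by_contra h
  have h1 := pos_of_Ro_eq_zero hQ (fun h0 => h (Subtype.ext h0)) hx.2
  rw [hx.1.2] at h1
  exact lt_irrefl _ h1

/-- The zero vector is orthogonal to every plane and lies in the trivial coset. It is absent from
Kudla's series but present in theta, and so is the source of the `log w` correction. -/
lemma ncard_orthNorm_zero (hQ : HasSignature Q p 2) (μ : Disc Q L) (z : SymSpace Q) [Decidable (μ = 0)] :
    (orthNorm L 0 μ z).ncard = if μ = 0 then 1 else 0 := by
  split_ifs with h
  · rw [Set.ncard_eq_one]
    refine ⟨0, Set.eq_singleton_iff_unique_mem.2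
      ⟨⟨⟨h.symm, by simp⟩, Ro_zero z⟩, fun x hx => eq_zero_of_mem_orthNorm_zero hQ hx⟩⟩
  · have : orthNorm L 0 μ z = ∅ := by
      refine Set.eq_empty_of_forall_notMem fun x hx => h ?_
      have h1 := hx.1.1
      rw [eq_zero_of_mem_orthNorm_zero hQ hx] at h1
      exact h1.symm
    rw [this, Set.ncard_empty]

/-- Kudla's Green function as a sum over the vectors that are not orthogonal to `z`. -/
lemma hasSum_greenTerm (hQ : HasSignature Q p 2) [L.IsLattice ℚ] (m : ℚ) (μ : Disc Q L)
    (z : SymSpace Q) {w : ℝ} (hw : 0 < w) (h0 : ∀ x ∈ orthNorm L m μ z, x = 0) :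
    HasSum (fun x : GreenIndex Q L m => greenTerm L w (basisVec Q L μ) z x.1)
      (∑' x : nonorthNorm L m μ z,
        (beta (2 * Real.pi * w * Ro ((x : dualLattice Q L) : V) z) : ℂ)) := by
  have hs := Complex.summable_ofReal.2 (integral_decayCoeff hQ m μ z hw).1
  let i : nonorthNorm L m μ z → GreenIndex Q L m := fun x => ⟨x.1, x.2.1.2, by
    intro h
    have h1 := x.2.2
    rw [h] at h1
    exact h1.ne' (Ro_zero z)⟩
  have hi : Function.Injective i := fun x y h => Subtype.ext (congrArg (fun y : GreenIndex Q L m => y.1) h)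
  rw [← hi.hasSum_iff]
  · have h1 : (fun x : GreenIndex Q L m => greenTerm L w (basisVec Q L μ) z x.1) ∘ i =
        fun x : nonorthNorm L m μ z => (beta (2 * Real.pi * w * Ro ((x : dualLattice Q L) : V) z) : ℂ) := by
      funext x
      have hx : toDisc Q L (x : dualLattice Q L) = μ := x.2.1.1
      simp only [Function.comp, i, greenTerm]
      rw [basisVec_apply, if_pos hx, one_mul]
    rw [h1]
    exact hs.hasSum
  · intro x hx
    rw [greenTerm, basisVec_apply]
    split_ifs with hμ
    · exfalso
      have hx1 : x.1 ∈ cosetNorm L m μ := ⟨hμ, x.2.1⟩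
      rw [cosetNorm_eq_union (z := z)] at hx1
      rcases hx1 with h | h
      · exact x.2.2 (h0 _ h)
      · exact hx ⟨⟨x.1, h⟩, rfl⟩
    · rw [zero_mul]

end GreenFunction

section VectorValued

variable {V : Type*} [AddCommGroup V] [Module ℚ V] [FiniteDimensional ℚ V]
  {Q : QuadraticForm ℚ V} {L : Submodule ℤ V} {p : ℕ}

lemma hasSum_greenTerm_of_basisVec [Fintype (Disc Q L)] {m : ℚ} {w : ℝ} {z : SymSpace Q}
    (φ : SchwartzL Q L) (g : Disc Q L → ℂ)
    (h : ∀ μ, HasSum (fun x : GreenIndex Q L m => greenTerm L w (basisVec Q L μ) z x.1) (g μ)) :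
    HasSum (fun x : GreenIndex Q L m => greenTerm L w φ z x.1) (∑ μ, φ μ * g μ) := by
  classical
  convert! hasSum_sum fun μ (_ : μ ∈ Finset.univ) => (h μ).mul_left (φ μ) using 2 with x
  simp only [greenTerm, basisVec_apply, ite_mul, one_mul, zero_mul, mul_ite, mul_zero,
    Finset.sum_ite_eq, Finset.mem_univ, if_true]

lemma hasRegularizedIntegral_pairing_vec (hQ : HasSignature Q p 2) [L.IsLattice ℚ]
    (hL : IsEven Q L) [Fintype (Disc Q L)] (m : ℚ) (φ : SchwartzL Q L) (z : SymSpace Q) {w : ℝ}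
    (hw : 0 < w) :
    HasRegularizedIntegral (fun τ => thetaAt L z τ (poincareVec L p m w φ τ))
      (∑ μ, φ μ * ((∑' x : nonorthNorm L m μ z,
        (beta (2 * Real.pi * w * Ro ((x : dualLattice Q L) : V) z) : ℂ)) -
          (orthNorm L m μ z).ncard * Real.log w)) := by
  have h := hasRegularizedIntegral_sum Finset.univ
    (fun μ τ => thetaAt L z τ (poincare L p m w μ τ)) _ φ
    fun μ _ => hasRegularizedIntegral_pairing hQ hL m μ z hw
  convert! h using 2 with τ
  rw [poincareVec, truncPoincareVec, finsum_eq_sum_of_fintype, thetaAt, siegelTheta_sum hQ hL]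
  rfl

end VectorValued

/-! ### Discontinuity along the special cycle -/

section Discontinuity

open Module

variable {V : Type*} [AddCommGroup V] [Module ℚ V] [FiniteDimensional ℚ V]
  {Q : QuadraticForm ℚ V} {L : Submodule ℤ V} {p : ℕ}

/-- On `(r, 1]` the integrand is at least `e⁻¹/t`, which exhibits the logarithmic singularity of `β`
at 0. -/
lemma le_beta {r : ℝ} (hr : 0 < r) (hr1 : r ≤ 1) : -(Real.exp (-1) * Real.log r) ≤ beta r := by
  have h1 : ∫ t in Set.Ioc r 1, Real.exp (-1) * t⁻¹ = -(Real.exp (-1) * Real.log r) := by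
    rw [← intervalIntegral.integral_of_le hr1, intervalIntegral.integral_const_mul,
      integral_inv_of_pos hr one_pos, Real.log_div one_ne_zero hr.ne', Real.log_one, zero_sub,
      mul_neg]
  have h2 := integrableOn_exp_div hr
  have h3 : IntegrableOn (fun t : ℝ => Real.exp (-1) * t⁻¹) (Set.Ioc r 1) := by
    refine (ContinuousOn.integrableOn_Icc ?_).mono_set Set.Ioc_subset_Icc_self
    exact continuousOn_const.mul (continuousOn_id.inv₀ fun v hv => (hr.trans_le hv.1).ne')
  rw [← h1, beta]
  refine (setIntegral_mono_on h3 (h2.mono_set Set.Ioc_subset_Ioi_self) measurableSet_Ioc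
    fun t ht => ?_).trans (setIntegral_mono_set h2 ?_ Set.Ioc_subset_Ioi_self.eventuallyLE)
  · have ht0 : 0 < t := hr.trans ht.1
    have := ht.2
    rw [div_eq_mul_inv]
    gcongr
  · filter_upwards [ae_restrict_mem measurableSet_Ioi] with t ht
    exact div_nonneg (Real.exp_pos _).le (hr.trans ht).le

lemma tendsto_beta : Tendsto beta (𝓝[>] 0) atTop := by
  have h : Tendsto (fun r => -(Real.exp (-1) * Real.log r)) (𝓝[>] 0) atTop :=
    tendsto_neg_atBot_atTop.comp (Real.tendsto_log_nhdsGT_zero.const_mul_atBot (Real.exp_pos _))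
  refine tendsto_atTop_mono' _ ?_ h
  filter_upwards [Ioc_mem_nhdsGT one_pos] with r hr using le_beta hr.1 hr.2

omit [FiniteDimensional ℚ V] in
lemma NegFrame.toSymSpace_eq (e : NegFrame Q) (z : SymSpace Q) (b : Basis (Fin 2) ℝ z.plane)
    (hb : ∀ i, (b i : RealSpace V) = e.1 i) (ho : b.orientation = z.orient) :
    e.toSymSpace = z := by
  obtain ⟨P, hf, hn, o⟩ := z
  have hP : Submodule.span ℝ (Set.range e.1) = P := by
    have h1 : e.1 = P.subtype ∘ b := funext fun i => (hb i).symm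
    rw [h1, Set.range_comp, Submodule.span_image]
    change Submodule.map _ (Submodule.span ℝ (Set.range b)) = P
    rw [b.span_eq, Submodule.map_subtype_top]
  subst hP
  have h1 : b = Basis.span e.2.1 := by
    refine Basis.eq_of_apply_eq fun i => Subtype.ext ?_
    rw [hb, Basis.span_apply]
  rw [NegFrame.toSymSpace]
  rw [h1] at ho
  congr 1

/-- An oriented orthogonal basis of a negative definite plane. -/
lemma exists_oriented_basis (z : SymSpace Q) : ∃ b : Basis (Fin 2) ℝ z.plane,
    b.orientation = z.orient ∧ ∀ s t : ℝ,
      realForm Q (s • (b 0 : RealSpace V) + t • (b 1 : RealSpace V)) = -(s ^ 2 + t ^ 2) / 2 := by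
  classical
  obtain ⟨b₀, h₀⟩ := exists_basis_of_posDef ((-realForm Q).restrict z.plane) (by
    rintro ⟨x, hx⟩ hne
    have := z.neg_def x hx (by simpa using hne)
    simpa [QuadraticMap.restrict_apply] using this)
  let b₁ : Basis (Fin 2) ℝ z.plane := b₀.reindex (finCongr z.finrank_plane)
  have h₁ : ∀ s t : ℝ, realForm Q (s • (b₁ 0 : RealSpace V) + t • (b₁ 1 : RealSpace V)) =
      -(s ^ 2 + t ^ 2) / 2 := by
    intro s t
    have h2 := h₀ (s • b₁ 0 + t • b₁ 1)
    rw [QuadraticMap.restrict_apply, neg_apply] at h2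
    have h3 : ∑ i, (b₀.repr (s • b₁ 0 + t • b₁ 1) i) ^ 2 = s ^ 2 + t ^ 2 := by
      rw [← (finCongr z.finrank_plane).symm.sum_comp]
      have h4 : ∀ i, b₀.repr (s • b₁ 0 + t • b₁ 1) ((finCongr z.finrank_plane).symm i) =
          b₁.repr (s • b₁ 0 + t • b₁ 1) i := fun i => by
        rw [Basis.repr_reindex_apply]
      simp only [h4, Fin.sum_univ_two]
      simp
    rw [h3] at h2
    have h5 : ((s • b₁ 0 + t • b₁ 1 : z.plane) : RealSpace V) =
      s • (b₁ 0 : RealSpace V) + t • (b₁ 1 : RealSpace V) := rfl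
    rw [h5] at h2
    linarith
  refine ⟨b₁.adjustToOrientation z.orient, b₁.orientation_adjustToOrientation z.orient,
    fun s t => ?_⟩
  have h2 : ∀ i, ∃ ε : ℝ, ε ^ 2 = 1 ∧
      ((b₁.adjustToOrientation z.orient i : z.plane) : RealSpace V) = ε • (b₁ i : RealSpace V) := by
    intro i
    rcases b₁.adjustToOrientation_apply_eq_or_eq_neg z.orient i with h | h
    · exact ⟨1, by norm_num, by rw [h, one_smul]⟩
    · exact ⟨-1, by norm_num, by rw [h, neg_one_smul]; rfl⟩
  obtain ⟨ε₀, hε₀, h3⟩ := h2 0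
  obtain ⟨ε₁, hε₁, h4⟩ := h2 1
  rw [h3, h4, smul_smul, smul_smul, h₁, mul_pow, mul_pow, hε₀, hε₁, mul_one, mul_one]

/-- Moving a plane `z` orthogonal to `x` in the direction of `x`. -/
lemma exists_path (z : SymSpace Q) {x : V} (hx : 0 < Q x)
    (hz : ∀ y ∈ z.plane, QuadraticMap.polarBilin (realForm Q) (toReal x) y = 0) :
    ∃ c : ℝ → SymSpace Q, Continuous c ∧ c 0 = z ∧
      (∀ t, Ro x (c t) = 4 * t ^ 2 * (Q x : ℝ) ^ 2 / (1 + (Q x : ℝ) ^ 2 * t ^ 4)) ∧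
      ∀ x' : V, Ro x' z ≠ 0 → {t | Ro x' (c t) = 0}.Finite := by
  obtain ⟨b, ho, hb⟩ := exists_oriented_basis z
  set e₀ : RealSpace V := ((b 0 : z.plane) : RealSpace V) with he₀
  set e₁ : RealSpace V := ((b 1 : z.plane) : RealSpace V) with he₁
  set X : RealSpace V := toReal x with hX
  set m : ℝ := (Q x : ℝ) with hm
  have hm0 : 0 < m := by
    rw [hm]
    exact_mod_cast hx
  have hQX : realForm Q X = m := realForm_toReal Q x
  have hXe : ∀ s t : ℝ, QuadraticMap.polar (realForm Q) X (s • e₀ + t • e₁) = 0 := fun s t =>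
    hz _ (z.plane.add_mem (z.plane.smul_mem _ (b 0).2) (z.plane.smul_mem _ (b 1).2))
  have hQ3 : ∀ r s t : ℝ, realForm Q (r • X + (s • e₀ + t • e₁)) =
      r ^ 2 * m - (s ^ 2 + t ^ 2) / 2 := by
    intro r s t
    rw [QuadraticMap.map_add (realForm Q), QuadraticMap.map_smul (realForm Q),
      QuadraticMap.polar_smul_left, hXe, hb, hQX]
    simp only [smul_eq_mul]
    ring
  -- The factor `1 + mt²` keeps the first vector negative for all `t`: `mt² - (1 + mt²)²/2 = -(1 +
  -- m²t⁴)/2`. The path is therefore polynomial and defined on all of `ℝ`.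
  let e : ℝ → Fin 2 → RealSpace V := fun t => ![(1 + m * t ^ 2) • e₀ + t • X, e₁]
  have hcomb : ∀ t s r : ℝ, s • e t 0 + r • e t 1 =
      (s * t) • X + ((s * (1 + m * t ^ 2)) • e₀ + r • e₁) := by
    intro t s r
    simp only [e, Matrix.cons_val_zero, Matrix.cons_val_one]
    module
  have hQe : ∀ t s r : ℝ, realForm Q (s • e t 0 + r • e t 1) =
      -(s ^ 2 * (1 + m ^ 2 * t ^ 4) + r ^ 2) / 2 := by
    intro t s r
    rw [hcomb, hQ3]
    ring
  have hneg : ∀ t s r : ℝ, s ≠ 0 ∨ r ≠ 0 → realForm Q (s • e t 0 + r • e t 1) < 0 := by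
    intro t s r h
    rw [hQe]
    have h1 : 0 < 1 + m ^ 2 * t ^ 4 := by positivity
    rcases h with h | h <;> have := sq_pos_of_ne_zero h <;>
      nlinarith [mul_nonneg (sq_nonneg s) h1.le, sq_nonneg r, mul_pos this h1]
  have hli : ∀ t, LinearIndependent ℝ (e t) := by
    intro t
    have h1 : e t = ![e t 0, e t 1] := by
      ext i
      fin_cases i <;> rfl
    rw [h1, LinearIndependent.pair_iff]
    intro s r h
    by_contra hcon
    have h2 := hneg t s r (by
      by_contra h3
      push Not at h3
      exact hcon h3)
    rw [h, QuadraticMap.map_zero] at h2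
    exact lt_irrefl _ h2
  have hspan : ∀ t, ∀ y ∈ Submodule.span ℝ (Set.range (e t)), ∃ s r : ℝ,
      y = s • e t 0 + r • e t 1 := by
    intro t y hy
    rw [Submodule.mem_span_range_iff_exists_fun] at hy
    obtain ⟨f, hf⟩ := hy
    exact ⟨f 0, f 1, by rw [← hf, Fin.sum_univ_two]⟩
  have hnd : ∀ t, ∀ y ∈ Submodule.span ℝ (Set.range (e t)), y ≠ 0 → realForm Q y < 0 := by
    intro t y hy hy0
    obtain ⟨s, r, rfl⟩ := hspan t y hy
    refine hneg t s r ?_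
    by_contra h
    push Not at h
    rw [h.1, h.2, zero_smul, zero_smul, add_zero] at hy0
    exact hy0 rfl
  let fr : ℝ → NegFrame Q := fun t => ⟨e t, hli t, hnd t⟩
  have hmem : ∀ t i, e t i ∈ (fr t).toSymSpace.plane := fun t i =>
    Submodule.subset_span ⟨i, rfl⟩
  have horth : ∀ t (y : V), Ro y (fr t).toSymSpace = 0 ↔
      QuadraticMap.polar (realForm Q) (toReal y) (e t 0) = 0 ∧
      QuadraticMap.polar (realForm Q) (toReal y) (e t 1) = 0 := by
    intro t y
    rw [Ro_eq_zero_iff_orthogonal]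
    constructor
    · intro h
      exact ⟨h _ (hmem t 0), h _ (hmem t 1)⟩
    · rintro ⟨h1, h2⟩ u hu
      obtain ⟨s, r, rfl⟩ := hspan t u hu
      rw [QuadraticMap.polarBilin_apply_apply, QuadraticMap.polar_add_right,
        QuadraticMap.polar_smul_right, QuadraticMap.polar_smul_right, h1, h2]
      simp
  have h0 : (fr 0).toSymSpace = z := by
    refine NegFrame.toSymSpace_eq (fr 0) z b (fun i => ?_) ho
    fin_cases i
    · simp [fr, e, he₀]
    · simp [fr, e, he₁]
  refine ⟨fun t => (fr t).toSymSpace, ?_, h0, ?_, ?_⟩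
  · have hcont : Continuous (NegFrame.toSymSpace : NegFrame Q → SymSpace Q) :=
      continuous_coinduced_rng
    refine hcont.comp ?_
    let : TopologicalSpace (RealSpace V) := moduleTopology ℝ (RealSpace V)
    have : ContinuousAdd (RealSpace V) := ModuleTopology.continuousAdd ℝ (RealSpace V)
    have : ContinuousSMul ℝ (RealSpace V) := ModuleTopology.continuousSMul ℝ (RealSpace V)
    refine Continuous.subtype_mk ?_ _
    refine continuous_pi fun i => ?_
    fin_cases i
    · change Continuous fun t : ℝ => (1 + m * t ^ 2) • e₀ + t • X
      fun_prop
    · exact continuous_const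
  · intro t
    set D : ℝ := 1 + m ^ 2 * t ^ 4 with hD
    have hD0 : 0 < D := by positivity
    -- `X` pairs with the first frame vector to `2tm`, with the second to 0, and the first pairs
    -- with itself to `-D`; the quotient is the projection coefficient.
    set c : ℝ := -(2 * t * m) / D with hc
    have hproj : proj (fr t).toSymSpace X = c • e t 0 := by
      refine proj_eq_of_mem _ (Submodule.smul_mem _ _ (hmem t 0)) ?_
      intro u hu
      obtain ⟨s, r, rfl⟩ := hspan t u hu
      change QuadraticMap.polar (realForm Q) (s • e t 0 + r • e t 1) (X - c • e t 0) = 0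
      have h1 : X - c • e t 0 = (1 - c * t) • X + ((-(c * (1 + m * t ^ 2))) • e₀ + (0 : ℝ) • e₁) := by
        simp only [e, Matrix.cons_val_zero]
        module
      have h2 : s • e t 0 + r • e t 1 + (X - c • e t 0) = (s * t + (1 - c * t)) • X +
          ((s * (1 + m * t ^ 2) + -(c * (1 + m * t ^ 2))) • e₀ + r • e₁) := by
        rw [hcomb, h1]
        module
      rw [QuadraticMap.polar, h2, h1, hcomb, hQ3, hQ3, hQ3]
      have h3 : c * D = -(2 * t * m) := div_mul_cancel₀ _ hD0.ne'
      rw [hD] at h3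
      linear_combination s * h3
    rw [Ro, ← hX, hproj, QuadraticMap.map_smul (realForm Q)]
    have h1 := hQe t 1 0
    rw [one_smul, zero_smul, add_zero, ← hD] at h1
    rw [h1, hc]
    simp only [smul_eq_mul]
    field_simp
    ring
  · intro x' hx'
    rw [← h0, Ne, horth] at hx'
    set P : ℝ := QuadraticMap.polar (realForm Q) (toReal x') e₀ with hP
    set q : ℝ := QuadraticMap.polar (realForm Q) (toReal x') X with hq
    -- Orthogonality of `x'` to the moving plane amounts to this polynomial in `t` and a condition
    -- independent of `t`. If it fails at `t = 0`, either the constant condition fails or the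
    -- polynomial has constant term `P ≠ 0`, hence finitely many roots.
    have hpol : ∀ t, QuadraticMap.polar (realForm Q) (toReal x') (e t 0) =
        P + q * t + P * m * t ^ 2 := by
      intro t
      simp only [e, Matrix.cons_val_zero]
      rw [QuadraticMap.polar_add_right, QuadraticMap.polar_smul_right,
        QuadraticMap.polar_smul_right, ← hP, ← hq]
      simp only [smul_eq_mul]
      ring
    have he1 : ∀ t, e t 1 = e₁ := fun t => rfl
    rw [hpol] at hx'
    simp only [horth, hpol, he1] at hx' ⊢
    by_cases h1 : QuadraticMap.polar (realForm Q) (toReal x') e₁ = 0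
    · have hP0 : P ≠ 0 := fun h => hx' ⟨by simp [h], h1⟩
      have h2 : (Polynomial.C P + Polynomial.C q * Polynomial.X +
          Polynomial.C (P * m) * Polynomial.X ^ 2 : Polynomial ℝ) ≠ 0 := by
        intro h
        have := congrArg (Polynomial.eval 0) h
        simp at this
        exact hP0 this
      refine (Polynomial.finite_setOfPred_isRoot h2).subset fun t ht => ?_
      simp only [Set.mem_ofPred_eq, Polynomial.IsRoot, Polynomial.eval_add, Polynomial.eval_mul,
        Polynomial.eval_C, Polynomial.eval_X, Polynomial.eval_pow]
      exact ht.1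
    · simp [h1]

/-- The regularized pairing is discontinuous along the special cycle. -/
theorem not_continuousAt_regPairing (hQ : HasSignature Q p 2) [L.IsLattice ℚ] (hL : IsEven Q L)
    (m : ℚ) (μ : Disc Q L) {w : ℝ} (hw : 0 < w) {z : SymSpace Q} (hz : z ∈ specialCycle L m μ) :
    ¬ ContinuousAt (fun z' : SymSpace Q => regPairing (poincare L p m w μ) (thetaAt L z')) z := by
  intro hcont
  obtain ⟨x, hxμ, hxm, hx, hxz⟩ := hz
  obtain ⟨c, hc, hc0, hR, hfin⟩ := exists_path z hx hxz
  have hcount := countable_dualLattice (L := L) hQ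
  -- Parameters at which some lattice vector not orthogonal to `z` becomes orthogonal to the moved
  -- plane. They form a countable set; off it the count `N` cannot exceed its value at `z`, which
  -- controls the term `-N log w` even if `log w > 0`.
  set bad : Set ℝ := ⋃ y ∈ {y : dualLattice Q L | Ro (y : V) z ≠ 0}, {t | Ro (y : V) (c t) = 0}
    with hbad
  have hbadc : bad.Countable :=
    (Set.to_countable _).biUnion fun y hy => (hfin y hy).countable
  set F : SymSpace Q → ℂ := fun z' => regPairing (poincare L p m w μ) (thetaAt L z') with hF
  set S : SymSpace Q → ℝ := fun z' => ∑' y : nonorthNorm L m μ z',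
    beta (2 * Real.pi * w * Ro ((y : dualLattice Q L) : V) z') with hS
  have hFS : ∀ z', F z' = ((S z' - (orthNorm L m μ z').ncard * Real.log w : ℝ) : ℂ) := by
    intro z'
    simp only [hF, hS]
    rw [regPairing_eq (hasRegularizedIntegral_pairing hQ hL m μ z' hw)]
    push_cast
    rfl
  have hQ0 : 0 < (Q (x : V) : ℝ) := by exact_mod_cast hx
  have hpi := Real.pi_pos
  have hRt : Tendsto (fun t => 2 * Real.pi * w * Ro (x : V) (c t)) (𝓝[>] 0) (𝓝[>] 0) := by
    refine tendsto_nhdsWithin_iff.2 ⟨?_, ?_⟩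
    · have h1 : Continuous fun t => 2 * Real.pi * w * Ro (x : V) (c t) := by
        simp only [hR]
        refine continuous_const.mul (Continuous.div (by fun_prop) (by fun_prop) fun t => ?_)
        positivity
      have h2 := h1.tendsto 0
      rw [hR] at h2
      simp only [ne_eq, OfNat.ofNat_ne_zero, not_false_eq_true, zero_pow, mul_zero, zero_mul,
        zero_div] at h2
      exact h2.mono_left inf_le_left
    · filter_upwards [self_mem_nhdsWithin] with t ht
      have ht' : 0 < t := ht
      rw [hR]
      rw [Set.mem_Ioi]
      positivity
  -- The threshold is the bound that continuity would impose on the value near `z`, plus the largest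
  -- possible size of `N log w`.
  have h1 := (tendsto_beta.comp hRt).eventually_gt_atTop
    (‖F z‖ + 1 + (orthNorm L m μ z).ncard * |Real.log w|)
  have h2 : ∀ᶠ t in 𝓝[>] (0 : ℝ), ‖F (c t)‖ < ‖F z‖ + 1 := by
    have h3 : ContinuousAt F (c 0) := by rw [hc0]; exact hcont
    have h4 := (h3.comp hc.continuousAt).norm.tendsto
    simp only [Function.comp, hc0] at h4
    exact (h4.eventually_lt_const (lt_add_one _)).filter_mono inf_le_left
  obtain ⟨δ, hδ, hsub⟩ := (mem_nhdsGT_iff_exists_Ioo_subset).1 (h1.and h2)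
  -- The complement of a countable set of reals is dense, so a good parameter exists in every
  -- interval `(0, δ)`.
  obtain ⟨t, htδ, htbad⟩ := (hbadc.dense_compl ℝ).inter_open_nonempty (Set.Ioo 0 δ) isOpen_Ioo
    (Set.nonempty_Ioo.2 hδ)
  obtain ⟨h5, h6⟩ := hsub htδ
  have hsubset : orthNorm L m μ (c t) ⊆ orthNorm L m μ z := by
    rintro y ⟨hy, hy'⟩
    refine ⟨hy, ?_⟩
    by_contra hne
    exact htbad (Set.mem_biUnion (show y ∈ {y : dualLattice Q L | Ro (y : V) z ≠ 0} from hne) hy')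
  have hcard : ((orthNorm L m μ (c t)).ncard : ℝ) ≤ (orthNorm L m μ z).ncard := by
    exact_mod_cast Set.ncard_le_ncard hsubset (finite_orthNorm hQ m μ z)
  have hxt : x ∈ nonorthNorm L m μ (c t) := by
    refine ⟨⟨hxμ, hxm⟩, ?_⟩
    rw [hR]
    have := htδ.1
    positivity
  have hS1 : beta (2 * Real.pi * w * Ro (x : V) (c t)) ≤ S (c t) := by
    refine (integral_decayCoeff hQ m μ (c t) hw).1.le_tsum (⟨x, hxt⟩ : nonorthNorm L m μ (c t))
      fun y _ => beta_nonneg ?_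
    have := Ro_nonneg ((y : dualLattice Q L) : V) (c t)
    positivity
  have hnorm : S (c t) - (orthNorm L m μ (c t)).ncard * Real.log w ≤ ‖F (c t)‖ := by
    rw [hFS, Complex.norm_real]
    exact le_abs_self _
  have hlog : (orthNorm L m μ (c t)).ncard * Real.log w ≤
      (orthNorm L m μ z).ncard * |Real.log w| :=
    (mul_le_mul_of_nonneg_left (le_abs_self _) (Nat.cast_nonneg _)).trans
      (mul_le_mul_of_nonneg_right hcard (abs_nonneg _))
  simp only [Function.comp] at h5
  linarith

end Discontinuity

/-- Off the cycle no vector of norm `m` in the coset is orthogonal to `z`, so `N = 0` and the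
logarithmic term is void. It is retained so that the sum has the form of the regularized pairing. -/
lemma kudlaGreen_basisVec_of_notMem {V : Type*} [AddCommGroup V] [Module ℚ V]
    [FiniteDimensional ℚ V] {Q : QuadraticForm ℚ V} {p : ℕ} (hQ : HasSignature Q p 2)
    {L : Submodule ℤ V} [L.IsLattice ℚ] {w : ℝ} (hw : 0 < w) {m : ℚ} (μ : Disc Q L)
    {z : SymSpace Q} (hm : m ≠ 0) (hz : z ∉ specialCycle L m μ) :
    HasSum (fun x : GreenIndex Q L m => greenTerm L w (basisVec Q L μ) z x.1)
      ((∑' x : nonorthNorm L m μ z,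
        (beta (2 * Real.pi * w * Ro ((x : dualLattice Q L) : V) z) : ℂ)) -
          (orthNorm L m μ z).ncard * Real.log w) := by
  have h0 : orthNorm L m μ z = ∅ := Set.eq_empty_of_forall_notMem fun x hx =>
    hz (mem_specialCycle_of_mem_orthNorm hQ hm hx)
  have h := hasSum_greenTerm hQ m μ z hw (by simp [h0])
  rw [h0, Set.ncard_empty, Nat.cast_zero, zero_mul, sub_zero]
  exact h

end KudlaGreen
end

open KudlaGreen in
/-- `V` is a rational quadratic space of signature `(p, 2)`, `L ⊂ V` an even lattice, `w > 0`. -/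
theorem theorem3p3 {V : Type*} [AddCommGroup V] [Module ℚ V] [FiniteDimensional ℚ V]
    (Q : QuadraticForm ℚ V) (p : ℕ) (hQ : HasSignature Q p 2) (L : Submodule ℤ V) [L.IsLattice ℚ] (hL : IsEven Q L)
    (w : ℝ) (hw : 0 < w) :
    -- the regularized theta lift is defined at every point of the symmetric space
    (∀ (m : ℚ) (μ : Disc Q L) (z : SymSpace Q),
      RegPairingExists (poincare L p m w μ) (thetaAt L z)) ∧
    -- `m ≠ 0`
    (∀ (m : ℚ) (μ : Disc Q L) (z : SymSpace Q), m ≠ 0 → z ∉ specialCycle L m μ →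
      KudlaGreenConverges L m w (basisVec Q L μ) z ∧
      kudlaGreen L m w (basisVec Q L μ) z = regPairing (poincare L p m w μ) (thetaAt L z)) ∧
    -- `m = 0`
    (∀ (μ : Disc Q L) (z : SymSpace Q),
      KudlaGreenConverges L 0 w (basisVec Q L μ) z ∧
      kudlaGreen L 0 w (basisVec Q L μ) z =
        regPairing (poincare L p 0 w μ) (thetaAt L z) +
          (open scoped Classical in if μ = 0 then (Real.log w : ℂ) else 0)) ∧
    -- the extension is discontinuous at every point of the special cycle
    (∀ (m : ℚ) (μ : Disc Q L) (z : SymSpace Q), z ∈ specialCycle L m μ →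
      ¬ ContinuousAt (fun z' : SymSpace Q => regPairing (poincare L p m w μ) (thetaAt L z')) z) ∧
    -- the `S(L)^∨`-valued version
    (∀ (m : ℚ) (φ : SchwartzL Q L) (z : SymSpace Q),
      RegPairingExists (poincareVec L p m w φ) (thetaAt L z)) ∧
    (∀ (m : ℚ) (φ : SchwartzL Q L) (z : SymSpace Q), m ≠ 0 → z ∉ specialCycleVec L m →
      KudlaGreenConverges L m w φ z ∧
      kudlaGreen L m w φ z = regPairing (poincareVec L p m w φ) (thetaAt L z)) ∧
    (∀ (φ : SchwartzL Q L) (z : SymSpace Q),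
      KudlaGreenConverges L 0 w φ z ∧
      kudlaGreen L 0 w φ z =
        regPairing (poincareVec L p 0 w φ) (thetaAt L z) + (Real.log w : ℂ) * φ 0) := by
  refine ⟨fun m μ z => ⟨_, hasRegularizedIntegral_pairing hQ hL m μ z hw⟩, fun m μ z hm hz => ?_,
    fun μ z => ?_, fun m μ z hz => not_continuousAt_regPairing hQ hL m μ hw hz,
    fun m φ z => ?_, fun m φ z hm hz => ?_, fun φ z => ?_⟩
  · have h := kudlaGreen_basisVec_of_notMem hQ hw μ hm hz
    refine ⟨h.summable, h.tsum_eq.trans ?_⟩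
    rw [regPairing_eq (hasRegularizedIntegral_pairing hQ hL m μ z hw)]
  · have h := hasSum_greenTerm hQ 0 μ z hw fun x hx => eq_zero_of_mem_orthNorm_zero hQ hx
    refine ⟨h.summable, h.tsum_eq.trans ?_⟩
    classical
    -- For `m = 0` the pairing carries `-log w` exactly when `μ = 0`, which the added term
    -- compensates.
    rw [regPairing_eq (hasRegularizedIntegral_pairing hQ hL 0 μ z hw), ncard_orthNorm_zero hQ]
    split_ifs <;> simp
  · have := finite_disc hQ hL z
    have := Fintype.ofFinite (Disc Q L)
    exact ⟨_, hasRegularizedIntegral_pairing_vec hQ hL m φ z hw⟩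
  · have := finite_disc hQ hL z
    have := Fintype.ofFinite (Disc Q L)
    have h := hasSum_greenTerm_of_basisVec φ _ fun μ =>
      kudlaGreen_basisVec_of_notMem hQ hw μ hm fun h => hz (Set.mem_iUnion.2 ⟨μ, h⟩)
    refine ⟨h.summable, h.tsum_eq.trans ?_⟩
    rw [regPairing_eq (hasRegularizedIntegral_pairing_vec hQ hL m φ z hw)]
  · have := finite_disc hQ hL z
    have := Fintype.ofFinite (Disc Q L)
    have h := hasSum_greenTerm_of_basisVec φ _ fun μ =>
      hasSum_greenTerm hQ 0 μ z hw fun x hx => eq_zero_of_mem_orthNorm_zero hQ hx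
    refine ⟨h.summable, h.tsum_eq.trans ?_⟩
    rw [regPairing_eq (hasRegularizedIntegral_pairing_vec hQ hL 0 φ z hw)]
    classical
    simp only [ncard_orthNorm_zero hQ, mul_sub, Finset.sum_sub_distrib]
    have h1 : ∑ μ, φ μ * (((if μ = 0 then 1 else 0 : ℕ) : ℂ) * (Real.log w : ℂ)) =
        (Real.log w : ℂ) * φ 0 := by
      simp [mul_comm]
    rw [h1, sub_add_cancel]
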